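/- Notation. For a topological space $X$, $\dim X$ (respectively $\dim_0 X$) is the least integer $n\ge -1$ such that every finite open (respectively cozero) cover of $X$ has a finite open (respectively cozero) refinement of order at most $n$, meaning that no point lies in more than $n+1$ members; it is $\infty$ if there is no such $n$. $F(X)$ and $A(X)$ are the free and the free Abelian topological group of a completely regular Hausdorff space $X$, and $\oplus$ is the topological sum. For $A\subset C^n$, $n\ge 1$, the $n$-cardinality $|A|_n$ is the least cardinality of a set $Y\subset C$ such that every point of $A$ has a coordinate in $Y$; $A$ is $n$-uncountable if $|A|_n>\omega$. A set $B\subset C$ is weakly $n$-Bernstein with respect to a topology $\sigma$ on $C^n$ if $|A\cap B^n|_n=2^\omega$ for every $n$-uncountable $\sigma$-closed set $A\subset C^n$. Theorem. Let $C$ be the Cantor set in $[0,1]$ with its usual topology $\tau$, and let $\tau^n$ be the product topology on $C^n$. There exist a topology $\mu\supset\tau^2$ on $C^2$ that has at most $2^\omega$ $2$-uncountable closed sets, all of them of $2$-cardinality at least $2^\omega$; disjoint sets $S_1,S_2\subset C$ such that $S_1$, $S_2$ and $C\setminus(S_1\cup S_2)$ are weakly $2$-Bernstein with respect to $\mu$,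 and $S_1$, $S_2$ are weakly $n$-Bernstein with respect to $\tau^n$ for all $n\ge 1$; and topologies $\tau_1,\tau_2$ on $C$ such that, with $C_i=(C,\tau_i)$, for $i=1,2$: (1) $\tau_i\supset\tau$; (2) every $\tau_i$-neighborhood of any point of $S_i$ is a $\tau$-neighborhood of that point; (3) $\tau_i$ has a base consisting of $\tau$-closed sets; (4) $\dim C_i=\dim_0 C_i=0$; (5) $C_1\times C_2$ is normal (and Hausdorff) and $\dim(C_1\times C_2)=\dim_0(C_1\times C_2)=1$; and such that the space $X=C_1\oplus C_2$ is completely regular, Hausdorff and Lindelöf and has the following properties: (i) $\dim X=\dim_0 X=0$; (ii) $\dim A(X)>0$ and $\dim_0 A(X)>0$; (iii) $\dim F(X)>0$ and $\dim_0 F(X)>0$. In particular, the free and the free Abelian topological group of a strongly zero-dimensional space (one with $\dim_0=0$) need not be strongly zero-dimensional. -/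

import Mathlib

open scoped Cardinal Topology
open Set TopologicalSpace

/-- The set `α` regarded as a space with the topology `τ`. -/
def Retop {α : Type*} (_τ : TopologicalSpace α) : Type _ := α

instance {α : Type*} (τ : TopologicalSpace α) : TopologicalSpace (Retop τ) := τ

/-- Cozero sets: the sets `{x | f x ≠ 0}` with `f` a continuous real-valued function. -/
def IsCozeroSet {X : Type*} [TopologicalSpace X] (U : Set X) : Prop :=
  ∃ f : X → ℝ, Continuous f ∧ U = {x | f x ≠ 0}

/-- Every finite cover of `X` by sets with property `P` has a finite refinement that again is a
cover by sets with property `P` and has order at most `n`, that is, no point of `X` lies in more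
than `n + 1` of its members. -/
def CoverDimLE {X : Type*} (P : Set X → Prop) (n : ℤ) : Prop :=
  ∀ 𝒰 : Set (Set X), 𝒰.Finite → (∀ U ∈ 𝒰, P U) → ⋃₀ 𝒰 = univ →
    ∃ 𝒱 : Set (Set X), 𝒱.Finite ∧ (∀ V ∈ 𝒱, P V) ∧ ⋃₀ 𝒱 = univ ∧
      (∀ V ∈ 𝒱, ∃ U ∈ 𝒰, V ⊆ U) ∧ ∀ x : X, ({V ∈ 𝒱 | x ∈ V}.ncard : ℤ) ≤ n + 1

/-- The least integer `n ≥ -1` with `CoverDimLE P n`, and `⊤` (infinity) if there is none. -/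
noncomputable def coverDim {X : Type*} (P : Set X → Prop) : WithTop ℤ :=
  sInf ((fun n : ℤ => (n : WithTop ℤ)) '' {n : ℤ | -1 ≤ n ∧ CoverDimLE P n})

/-- The covering dimension `dim X` in the sense of Čech (finite open covers). -/
noncomputable def cechDim (X : Type*) [TopologicalSpace X] : WithTop ℤ :=
  coverDim (fun U : Set X => IsOpen U)

/-- The covering dimension `dim₀ X` in the sense of Katětov (finite cozero covers). -/
noncomputable def katetovDim (X : Type*) [TopologicalSpace X] : WithTop ℤ :=
  coverDim (fun U : Set X => IsCozeroSet U)

/-- The free topological group `F(X)`: the free group on the set `X` with the finest group topology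
for which the canonical map `X → F(X)` is continuous. -/
def FreeTopGroup (X : Type*) [TopologicalSpace X] : Type _ := FreeGroup X

namespace FreeTopGroup

variable (X : Type*) [TopologicalSpace X]

instance : Group (FreeTopGroup X) := inferInstanceAs (Group (FreeGroup X))

instance : TopologicalSpace (FreeTopGroup X) :=
  (GroupTopology.coinduced (FreeGroup.of : X → FreeGroup X)).toTopologicalSpace

instance : IsTopologicalGroup (FreeTopGroup X) :=
  (GroupTopology.coinduced (FreeGroup.of : X → FreeGroup X)).toIsTopologicalGroup

end FreeTopGroup

/-- The free Abelian topological group `A(X)`: the free Abelian group on the set `X` with the finest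
group topology for which the canonical map `X → A(X)` is continuous. -/
def FreeAbelianTopGroup (X : Type*) [TopologicalSpace X] : Type _ := FreeAbelianGroup X

namespace FreeAbelianTopGroup

variable (X : Type*) [TopologicalSpace X]

instance : AddCommGroup (FreeAbelianTopGroup X) :=
  inferInstanceAs (AddCommGroup (FreeAbelianGroup X))

instance : TopologicalSpace (FreeAbelianTopGroup X) :=
  (AddGroupTopology.coinduced (FreeAbelianGroup.of : X → FreeAbelianGroup X)).toTopologicalSpace

instance : IsTopologicalAddGroup (FreeAbelianTopGroup X) :=
  (AddGroupTopology.coinduced (FreeAbelianGroup.of : X → FreeAbelianGroup X)).toIsTopologicalAddGroup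

end FreeAbelianTopGroup

/-- The `n`-cardinality `|A|ₙ` of `A ⊆ Xⁿ` (for `n ≥ 1`): the least cardinality of a set `Y ⊆ X`
such that every point of `A` has at least one coordinate in `Y`. -/
noncomputable def nCard {X : Type*} {n : ℕ} (A : Set (Fin n → X)) : Cardinal :=
  sInf {κ | ∃ Y : Set X, #Y = κ ∧ ∀ x ∈ A, ∃ i, x i ∈ Y}

/-- `A ⊆ Xⁿ` is `n`-uncountable. -/
def NUncountable {X : Type*} {n : ℕ} (A : Set (Fin n → X)) : Prop := ℵ₀ < nCard A

/-- `B ⊆ X` is weakly `n`-Bernstein with respect to the topology `σ` on `Xⁿ`: `|A ∩ Bⁿ|ₙ = 2^ω` for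
every `n`-uncountable `σ`-closed set `A`. -/
def WeaklyBernstein {X : Type*} {n : ℕ} (σ : TopologicalSpace (Fin n → X)) (B : Set X) : Prop :=
  ∀ A : Set (Fin n → X), IsClosed[σ] A → NUncountable A →
    nCard (A ∩ {x | ∀ i, x i ∈ B}) = 𝔠

/-- The product topology `τⁿ` on `Xⁿ`. -/
abbrev powTopology {X : Type*} (τ : TopologicalSpace X) (n : ℕ) : TopologicalSpace (Fin n → X) :=
  @Pi.topologicalSpace (Fin n) (fun _ => X) (fun _ => τ)

/-- The conditions on an auxiliary topology `μ` on the square of the space `(X, τ)`: it is finer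
than the product topology, has at most `2^ω` closed sets that are `2`-uncountable, and each of these
has `2`-cardinality at least `2^ω`. -/
structure IsAdmissibleSquareTopology {X : Type*} (τ : TopologicalSpace X)
    (μ : TopologicalSpace (Fin 2 → X)) : Prop where
  le_product : μ ≤ powTopology τ 2
  card_closed_le : #{A : Set (Fin 2 → X) | IsClosed[μ] A ∧ NUncountable A} ≤ 𝔠
  le_nCard : ∀ A : Set (Fin 2 → X), IsClosed[μ] A → NUncountable A → 𝔠 ≤ nCard A

/-- The conditions on a topology `σ` on the space `(X, τ)` relative to a set `S ⊆ X`: `S` is weakly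
`n`-Bernstein with respect to `τⁿ` for every `n ≥ 1`; `σ` refines `τ`; every `σ`-neighbourhood of a
point of `S` is a `τ`-neighbourhood of it; `σ` has a base of `τ`-closed sets; and both covering
dimensions of `(X, σ)` are zero. -/
structure IsBernsteinRefinement {X : Type*} (τ : TopologicalSpace X) (S : Set X)
    (σ : TopologicalSpace X) : Prop where
  weaklyBernstein : ∀ n : ℕ, 1 ≤ n → WeaklyBernstein (powTopology τ n) S
  refines : σ ≤ τ
  mem_nhds : ∀ s ∈ S, ∀ U : Set X, U ∈ @nhds X σ s → U ∈ @nhds X τ s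
  exists_closed_base :
    ∃ 𝓑 : Set (Set X), @IsTopologicalBasis X σ 𝓑 ∧ ∀ B ∈ 𝓑, IsClosed[τ] B
  cechDim_eq : cechDim (Retop σ) = 0
  katetovDim_eq : katetovDim (Retop σ) = 0

/-- The usual topology on the Cantor set in `[0, 1] ⊆ ℝ`. -/
abbrev cantorTopology : TopologicalSpace cantorSet := instTopologicalSpaceSubtype

/-!
The binary digits of a point `x` of the Cantor set define its `height` in `[0, 1]`, and the function
`squareHeight` extends it from the diagonal to the square: at `(x, y)` with `x ≠ y` it only takes
account of the digits before the branches of `x` and `y` split, so it is locally constant there and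
all its irregularity sits on the diagonal. The topology `μ` on the square is that of the graph of
`squareHeight`. Transfinite recursion gives Bernstein sets `S 0`, `S 1`, `S 2` for `μ` and the
product topologies and, on `S 0`, points `x` with sequences in the square that converge to `(x, x)`
in `μ`, such that two sets whose closures in the graph share uncountably many points of the diagonal
always share the limit of one of these sequences. The coordinates of the sequences become
convergent in `τ₁` and `τ₂`, and points of `S 1`, respectively `S 2`, keep their neighbourhoods.

Then `squareHeight` is continuous on `C₁ × C₂`, and disjoint closed sets there have closures in the
graph that overlap only in a Lindelöf set. Hence `C₁ × C₂` is normal and its dimension is at most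
`1`. It is not `0`: if a clopen set contains the points of the diagonal of height `0` but none of
height at least `2 / 3`, then raising even digits greedily gives for every choice of the odd digits
a common limit, in the graph, of points of the diagonal inside and outside the set, although only
countably many such limits exist.

A word with an odd number of letters has an infinite branch of cylinders each of which contains an
odd number of its letters. Sending the word to the end of that branch retracts `A(C_i)` onto `C_i`,
and this is continuous since `τ_i` has a base of `τ`-closed sets. So `C₁ × C₂` is a retract of
`A(C₁ ⊕ C₂)` and of `F(C₁ ⊕ C₂)`, whose dimensions are therefore at least `1`.
-/

open Filter

section CoveringDimension

variable {X Y : Type*}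

theorem CoverDimLE.mono {P : Set X → Prop} {m n : ℤ} (h : CoverDimLE P m) (hmn : m ≤ n) :
    CoverDimLE P n := by
  intro 𝒰 hfin hP hcov
  obtain ⟨𝒱, h𝒱fin, h𝒱P, h𝒱cov, hsub, hord⟩ := h 𝒰 hfin hP hcov
  exact ⟨𝒱, h𝒱fin, h𝒱P, h𝒱cov, hsub, fun x => (hord x).trans (by lia)⟩

theorem coverDim_eq {P : Set X → Prop} {n : ℤ} (hn : -1 ≤ n) (h : CoverDimLE P n)
    (h' : ¬ CoverDimLE P (n - 1)) : coverDim P = n := by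
  refine IsLeast.csInf_eq ⟨⟨n, ⟨hn, h⟩, rfl⟩, ?_⟩
  rintro _ ⟨m, ⟨_, hm⟩, rfl⟩
  refine WithTop.coe_le_coe.2 ?_
  by_contra! hlt
  exact h' (hm.mono (by lia))

theorem coverDim_le_coverDim {P : Set X → Prop} {Q : Set Y → Prop}
    (h : ∀ n, CoverDimLE P n → CoverDimLE Q n) : coverDim Q ≤ coverDim P := by
  have hsub : {n : ℤ | -1 ≤ n ∧ CoverDimLE P n} ⊆ {n : ℤ | -1 ≤ n ∧ CoverDimLE Q n} :=
    fun n hn => ⟨hn.1, h n hn.2⟩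
  rcases {n : ℤ | -1 ≤ n ∧ CoverDimLE P n}.eq_empty_or_nonempty with hP | hP
  · simp only [coverDim, hP, image_empty, WithTop.sInf_empty, le_top]
  · refine csInf_le_csInf ⟨((-1 : ℤ) : WithTop ℤ), ?_⟩ (hP.image _) (image_mono hsub)
    rintro _ ⟨n, hn, rfl⟩
    exact WithTop.coe_le_coe.2 hn.1

theorem not_coverDimLE_neg_one [Nonempty X] {P : Set X → Prop} (hP : P univ) :
    ¬ CoverDimLE P (-1) := by
  intro h
  obtain ⟨𝒱, hfin, -, hcov, -, hord⟩ :=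
    h {univ} (finite_singleton _) (by simpa using hP) (sUnion_singleton _)
  obtain ⟨x⟩ := ‹Nonempty X›
  obtain ⟨V, hV, hxV⟩ : x ∈ ⋃₀ 𝒱 := hcov ▸ mem_univ x
  have hpos : 0 < {V ∈ 𝒱 | x ∈ V}.ncard :=
    (ncard_pos (hfin.subset (sep_subset _ _))).2 ⟨V, hV, hxV⟩
  have := hord x
  lia

theorem coverDim_eq_zero [Nonempty X] {P : Set X → Prop} (hP : P univ) (h : CoverDimLE P 0) :
    coverDim P = 0 :=
  coverDim_eq (by lia) h (not_coverDimLE_neg_one hP)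

theorem ncard_members_image_le {𝒱 : Set (Set X)} (hfin : 𝒱.Finite) (f : Set X → Set Y) {x : X}
    {y : Y} (hf : ∀ V ∈ 𝒱, y ∈ f V → x ∈ V) :
    {W ∈ f '' 𝒱 | y ∈ W}.ncard ≤ {V ∈ 𝒱 | x ∈ V}.ncard := by
  have hsub : {W ∈ f '' 𝒱 | y ∈ W} ⊆ f '' {V ∈ 𝒱 | x ∈ V} := by
    rintro _ ⟨⟨V, hV, rfl⟩, hy⟩
    exact ⟨V, ⟨hV, hf V hV hy⟩, rfl⟩
  have hmem : {V ∈ 𝒱 | x ∈ V}.Finite := hfin.subset (sep_subset _ _)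
  exact (ncard_le_ncard hsub (hmem.image f)).trans (ncard_image_le hmem)

theorem CoverDimLE.of_leftInverse {P : Set X → Prop} {Q : Set Y → Prop} {n : ℤ} {s : Y → X}
    {r : X → Y} (hrs : Function.LeftInverse r s) (hr : ∀ U, Q U → P (r ⁻¹' U))
    (hs : ∀ V, P V → Q (s ⁻¹' V)) (h : CoverDimLE P n) : CoverDimLE Q n := by
  intro 𝒰 hfin hQ hcov
  obtain ⟨𝒱, h𝒱fin, h𝒱P, h𝒱cov, hsub, hord⟩ := h (preimage r '' 𝒰) (hfin.image _)
    (forall_mem_image.2 fun U hU => hr U (hQ U hU))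
    (by rw [sUnion_image, ← preimage_sUnion, hcov, preimage_univ])
  refine ⟨preimage s '' 𝒱, h𝒱fin.image _, forall_mem_image.2 fun V hV => hs V (h𝒱P V hV),
    by rw [sUnion_image, ← preimage_sUnion, h𝒱cov, preimage_univ],
    forall_mem_image.2 fun V hV => ?_, fun y => ?_⟩
  · obtain ⟨_, ⟨U, hU, rfl⟩, hVU⟩ := hsub V hV
    exact ⟨U, hU, fun y hy => by simpa only [mem_preimage, hrs y] using hVU hy⟩
  · refine le_trans ?_ (hord (s y))
    exact_mod_cast ncard_members_image_le h𝒱fin (preimage s) fun V _ hy => hy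

theorem coverDimLE_of_disjoint_families {P : Set X → Prop} (k : ℕ)
    (h : ∀ 𝒰 : Set (Set X), 𝒰.Finite → (∀ U ∈ 𝒰, P U) → ⋃₀ 𝒰 = univ →
      ∃ A : Fin (k + 1) → 𝒰 → Set X, (∀ c i, P (A c i)) ∧ (∀ c i, A c i ⊆ i) ∧
        (∀ c, Pairwise (Function.onFun Disjoint (A c))) ∧ ⋃ c, ⋃ i, A c i = univ) :
    CoverDimLE P k := by
  intro 𝒰 hfin hP hcov
  obtain ⟨A, hAP, hAU, hdisj, hA⟩ := h 𝒰 hfin hP hcov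
  have := hfin.to_subtype
  refine ⟨range fun ci : Fin (k + 1) × 𝒰 => A ci.1 ci.2, finite_range _,
    forall_mem_range.2 fun ci => hAP ci.1 ci.2, ?_,
    forall_mem_range.2 fun ci => ⟨ci.2, ci.2.2, hAU ci.1 ci.2⟩, fun x => ?_⟩
  · rw [sUnion_range, iUnion_prod', hA]
  · have hcolor : ∀ V ∈ {V ∈ range fun ci : Fin (k + 1) × 𝒰 => A ci.1 ci.2 | x ∈ V},
        ∃ c i, A c i = V := by
      rintro _ ⟨⟨ci, rfl⟩, -⟩
      exact ⟨ci.1, ci.2, rfl⟩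
    choose! c hc using hcolor
    have hinj : InjOn c {V ∈ range fun ci : Fin (k + 1) × 𝒰 => A ci.1 ci.2 | x ∈ V} := by
      intro V hV W hW hVW
      obtain ⟨i, hi⟩ := hc V hV
      obtain ⟨j, hj⟩ := hc W hW
      rw [← hVW] at hj
      by_contra hne
      have hij : i ≠ j := fun h => hne (by rw [← hi, ← hj, h])
      exact disjoint_left.1 (hdisj _ hij) (hi ▸ hV.2) (hj ▸ hW.2)
    have hcard := ncard_le_ncard_of_injOn c (fun V _ => mem_univ (c V)) hinj
    rw [ncard_univ, Nat.card_fin] at hcard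
    exact_mod_cast hcard

section Topology

variable [TopologicalSpace X] [TopologicalSpace Y]

theorem IsCozeroSet.preimage {f : X → Y} (hf : Continuous f) {U : Set Y} (hU : IsCozeroSet U) :
    IsCozeroSet (f ⁻¹' U) := by
  obtain ⟨g, hg, rfl⟩ := hU
  exact ⟨g ∘ f, hg.comp hf, rfl⟩

theorem IsCozeroSet.isOpen {U : Set X} (hU : IsCozeroSet U) : IsOpen U := by
  obtain ⟨g, hg, rfl⟩ := hU
  exact isOpen_ne_fun hg continuous_const

theorem IsCozeroSet.of_isClopen {U : Set X} (hU : IsClopen U) : IsCozeroSet U := by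
  refine ⟨U.indicator 1, (continuous_const (y := (1 : ℝ))).indicator (by simp [hU.frontier_eq]), ?_⟩
  ext x
  by_cases h : x ∈ U <;> simp [h]

theorem isCozeroSet_setOf_lt {f g : X → ℝ} (hf : Continuous f) (hg : Continuous g) :
    IsCozeroSet {x | f x < g x} :=
  ⟨fun x => max (g x - f x) 0, by fun_prop, by
    ext x
    simp only [mem_ofPred_eq, ne_eq, max_eq_right_iff, not_le, sub_pos]⟩

theorem cechDim_le_of_leftInverse {s : Y → X} {r : X → Y} (hs : Continuous s) (hr : Continuous r)
    (hrs : Function.LeftInverse r s) : cechDim Y ≤ cechDim X :=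
  coverDim_le_coverDim fun _ =>
    .of_leftInverse hrs (fun _ hU => hU.preimage hr) fun _ hU => hU.preimage hs

theorem katetovDim_le_of_leftInverse {s : Y → X} {r : X → Y} (hs : Continuous s)
    (hr : Continuous r) (hrs : Function.LeftInverse r s) : katetovDim Y ≤ katetovDim X :=
  coverDim_le_coverDim fun _ =>
    .of_leftInverse hrs (fun _ hU => hU.preimage hr) fun _ hU => hU.preimage hs

theorem exists_cozero_shrinking [NormalSpace X] {ι : Type*} [Finite ι] {U : ι → Set X}
    (hU : ∀ i, IsOpen (U i)) (hcov : ⋃ i, U i = univ) :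
    ∃ V : ι → Set X, (∀ i, IsCozeroSet (V i)) ∧ (∀ i, V i ⊆ U i) ∧ ⋃ i, V i = univ := by
  obtain ⟨F, hF, hFc, hFU⟩ := exists_subset_iUnion_closed_subset isClosed_univ hU
    (fun x _ => toFinite _) hcov.ge
  choose f hf0 hf1 _ using fun i => exists_continuous_zero_one_of_isClosed
    (hU i).isClosed_compl (hFc i) (disjoint_compl_left_iff_subset.2 (hFU i))
  refine ⟨fun i => {x | f i x ≠ 0}, fun i => ⟨f i, (f i).continuous, rfl⟩,
    fun i x hx => by_contra fun h => hx (hf0 i h), eq_univ_of_forall fun x => ?_⟩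
  obtain ⟨i, hi⟩ := mem_iUnion.1 (hF (mem_univ x))
  exact mem_iUnion.2 ⟨i, by simp [hf1 i hi]⟩

theorem coverDimLE_isCozeroSet_of_isOpen [NormalSpace X] {n : ℤ}
    (h : CoverDimLE (fun U : Set X => IsOpen U) n) :
    CoverDimLE (fun U : Set X => IsCozeroSet U) n := by
  classical
  intro 𝒰 hfin hP hcov
  obtain ⟨𝒱, h𝒱fin, h𝒱o, h𝒱cov, hsub, hord⟩ := h 𝒰 hfin (fun U hU => (hP U hU).isOpen) hcov
  have := h𝒱fin.to_subtype
  obtain ⟨V, hV, hVsub, hVcov⟩ := exists_cozero_shrinking (U := fun W : 𝒱 => (W : Set X))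
    (fun W => h𝒱o W W.2) (by rwa [← sUnion_eq_iUnion])
  let shrink : Set X → Set X := fun W => if hW : W ∈ 𝒱 then V ⟨W, hW⟩ else ∅
  have hshrink (W : Set X) (hW : W ∈ 𝒱) : shrink W = V ⟨W, hW⟩ := dif_pos hW
  refine ⟨shrink '' 𝒱, h𝒱fin.image _, forall_mem_image.2 fun W hW => hshrink W hW ▸ hV _, ?_,
    forall_mem_image.2 fun W hW => ?_, fun x => ?_⟩
  · refine eq_univ_of_forall fun x => ?_
    obtain ⟨W, hx⟩ := mem_iUnion.1 (hVcov ▸ mem_univ x)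
    exact ⟨V W, ⟨W, W.2, hshrink W W.2⟩, hx⟩
  · obtain ⟨U, hU, hWU⟩ := hsub W hW
    exact ⟨U, hU, hshrink W hW ▸ (hVsub _).trans hWU⟩
  · refine le_trans ?_ (hord x)
    exact_mod_cast ncard_members_image_le h𝒱fin shrink
      fun W hW hx => hVsub ⟨W, hW⟩ (hshrink W hW ▸ hx)

theorem CoverDimLE.exists_isClopen {P : Set X → Prop} (hP : ∀ U, P U → IsOpen U)
    (h : CoverDimLE P 0) {U V : Set X} (hU : P U) (hV : P V) (hUV : U ∪ V = univ) :
    ∃ W, IsClopen W ∧ W ⊆ U ∧ Wᶜ ⊆ V := by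
  obtain ⟨𝒱, hfin, h𝒱P, hcov, hsub, hord⟩ :=
    h {U, V} (toFinite _) (by simp [hU, hV]) (by simpa using hUV)
  have hunique : ∀ x, ∀ W ∈ 𝒱, ∀ W' ∈ 𝒱, x ∈ W → x ∈ W' → W = W' := by
    intro x W hW W' hW' hx hx'
    have hle := hord x
    exact (ncard_le_one (s := {V ∈ 𝒱 | x ∈ V}) (hfin.subset (sep_subset _ _))).1 (by lia)
      _ ⟨hW, hx⟩ _ ⟨hW', hx'⟩
  have hcompl : (⋃₀ {W ∈ 𝒱 | W ⊆ U})ᶜ = ⋃₀ {W ∈ 𝒱 | ¬ W ⊆ U} := by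
    ext x
    obtain ⟨W, hW, hx⟩ : x ∈ ⋃₀ 𝒱 := hcov ▸ mem_univ x
    constructor
    · exact fun hn => ⟨W, ⟨hW, fun hWU => hn ⟨W, ⟨hW, hWU⟩, hx⟩⟩, hx⟩
    · rintro ⟨W', ⟨hW', hn⟩, hx'⟩ ⟨W'', ⟨hW'', hs⟩, hx''⟩
      exact hn (hunique x _ hW' _ hW'' hx' hx'' ▸ hs)
  refine ⟨⋃₀ {W ∈ 𝒱 | W ⊆ U}, ⟨⟨?_⟩, isOpen_sUnion fun W hW => hP _ (h𝒱P W hW.1)⟩,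
    sUnion_subset fun W hW => hW.2, ?_⟩
  · rw [hcompl]
    exact isOpen_sUnion fun W hW => hP _ (h𝒱P W hW.1)
  · rw [hcompl]
    refine sUnion_subset fun W hW => ?_
    obtain ⟨U', rfl | rfl, hs⟩ := hsub W hW.1
    exacts [absurd hs hW.2, hs]

end Topology

end CoveringDimension

section ZeroDimensional

variable {X ι : Type*} [TopologicalSpace X]

theorem isTopologicalBasis_isClopen_prod {Y : Type*} [TopologicalSpace Y]
    (hX : IsTopologicalBasis {s : Set X | IsClopen s})
    (hY : IsTopologicalBasis {s : Set Y | IsClopen s}) :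
    IsTopologicalBasis {s : Set (X × Y) | IsClopen s} :=
  (hX.prod hY).of_isOpen_of_subset (fun _ h => h.isOpen)
    (image2_subset_iff.2 fun _ hs _ ht => hs.prod ht)

theorem isTopologicalBasis_isClopen_sum {Y : Type*} [TopologicalSpace Y]
    (hX : IsTopologicalBasis {s : Set X | IsClopen s})
    (hY : IsTopologicalBasis {s : Set Y | IsClopen s}) :
    IsTopologicalBasis {s : Set (X ⊕ Y) | IsClopen s} :=
  (hX.sum hY).of_isOpen_of_subset (fun _ h => h.isOpen) (union_subset
    (image_subset_iff.2 fun _ hs => ⟨isClosedMap_inl _ hs.1, isOpenMap_inl _ hs.2⟩)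
    (image_subset_iff.2 fun _ hs => ⟨isClosedMap_inr _ hs.1, isOpenMap_inr _ hs.2⟩))

theorem pairwise_disjoint_biUnion_fiber {X ι κ : Type*} {W : κ → Set X}
    (hW : Pairwise (Function.onFun Disjoint W)) (i : κ → ι) :
    Pairwise (Function.onFun Disjoint fun j => ⋃ n ∈ {n | i n = j}, W n) := by
  refine fun j k hjk => disjoint_iUnion₂_left.2 fun n hn => disjoint_iUnion₂_right.2 fun m hm => ?_
  refine hW fun hnm => hjk ?_
  exact hn.symm.trans ((congrArg i hnm).trans hm)

theorem exists_isClopen_pairwise_disjoint_of_iUnion {E : Set X} (hE : IsClosed E) {W : ℕ → Set X}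
    (hW : ∀ n, IsClopen (W n)) (hWE : ⋃ n, W n = E) (i : ℕ → ι) :
    ∃ A : ι → Set X, (∀ j, IsClopen (A j)) ∧ (∀ j, A j ⊆ ⋃ n ∈ {n | i n = j}, W n) ∧
      Pairwise (Function.onFun Disjoint A) ∧ ⋃ j, A j = E := by
  have hD (n : ℕ) : IsClopen (disjointed W n) :=
    disjointedRec (p := IsClopen) (fun _ _ h => h.diff (hW _)) (hW n)
  set A : ι → Set X := fun j => ⋃ n ∈ {n | i n = j}, disjointed W n with hA
  have hAo (j : ι) : IsOpen (A j) := isOpen_biUnion fun n _ => (hD n).isOpen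
  have hAE : ⋃ j, A j = E := by
    rw [← hWE, ← iUnion_disjointed (f := W)]
    ext x
    simp [hA]
  have hAd : Pairwise (Function.onFun Disjoint A) :=
    pairwise_disjoint_biUnion_fiber (disjoint_disjointed W) i
  have hcompl (j : ι) : (A j)ᶜ = Eᶜ ∪ ⋃ k ∈ {k | k ≠ j}, A k := by
    ext x
    constructor
    · intro hx
      by_cases hxE : x ∈ E
      · obtain ⟨k, hk⟩ := mem_iUnion.1 (hAE ▸ hxE : x ∈ ⋃ j, A j)
        exact .inr (mem_biUnion (fun h => hx (h ▸ hk)) hk)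
      · exact .inl hxE
    · rintro (hx | hx) hxj
      · exact hx (hAE ▸ mem_iUnion.2 ⟨j, hxj⟩)
      · obtain ⟨k, hk, hxk⟩ := mem_iUnion₂.1 hx
        exact disjoint_left.1 (hAd hk) hxk hxj
  refine ⟨A, fun j => ⟨⟨?_⟩, hAo j⟩, fun j => iUnion₂_mono fun n _ => disjointed_subset W n, hAd,
    hAE⟩
  rw [hcompl]
  exact hE.isOpen_compl.union (isOpen_biUnion fun k _ => hAo k)

theorem exists_isClopen_refinement_of_isLindelof (hb : IsTopologicalBasis {s : Set X | IsClopen s})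
    {E : Set X} (hE : IsLindelof E) (hEc : IsClopen E) {U : ι → Set X} (hU : ∀ i, IsOpen (U i))
    (hcov : E ⊆ ⋃ i, U i) :
    ∃ A : ι → Set X, (∀ i, IsClopen (A i)) ∧ (∀ i, A i ⊆ U i) ∧
      Pairwise (Function.onFun Disjoint A) ∧ ⋃ i, A i = E := by
  rcases E.eq_empty_or_nonempty with rfl | hne
  · exact ⟨fun _ => ∅, fun _ => isClopen_empty, fun _ => empty_subset _,
      fun _ _ _ => disjoint_empty _, by simp⟩
  have hlocal (x : E) : ∃ i W, IsClopen W ∧ x.1 ∈ W ∧ W ⊆ U i ∩ E := by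
    obtain ⟨i, hi⟩ := mem_iUnion.1 (hcov x.2)
    exact ⟨i, hb.exists_subset_of_mem_open ⟨hi, x.2⟩ ((hU i).inter hEc.isOpen)⟩
  choose i W hW hxW hWU using hlocal
  have := hne.to_subtype
  obtain ⟨f, hf⟩ := hE.indexed_countable_subcover W (fun x => (hW x).isOpen)
    (fun x hx => mem_iUnion.2 ⟨⟨x, hx⟩, hxW ⟨x, hx⟩⟩)
  obtain ⟨A, hA, hAW, hAd, hAE⟩ := exists_isClopen_pairwise_disjoint_of_iUnion hEc.isClosed
    (fun n => hW (f n))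
    (subset_antisymm (iUnion_subset fun n => (hWU (f n)).trans inter_subset_right) hf)
    (fun n => i (f n))
  refine ⟨A, hA, fun j => (hAW j).trans (iUnion₂_subset ?_), hAd, hAE⟩
  rintro n rfl
  exact (hWU (f n)).trans inter_subset_left

theorem coverDimLE_zero_of_isTopologicalBasis_isClopen [LindelofSpace X]
    (hb : IsTopologicalBasis {s : Set X | IsClopen s}) {P : Set X → Prop}
    (hP : ∀ U, P U → IsOpen U) (hP' : ∀ U, IsClopen U → P U) : CoverDimLE P 0 := by
  refine coverDimLE_of_disjoint_families 0 fun 𝒰 _ hU hcov => ?_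
  obtain ⟨A, hA, hAU, hAd, hAcov⟩ := exists_isClopen_refinement_of_isLindelof hb isLindelof_univ
    isClopen_univ (U := fun i : 𝒰 => (i : Set X)) (fun i => hP _ (hU i i.2))
    (by rw [← sUnion_eq_iUnion, hcov])
  exact ⟨fun _ => A, fun _ i => hP' _ (hA i), fun _ => hAU, fun _ => hAd, by rwa [iUnion_const]⟩

theorem cechDim_eq_zero [LindelofSpace X] [Nonempty X]
    (hb : IsTopologicalBasis {s : Set X | IsClopen s}) : cechDim X = 0 :=
  coverDim_eq_zero isOpen_univ
    (coverDimLE_zero_of_isTopologicalBasis_isClopen hb (fun _ h => h) fun _ h => h.isOpen)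

theorem katetovDim_eq_zero [LindelofSpace X] [Nonempty X]
    (hb : IsTopologicalBasis {s : Set X | IsClopen s}) : katetovDim X = 0 :=
  coverDim_eq_zero (.of_isClopen isClopen_univ)
    (coverDimLE_zero_of_isTopologicalBasis_isClopen hb (fun _ h => h.isOpen)
      fun _ h => .of_isClopen h)

theorem exists_isClopen_iUnion_of_split {W : ℕ → Set X} (hW : ∀ n, IsClopen (W n))
    (hWd : Pairwise (Function.onFun Disjoint W)) {L N : Set X} (hN : IsOpen N)
    (hWN : (⋃ n, W n)ᶜ ⊆ N)
    (hsplit : ∀ n, ∃ B, IsClopen B ∧ B ⊆ W n ∧ Disjoint B N ∧ Disjoint (W n \ B) L) :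
    ∃ B : ℕ → Set X, (∀ n, IsClopen (B n)) ∧ (∀ n, B n ⊆ W n) ∧ IsClopen (⋃ n, B n) ∧
      L ∩ ⋃ n, W n ⊆ ⋃ n, B n := by
  choose B hB hBW hBN hBL using hsplit
  have hcompl : (⋃ n, B n)ᶜ = N ∪ ⋃ n, W n \ B n := by
    ext x
    constructor
    · intro hx
      by_cases hxW : x ∈ ⋃ n, W n
      · obtain ⟨n, hn⟩ := mem_iUnion.1 hxW
        exact .inr (mem_iUnion.2 ⟨n, hn, fun hxB => hx (mem_iUnion.2 ⟨n, hxB⟩)⟩)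
      · exact .inl (hWN hxW)
    · rintro (hx | hx) hxB <;> obtain ⟨n, hn⟩ := mem_iUnion.1 hxB
      · exact disjoint_left.1 (hBN n) hn hx
      · obtain ⟨m, hm, hmB⟩ := mem_iUnion.1 hx
        obtain rfl | hmn := eq_or_ne m n
        exacts [hmB hn, disjoint_left.1 (hWd hmn) hm (hBW n hn)]
  refine ⟨B, hB, hBW, ⟨⟨?_⟩, isOpen_iUnion fun n => (hB n).isOpen⟩, fun x hx => ?_⟩
  · rw [hcompl]
    exact hN.union (isOpen_iUnion fun n => ((hW n).diff (hB n)).isOpen)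
  · obtain ⟨n, hn⟩ := mem_iUnion.1 hx.2
    by_contra hxB
    exact disjoint_left.1 (hBL n) ⟨hn, fun h => hxB (mem_iUnion.2 ⟨n, h⟩)⟩ hx.1

theorem exists_isClopen_isLindelof_superset [NormalSpace X]
    (hb : IsTopologicalBasis {s : Set X | IsClopen s}) {L : Set X} (hL : IsLindelof L)
    (hLc : IsClosed L) (hloc : ∀ x ∈ L, ∃ W, IsClopen W ∧ IsLindelof W ∧ x ∈ W) :
    ∃ E, IsClopen E ∧ IsLindelof E ∧ L ⊆ E := by
  rcases L.eq_empty_or_nonempty with rfl | hne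
  · exact ⟨∅, isClopen_empty, isLindelof_empty, subset_rfl⟩
  choose V hV hVL hxV using fun x : L => hloc x x.2
  have := hne.to_subtype
  obtain ⟨f, hf⟩ := hL.indexed_countable_subcover V (fun x => (hV x).isOpen)
    (fun x hx => mem_iUnion.2 ⟨⟨x, hx⟩, hxV ⟨x, hx⟩⟩)
  set W : ℕ → Set X := disjointed (V ∘ f) with hWdef
  have hW (n : ℕ) : IsClopen (W n) :=
    disjointedRec (p := IsClopen) (fun _ _ h => h.diff (hV _)) (hV (f n))
  have hWL (n : ℕ) : IsLindelof (W n) :=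
    (hVL (f n)).of_isClosed_subset (hW n).isClosed (disjointed_subset (V ∘ f) n)
  have hLW : L ⊆ ⋃ n, W n := by rwa [hWdef, iUnion_disjointed]
  obtain ⟨N, hN, hWN, hNL⟩ := normal_exists_closure_subset
    (isOpen_iUnion fun n => (hW n).isOpen).isClosed_compl hLc.isOpen_compl
    (compl_subset_compl.2 hLW)
  have hsplit (n : ℕ) : ∃ B, IsClopen B ∧ B ⊆ W n ∧ Disjoint B N ∧ Disjoint (W n \ B) L := by
    obtain ⟨A, hA, hAU, -, hAW⟩ := exists_isClopen_refinement_of_isLindelof hb (hWL n) (hW n)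
      (U := fun b : Bool => cond b Lᶜ (closure N)ᶜ) (by simp [hLc.isOpen_compl])
      (fun x _ => mem_iUnion.2 <| by
        by_cases hx : x ∈ closure N
        exacts [⟨true, hNL hx⟩, ⟨false, hx⟩])
    refine ⟨A false, hA _, hAW ▸ subset_iUnion A false,
      (disjoint_compl_left_iff_subset.2 subset_closure).mono_left (hAU false),
      disjoint_left.2 fun x hx => hAU true ?_⟩
    obtain ⟨b, hb⟩ := mem_iUnion.1 (hAW ▸ hx.1)
    cases b
    exacts [absurd hb hx.2, hb]
  obtain ⟨B, hB, hBW, hBc, hLB⟩ :=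
    exists_isClopen_iUnion_of_split hW (disjoint_disjointed _) hN hWN hsplit
  exact ⟨⋃ n, B n, hBc,
    isLindelof_iUnion fun n => (hWL n).of_isClosed_subset (hB n).isClosed (hBW n),
    fun x hx => hLB ⟨hx, hLW hx⟩⟩

end ZeroDimensional

section LindelofOverlap

theorem hasSeparatingCover_of_countable {X : Type*} [TopologicalSpace X] {H K : Set X}
    {𝒮 : Set (Set X)} (hc : 𝒮.Countable) (ho : ∀ U ∈ 𝒮, IsOpen U ∧ Disjoint (closure U) K)
    (hH : H ⊆ ⋃₀ 𝒮) : HasSeparatingCover H K := by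
  obtain ⟨u, hu⟩ := (hc.insert ∅).exists_eq_range (insert_nonempty _ _)
  refine ⟨u, fun x hx => ?_, fun n => ?_⟩
  · obtain ⟨U, hU, hxU⟩ := hH hx
    obtain ⟨n, rfl⟩ : U ∈ range u := hu ▸ mem_insert_of_mem _ hU
    exact mem_iUnion.2 ⟨n, hxU⟩
  · rcases (hu ▸ mem_range_self n : u n ∈ insert ∅ 𝒮) with h | h
    · simp [h]
    · exact ho _ h

variable {Z M : Type*} [TopologicalSpace Z] [TopologicalSpace M]

/-- Disjoint closed sets of `Z` have closures in the coarser topology induced by `Φ` that meet in a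
set contained in a Lindelöf set. Normality and a bound on the dimension pass from `M` to `Z` along
such a map. -/
def LindelofOverlap (Φ : Z → M) : Prop :=
  ∀ H K : Set Z, IsClosed H → IsClosed K → Disjoint H K →
    ∃ T : Set Z, IsLindelof T ∧ Φ ⁻¹' (closure (Φ '' H) ∩ closure (Φ '' K)) ⊆ T

theorem LindelofOverlap.hasSeparatingCover [SecondCountableTopology M] [RegularSpace M]
    (hb : IsTopologicalBasis {s : Set Z | IsClopen s}) {Φ : Z → M} (hΦ : Continuous Φ)
    (hT : LindelofOverlap Φ) {H K : Set Z} (hH : IsClosed H) (hK : IsClosed K)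
    (hd : Disjoint H K) : HasSeparatingCover H K := by
  obtain ⟨T, hTL, hTs⟩ := hT H K hH hK hd
  have hregular : ∀ y ∈ (closure (Φ '' K))ᶜ,
      ∃ O, IsOpen O ∧ y ∈ O ∧ closure O ⊆ (closure (Φ '' K))ᶜ := by
    intro y hy
    obtain ⟨s, hs, hsc, hss⟩ := exists_mem_nhds_isClosed_subset
      (isClosed_closure.isOpen_compl.mem_nhds hy)
    exact ⟨interior s, isOpen_interior, mem_interior_iff_mem_nhds.2 hs,
      (closure_minimal interior_subset hsc).trans hss⟩
  choose! O hO hyO hOK using hregular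
  obtain ⟨t, htc, htK, ht⟩ := (HereditarilyLindelofSpace.isLindelof
    (closure (Φ '' K))ᶜ).elim_nhds_subcover O (fun y hy => (hO y hy).mem_nhds (hyO y hy))
  have hclopen : ∀ x ∈ T ∩ H, ∃ W, IsClopen W ∧ x ∈ W ∧ W ⊆ Kᶜ := fun x hx =>
    hb.exists_subset_of_mem_open (disjoint_left.1 hd hx.2) hK.isOpen_compl
  choose! W hW hxW hWK using hclopen
  obtain ⟨r, hrc, hrT, hr⟩ := (hTL.inter_right hH).elim_nhds_subcover W
    (fun x hx => (hW x hx).isOpen.mem_nhds (hxW x hx))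
  refine hasSeparatingCover_of_countable (𝒮 := ((fun y => Φ ⁻¹' O y) '' t) ∪ (W '' r))
    ((htc.image _).union (hrc.image _)) ?_ fun x hx => ?_
  · rintro _ (⟨y, hy, rfl⟩ | ⟨x, hx, rfl⟩)
    · refine ⟨(hO y (htK y hy)).preimage hΦ, disjoint_left.2 fun z hz hzK => ?_⟩
      exact hOK y (htK y hy) (hΦ.closure_preimage_subset _ hz)
        (subset_closure (mem_image_of_mem Φ hzK))
    · refine ⟨(hW x (hrT x hx)).isOpen, ?_⟩
      rw [(hW x (hrT x hx)).isClosed.closure_eq]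
      exact disjoint_left.2 fun z hz => hWK x (hrT x hx) hz
  · by_cases hxK : Φ x ∈ closure (Φ '' K)
    · obtain ⟨w, hw, hxw⟩ := mem_iUnion₂.1
        (hr ⟨hTs ⟨subset_closure (mem_image_of_mem Φ hx), hxK⟩, hx⟩)
      exact ⟨_, .inr ⟨w, hw, rfl⟩, hxw⟩
    · obtain ⟨w, hw, hxw⟩ := mem_iUnion₂.1 (ht hxK)
      exact ⟨_, .inl ⟨w, hw, rfl⟩, hxw⟩

theorem LindelofOverlap.normalSpace [SecondCountableTopology M] [RegularSpace M]
    (hb : IsTopologicalBasis {s : Set Z | IsClopen s}) {Φ : Z → M} (hΦ : Continuous Φ)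
    (hT : LindelofOverlap Φ) : NormalSpace Z where
  normal _ _ hH hK hd := hasSeparatingCovers_iff_separatedNhds.1
    ⟨hT.hasSeparatingCover hb hΦ hH hK hd, hT.hasSeparatingCover hb hΦ hK hH hd.symm⟩

theorem exists_pairwise_disjoint_isOpen_of_isClosed_superset {V F : ℕ → Set M}
    (hV : ∀ n, IsOpen (V n)) (hF : ∀ n, IsClosed (F n)) (hVF : ∀ n, V n ⊆ F n) :
    ∃ B : ℕ → Set M, (∀ n, IsOpen (B n)) ∧ (∀ n, B n ⊆ V n) ∧
      Pairwise (Function.onFun Disjoint B) ∧ (⋃ n, V n) \ (⋃ n, F n \ V n) ⊆ ⋃ n, B n := by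
  classical
  refine ⟨fun n => V n \ ⋃ m ∈ {m | m < n}, F m,
    fun n => (hV n).sdiff ((finite_lt_nat n).isClosed_biUnion fun m _ => hF m),
    fun n => sdiff_subset, (pairwise_disjoint_on _).2 fun m n hmn => ?_, ?_⟩
  · exact disjoint_left.2 fun p hpm hpn => hpn.2 (mem_biUnion hmn (hVF m hpm.1))
  · rintro p ⟨hp, hpF⟩
    have hex : ∃ n, p ∈ V n := mem_iUnion.1 hp
    refine mem_iUnion.2 ⟨Nat.find hex, Nat.find_spec hex, fun hmem => hpF ?_⟩
    obtain ⟨m, hm, hpm⟩ := mem_iUnion₂.1 hmem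
    exact mem_iUnion.2 ⟨m, hpm, Nat.find_min hex hm⟩

theorem exists_disjoint_open_off_levels {K ι : Type*} [TopologicalSpace K]
    [SecondCountableTopology K] (hK : IsTopologicalBasis {s : Set K | IsClopen s}) {Q : Set ℝ}
    (hQ : Dense Q) {V : ι → Set (K × ℝ)} (hV : ∀ i, IsOpen (V i)) :
    ∃ A : ι → Set (K × ℝ), (∀ i, IsOpen (A i)) ∧ (∀ i, A i ⊆ V i) ∧
      Pairwise (Function.onFun Disjoint A) ∧ (⋃ i, V i) ∩ {p | p.2 ∉ Q} ⊆ ⋃ i, A i := by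
  rcases (⋃ i, V i).eq_empty_or_nonempty with hemp | hne
  · exact ⟨fun _ => ∅, fun _ => isOpen_empty, fun _ => empty_subset _,
      fun _ _ _ => disjoint_empty _, by simp [hemp]⟩
  have hbox : ∀ p : ↥(⋃ i, V i), ∃ (i : ι) (D : Set K) (s t : ℝ), IsClopen D ∧ s ∈ Q ∧ t ∈ Q ∧
      p.1 ∈ D ×ˢ Ioo s t ∧ D ×ˢ Ioo s t ⊆ V i := by
    rintro ⟨⟨k, x⟩, hp⟩
    obtain ⟨i, hi⟩ := mem_iUnion.1 hp
    obtain ⟨D₀, I, hD₀, hI, hk, hx, hs⟩ := isOpen_prod_iff.1 (hV i) k x hi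
    obtain ⟨D, hD, hkD, hDD⟩ := hK.exists_subset_of_mem_open hk hD₀
    obtain ⟨l, u, hlu, hIs⟩ := mem_nhds_iff_exists_Ioo_subset.1 (hI.mem_nhds hx)
    obtain ⟨s, hsQ, hs1⟩ := hQ.exists_between hlu.1
    obtain ⟨t, htQ, ht1⟩ := hQ.exists_between hlu.2
    exact ⟨i, D, s, t, hD, hsQ, htQ, ⟨hkD, hs1.2, ht1.1⟩,
      (prod_mono hDD ((Ioo_subset_Ioo hs1.1.le ht1.2.le).trans hIs)).trans hs⟩
  choose i D s t hD hs ht hp hDV using hbox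
  have := hne.to_subtype
  obtain ⟨f, hf⟩ := (HereditarilyLindelofSpace.isLindelof (⋃ i, V i)).indexed_countable_subcover
    (fun p => D p ×ˢ Ioo (s p) (t p)) (fun p => (hD p).isOpen.prod isOpen_Ioo)
    (fun p h => mem_iUnion.2 ⟨⟨p, h⟩, hp ⟨p, h⟩⟩)
  obtain ⟨B, hBo, hBV, hBd, hB⟩ := exists_pairwise_disjoint_isOpen_of_isClosed_superset
    (V := fun n => D (f n) ×ˢ Ioo (s (f n)) (t (f n)))
    (F := fun n => D (f n) ×ˢ Icc (s (f n)) (t (f n)))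
    (fun n => (hD _).isOpen.prod isOpen_Ioo) (fun n => (hD _).isClosed.prod isClosed_Icc)
    (fun n => prod_mono_right Ioo_subset_Icc_self)
  refine ⟨fun j => ⋃ n ∈ {n | i (f n) = j}, B n, fun j => isOpen_biUnion fun n _ => hBo n,
    fun j => iUnion₂_subset ?_, pairwise_disjoint_biUnion_fiber hBd _, fun p hpV => ?_⟩
  · rintro n rfl
    exact (hBV n).trans (hDV _)
  · suffices hpB : p ∈ ⋃ n, B n by
      obtain ⟨n, hn⟩ := mem_iUnion.1 hpB
      exact mem_iUnion.2 ⟨i (f n), mem_biUnion rfl hn⟩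
    refine hB ⟨hf hpV.1, fun hmem => ?_⟩
    obtain ⟨n, ⟨hpD, hpI⟩, hpn⟩ := mem_iUnion.1 hmem
    have hlevel : ∀ {r}, r ∈ Q → p.2 ≠ r := fun hr h => hpV.2 (h ▸ hr)
    exact hpn ⟨hpD, hpI.1.lt_of_ne (hlevel (hs _)).symm, hpI.2.lt_of_ne (hlevel (ht _))⟩

theorem LindelofOverlap.exists_isOpen_isClopen_compl_subset [NormalSpace Z]
    (hb : IsTopologicalBasis {s : Set Z | IsClopen s}) {Φ : Z → M} (hΦ : Continuous Φ)
    (hT : LindelofOverlap Φ) (hloc : ∀ z : Z, ∃ W, IsClopen W ∧ IsLindelof W ∧ z ∈ W)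
    {ι : Type*} [Finite ι] {U : ι → Set Z} (hU : ∀ i, IsOpen (U i)) (hcov : ⋃ i, U i = univ) :
    ∃ (V : ι → Set M) (E : Set Z), (∀ i, IsOpen (V i)) ∧ (∀ i, Φ ⁻¹' V i ⊆ U i) ∧ IsClopen E ∧
      IsLindelof E ∧ Eᶜ ⊆ Φ ⁻¹' ⋃ i, V i := by
  obtain ⟨F, hF, hFc, hFU⟩ := exists_subset_iUnion_closed_subset isClosed_univ hU
    (fun x _ => toFinite _) hcov.ge
  choose T hTL hTs using fun i => hT (F i) (U i)ᶜ (hFc i) (hU i).isClosed_compl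
    (disjoint_compl_right_iff_subset.2 (hFU i))
  set V : ι → Set M := fun i => (closure (Φ '' (U i)ᶜ))ᶜ
  have hVo (i : ι) : IsOpen (V i) := isClosed_closure.isOpen_compl
  have hLc : IsClosed (Φ ⁻¹' ⋃ i, V i)ᶜ := ((isOpen_iUnion hVo).preimage hΦ).isClosed_compl
  have hLT : (Φ ⁻¹' ⋃ i, V i)ᶜ ⊆ ⋃ i, T i := by
    intro z hz
    obtain ⟨i, hi⟩ := mem_iUnion.1 (hF (mem_univ z))
    refine mem_iUnion.2 ⟨i, hTs i ⟨subset_closure (mem_image_of_mem Φ hi), ?_⟩⟩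
    by_contra h
    exact hz (mem_iUnion.2 ⟨i, h⟩)
  obtain ⟨E, hEc, hEL, hLE⟩ := exists_isClopen_isLindelof_superset hb
    ((isLindelof_iUnion hTL).of_isClosed_subset hLc hLT) hLc (fun z _ => hloc z)
  refine ⟨V, E, hVo, fun i z hz => ?_, hEc, hEL, compl_subset_comm.1 hLE⟩
  by_contra h
  exact hz (subset_closure (mem_image_of_mem Φ h))

theorem LindelofOverlap.coverDimLE_one {K : Type*} [TopologicalSpace K]
    [SecondCountableTopology K] (hK : IsTopologicalBasis {s : Set K | IsClopen s}) [NormalSpace Z]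
    (hb : IsTopologicalBasis {s : Set Z | IsClopen s}) {Φ : Z → K × ℝ} (hΦ : Continuous Φ)
    (hT : LindelofOverlap Φ) (hloc : ∀ z : Z, ∃ W, IsClopen W ∧ IsLindelof W ∧ z ∈ W) :
    CoverDimLE (fun U : Set Z => IsOpen U) 1 := by
  refine coverDimLE_of_disjoint_families 1 fun 𝒰 hfin hU hcov => ?_
  have := hfin.to_subtype
  have hUo (i : 𝒰) : IsOpen (i : Set Z) := hU i i.2
  have hUcov : ⋃ i : 𝒰, (i : Set Z) = univ := by rw [← sUnion_eq_iUnion, hcov]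
  obtain ⟨V, E, hVo, hVU, hEc, hEL, hEV⟩ :=
    hT.exists_isOpen_isClopen_compl_subset hb hΦ hloc hUo hUcov
  obtain ⟨G, hG, hGU, hGd, hGE⟩ := exists_isClopen_refinement_of_isLindelof hb hEL hEc hUo
    (hUcov ▸ subset_univ E)
  -- Every real number is missing from one of these two dense sets.
  let Q : Fin 2 → Set ℝ := ![range ((↑) : ℚ → ℝ), {x | Irrational x}]
  have hQ : ∀ c, Dense (Q c) := Fin.forall_fin_two.2 ⟨Rat.denseRange_cast, dense_irrational⟩
  choose A hAo hAV hAd hA using fun c => exists_disjoint_open_off_levels hK (hQ c) hVo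
  have hGsub (i : 𝒰) : G i ⊆ E := hGE ▸ subset_iUnion G i
  refine ⟨fun c i => (Φ ⁻¹' A c i \ E) ∪ G i,
    fun c i => (((hAo c i).preimage hΦ).sdiff hEc.isClosed).union (hG i).isOpen,
    fun c i => union_subset (sdiff_subset.trans ((preimage_mono (hAV c i)).trans (hVU i))) (hGU i),
    fun c i j hij => disjoint_left.2 ?_, eq_univ_of_forall fun z => ?_⟩
  · rintro z (hz | hz) (hz' | hz')
    · exact disjoint_left.1 (hAd c hij) hz.1 hz'.1
    · exact hz.2 (hGsub j hz')
    · exact hz'.2 (hGsub i hz)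
    · exact disjoint_left.1 (hGd hij) hz hz'
  · simp only [mem_iUnion]
    by_cases hzE : z ∈ E
    · obtain ⟨i, hi⟩ := mem_iUnion.1 (hGE ▸ hzE : z ∈ ⋃ i, G i)
      exact ⟨0, i, .inr hi⟩
    · obtain ⟨c, hc⟩ : ∃ c, (Φ z).2 ∉ Q c := by
        by_cases hz : (Φ z).2 ∈ Q 0
        exacts [⟨1, not_not.2 hz⟩, ⟨0, hz⟩]
      obtain ⟨i, hi⟩ := mem_iUnion.1 (hA c ⟨hEV hzE, hc⟩)
      exact ⟨c, i, .inl ⟨hi, hzE⟩⟩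

end LindelofOverlap

section BinaryTree

section Cylinder

variable {X : Type*} {b : X → ℕ → Bool}

/-- The set of the points that agree with `x` in the first `n` of their binary digits, which are
given by `b`. -/
def cylinder (b : X → ℕ → Bool) (x : X) (n : ℕ) : Set X := b ⁻¹' PiNat.cylinder (b x) n

theorem mem_cylinder_self (x : X) (n : ℕ) : x ∈ cylinder b x n := PiNat.self_mem_cylinder _ _

theorem cylinder_anti (x : X) {m n : ℕ} (h : m ≤ n) : cylinder b x n ⊆ cylinder b x m :=
  preimage_mono (PiNat.cylinder_anti _ h)

theorem cylinder_eq_of_mem {x y : X} {n : ℕ} (h : y ∈ cylinder b x n) :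
    cylinder b y n = cylinder b x n :=
  congrArg (preimage b) (PiNat.mem_cylinder_iff_eq.1 h)

theorem isClopen_cylinder_of_continuous [TopologicalSpace X] (hb : Continuous b) (x : X) (n : ℕ) :
    IsClopen (cylinder b x n) := by
  rw [cylinder, PiNat.cylinder_eq_pi, Set.pi_def]
  exact ((Finset.finite_toSet _).isClopen_biInter fun k _ =>
    (isClopen_discrete _).preimage (continuous_apply k)).preimage hb

end Cylinder

variable {C : Type*} [TopologicalSpace C] (e : C ≃ₜ (ℕ → Bool))

/-- The level at which the branches of `x` and `y` in the binary tree split: the first digit in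
which they differ (`0` if `x = y`). -/
noncomputable def splitLevel (x y : C) : ℕ := PiNat.firstDiff (e x) (e y)

variable {e}

theorem isClopen_cylinder (x : C) (n : ℕ) : IsClopen (cylinder e x n) :=
  isClopen_cylinder_of_continuous e.continuous x n

theorem cylinder_mem_nhds (x : C) (n : ℕ) : cylinder e x n ∈ 𝓝 x :=
  (isClopen_cylinder x n).isOpen.mem_nhds (mem_cylinder_self x n)

theorem exists_cylinder_subset {x : C} {U : Set C} (hU : U ∈ 𝓝 x) : ∃ n, cylinder e x n ⊆ U := by
  obtain ⟨V, hV, hVo, hxV⟩ := mem_nhds_iff.1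
    (e.symm.continuous.continuousAt.preimage_mem_nhds (by simpa) : e.symm ⁻¹' U ∈ 𝓝 (e x))
  obtain ⟨_, ⟨y, n, rfl⟩, hx, hs⟩ :=
    (PiNat.isTopologicalBasis_cylinders (fun _ => Bool)).exists_subset_of_mem_open hxV hVo
  rw [← PiNat.mem_cylinder_iff_eq.1 hx] at hs
  exact ⟨n, fun z hz => by simpa using hV (hs hz)⟩

theorem hasBasis_nhds_cylinder (x : C) : (𝓝 x).HasBasis (fun _ : ℕ => True) (cylinder e x) :=
  ⟨fun _ => ⟨fun h => (exists_cylinder_subset h).imp fun _ h => ⟨trivial, h⟩,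
    fun ⟨n, _, h⟩ => mem_of_superset (cylinder_mem_nhds x n) h⟩⟩

theorem isTopologicalBasis_isClopen_of_homeomorph (e : C ≃ₜ (ℕ → Bool)) :
    IsTopologicalBasis {s : Set C | IsClopen s} :=
  isTopologicalBasis_of_isOpen_of_nhds (fun _ h => h.isOpen) fun x _ hx hU =>
    let ⟨n, hn⟩ := exists_cylinder_subset (e := e) (hU.mem_nhds hx)
    ⟨_, isClopen_cylinder x n, mem_cylinder_self x n, hn⟩

theorem splitLevel_comm (x y : C) : splitLevel e x y = splitLevel e y x :=
  PiNat.firstDiff_comm _ _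

theorem apply_splitLevel_ne {x y : C} (h : x ≠ y) :
    e x (splitLevel e x y) ≠ e y (splitLevel e x y) :=
  PiNat.apply_firstDiff_ne (e.injective.ne h)

theorem apply_eq_of_lt_splitLevel {x y : C} {n : ℕ} (h : n < splitLevel e x y) : e x n = e y n :=
  PiNat.apply_eq_of_lt_firstDiff h

theorem splitLevel_eq {x y : C} {n : ℕ} (h : ∀ k < n, e x k = e y k) (hn : e x n ≠ e y n) :
    splitLevel e x y = n := by
  have hne : x ≠ y := by
    rintro rfl
    exact hn rfl
  rcases lt_trichotomy (splitLevel e x y) n with h' | h' | h'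
  · exact absurd (h _ h') (apply_splitLevel_ne hne)
  · exact h'
  · exact absurd (apply_eq_of_lt_splitLevel h') hn

theorem mem_cylinder_iff {x y : C} (h : x ≠ y) {n : ℕ} :
    y ∈ cylinder e x n ↔ n ≤ splitLevel e x y := by
  rw [splitLevel_comm]
  exact PiNat.mem_cylinder_iff_le_firstDiff (e.injective.ne h.symm) n

theorem mem_cylinder_splitLevel (x y : C) : y ∈ cylinder e x (splitLevel e x y) :=
  fun _ hk => (apply_eq_of_lt_splitLevel hk).symm

theorem exists_notMem_cylinder {x y : C} (h : x ≠ y) : ∃ n, y ∉ cylinder e x n :=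
  ⟨splitLevel e x y + 1, fun hy => by have := (mem_cylinder_iff h).1 hy; lia⟩

theorem splitLevel_congr {x x' y y' : C} {n : ℕ} (h : x ≠ x') (hn : splitLevel e x x' < n)
    (hy : y ∈ cylinder e x n) (hy' : y' ∈ cylinder e x' n) :
    y ≠ y' ∧ splitLevel e y y' = splitLevel e x x' := by
  have hdigit : e y (splitLevel e x x') ≠ e y' (splitLevel e x x') := by
    rw [hy _ hn, hy' _ hn]
    exact apply_splitLevel_ne h
  refine ⟨fun hyy' => hdigit (by rw [hyy']), splitLevel_eq (fun k hk => ?_) hdigit⟩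
  rw [hy _ (hk.trans hn), hy' _ (hk.trans hn), apply_eq_of_lt_splitLevel hk]

theorem splitLevel_le_of_ne {u v x : C} (h : splitLevel e u x ≠ splitLevel e v x) (hu : u ≠ x)
    (hv : v ≠ x) : u ≠ v ∧ splitLevel e u v ≤ splitLevel e u x := by
  refine ⟨fun huv => h (by rw [huv]), ?_⟩
  rcases lt_or_gt_of_ne h with h' | h'
  · refine (splitLevel_eq (fun k hk => ?_) ?_).le
    · rw [apply_eq_of_lt_splitLevel hk, apply_eq_of_lt_splitLevel (hk.trans h')]
    · rw [apply_eq_of_lt_splitLevel h']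
      exact apply_splitLevel_ne hu
  · refine (splitLevel_eq (n := splitLevel e v x) (fun k hk => ?_) ?_).le.trans h'.le
    · rw [apply_eq_of_lt_splitLevel hk, apply_eq_of_lt_splitLevel (hk.trans h')]
    · rw [apply_eq_of_lt_splitLevel h']
      exact (apply_splitLevel_ne hv).symm

variable (e)

/-- The sum of `1 / (k + 1)` over the even `k < n` for which the digit `k` of `x` is `1`. Only even
digits contribute, so that the odd ones remain free for coding. -/
noncomputable def evenDigitSum (n : ℕ) (x : C) : ℝ :=
  ∑ k ∈ Finset.range n, if Even k ∧ e x k = true then (1 / (k + 1) : ℝ) else 0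

/-- The sum `evenDigitSum` cut off at `1`. -/
noncomputable def partialHeight (n : ℕ) (x : C) : ℝ := min 1 (evenDigitSum e n x)

/-- The limit of the functions `partialHeight`, a lower semicontinuous function to `[0, 1]`. -/
noncomputable def height (x : C) : ℝ := ⨆ n, partialHeight e n x

/-- The function on the square that equals `height` on the diagonal and is, off the diagonal, the
sum over the digits before the two branches split. -/
noncomputable def squareHeight (p : C × C) : ℝ :=
  open Classical in
  if p.1 = p.2 then height e p.1 else partialHeight e (splitLevel e p.1 p.2) p.1

variable {e}

theorem evenDigitSum_mono (x : C) : Monotone fun n => evenDigitSum e n x := fun m n h =>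
  Finset.sum_le_sum_of_subset_of_nonneg (Finset.range_mono h) fun k _ _ => by
    split_ifs <;> positivity

theorem evenDigitSum_congr {x y : C} {n : ℕ} (h : y ∈ cylinder e x n) :
    evenDigitSum e n y = evenDigitSum e n x :=
  Finset.sum_congr rfl fun k hk => by rw [h k (Finset.mem_range.1 hk)]

theorem partialHeight_mono (x : C) : Monotone fun n => partialHeight e n x := fun _ _ h =>
  min_le_min le_rfl (evenDigitSum_mono x h)

theorem partialHeight_zero (x : C) : partialHeight e 0 x = 0 := by
  simp [partialHeight, evenDigitSum]

theorem partialHeight_nonneg (n : ℕ) (x : C) : 0 ≤ partialHeight e n x :=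
  (partialHeight_zero x).symm.trans_le (partialHeight_mono x n.zero_le)

theorem partialHeight_le_one (n : ℕ) (x : C) : partialHeight e n x ≤ 1 := min_le_left _ _

theorem partialHeight_congr {x y : C} {n : ℕ} (h : y ∈ cylinder e x n) :
    partialHeight e n y = partialHeight e n x :=
  congrArg (min 1) (evenDigitSum_congr h)

theorem bddAbove_range_partialHeight (x : C) : BddAbove (range fun n => partialHeight e n x) :=
  ⟨1, forall_mem_range.2 fun n => partialHeight_le_one n x⟩

theorem partialHeight_le_height (n : ℕ) (x : C) : partialHeight e n x ≤ height e x :=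
  le_ciSup (bddAbove_range_partialHeight x) n

theorem tendsto_partialHeight (x : C) :
    Tendsto (fun n => partialHeight e n x) atTop (𝓝 (height e x)) :=
  tendsto_atTop_ciSup (partialHeight_mono x) (bddAbove_range_partialHeight x)

theorem squareHeight_self (x : C) : squareHeight e (x, x) = height e x := if_pos rfl

theorem squareHeight_of_ne {x y : C} (h : x ≠ y) :
    squareHeight e (x, y) = partialHeight e (splitLevel e x y) x := if_neg h

theorem squareHeight_le_left (x y : C) : squareHeight e (x, y) ≤ height e x := by
  obtain rfl | h := eq_or_ne x y
  · rw [squareHeight_self]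
  · exact (squareHeight_of_ne h).trans_le (partialHeight_le_height _ _)

theorem squareHeight_le_right (x y : C) : squareHeight e (x, y) ≤ height e y := by
  obtain rfl | h := eq_or_ne x y
  · rw [squareHeight_self]
  · rw [squareHeight_of_ne h, ← partialHeight_congr (mem_cylinder_splitLevel x y)]
    exact partialHeight_le_height _ _

theorem partialHeight_le_squareHeight {x y y' : C} {n : ℕ} (hy : y ∈ cylinder e x n)
    (hy' : y' ∈ cylinder e x n) : partialHeight e n x ≤ squareHeight e (y, y') := by
  rw [← partialHeight_congr hy]
  obtain rfl | h := eq_or_ne y y'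
  · rw [squareHeight_self]
    exact partialHeight_le_height _ _
  · rw [squareHeight_of_ne h]
    exact partialHeight_mono _ ((mem_cylinder_iff h).1 (by rwa [cylinder_eq_of_mem hy]))

theorem squareHeight_congr {x x' y y' : C} {n : ℕ} (h : x ≠ x') (hn : splitLevel e x x' < n)
    (hy : y ∈ cylinder e x n) (hy' : y' ∈ cylinder e x' n) :
    squareHeight e (y, y') = squareHeight e (x, x') := by
  obtain ⟨hne, hlevel⟩ := splitLevel_congr h hn hy hy'
  rw [squareHeight_of_ne h, squareHeight_of_ne hne, hlevel,
    partialHeight_congr (cylinder_anti x hn.le hy)]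

theorem squareHeight_le_of_splitLevel_ne {u v x : C} (h : splitLevel e u x ≠ splitLevel e v x)
    (hu : u ≠ x) (hv : v ≠ x) : squareHeight e (u, v) ≤ height e x := by
  obtain ⟨huv, hle⟩ := splitLevel_le_of_ne h hu hv
  rw [squareHeight_of_ne huv,
    ← partialHeight_congr (cylinder_anti u hle (mem_cylinder_splitLevel u x))]
  exact partialHeight_le_height _ _

theorem continuousAt_squareHeight {p : C × C} (hp : p.1 ≠ p.2) :
    ContinuousAt (squareHeight e) p := by
  have hconst : squareHeight e =ᶠ[𝓝 p] fun _ => squareHeight e p := by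
    filter_upwards [prod_mem_nhds (cylinder_mem_nhds (e := e) p.1 _)
      (cylinder_mem_nhds (e := e) p.2 _)] with q hq
    exact squareHeight_congr hp (Nat.lt_succ_self (splitLevel e p.1 p.2)) hq.1 hq.2
  exact continuousAt_const.congr hconst.symm

end BinaryTree

section SequenceTopology

variable {C : Type*} [TopologicalSpace C]

/-- The topology in which points of `S` have the given neighbourhoods and each point `x ∉ S` is the
limit of the sequence `a x`; the sets `U` are open that contain, with each of their points `x`,
almost all points of `a x`, and that are neighbourhoods of their points in `S`. -/
@[reducible]
def seqTopology (S : Set C) (a : C → ℕ → C) : TopologicalSpace C where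
  IsOpen U := ∀ x ∈ U, (x ∈ S → U ∈ 𝓝 x) ∧ ∀ᶠ n in atTop, a x n ∈ U
  isOpen_univ := by simp
  isOpen_inter U V hU hV x hx := ⟨fun hS => inter_mem ((hU x hx.1).1 hS) ((hV x hx.2).1 hS),
    (hU x hx.1).2.and (hV x hx.2).2⟩
  isOpen_sUnion 𝒰 h x hx := by
    obtain ⟨U, hU, hxU⟩ := hx
    exact ⟨fun hS => mem_of_superset ((h U hU x hxU).1 hS) (subset_sUnion_of_mem hU),
      (h U hU x hxU).2.mono fun n hn => ⟨U, hU, hn⟩⟩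

variable {S : Set C} {a : C → ℕ → C}

theorem mem_nhds_of_mem_nhds_seqTopology {s : C} (hs : s ∈ S) {U : Set C}
    (hU : U ∈ @nhds C (seqTopology S a) s) : U ∈ 𝓝 s := by
  obtain ⟨V, hVU, hV, hsV⟩ := (@mem_nhds_iff C (seqTopology S a) s U).1 hU
  exact mem_of_superset ((hV s hsV).1 hs) hVU

theorem seqTopology_le (ha : ∀ x, Tendsto (a x) atTop (𝓝 x)) :
    seqTopology S a ≤ ‹TopologicalSpace C› := fun _ hU x hx =>
  ⟨fun _ => hU.mem_nhds hx, ha x (hU.mem_nhds hx)⟩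

theorem isOpen_seqTopology_singleton {x : C} (hx : x ∉ S) (hax : ∀ n, a x n = x) :
    IsOpen[seqTopology S a] {x} := by
  rintro _ rfl
  exact ⟨fun h => absurd h hx, by simp [hax]⟩

theorem isOpen_seqTopology_insert {x : C} (hx : x ∉ S) {P : ℕ → Set C} {m : ℕ}
    (hP : ∀ n ≥ m, IsOpen[seqTopology S a] (P n)) (ha : ∀ n ≥ m, a x n ∈ P n) :
    IsOpen[seqTopology S a] ({x} ∪ ⋃ n ∈ {n | m ≤ n}, P n) := by
  rintro y (rfl | hy)
  · refine ⟨fun h => absurd h hx, ?_⟩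
    filter_upwards [eventually_ge_atTop m] with n hn
    exact .inr (mem_biUnion (show n ∈ {n | m ≤ n} from hn) (ha n hn))
  · obtain ⟨n, hn, hyn⟩ := mem_iUnion₂.1 hy
    have hs : P n ⊆ {x} ∪ ⋃ n ∈ {n | m ≤ n}, P n :=
      (subset_biUnion_of_mem (u := P) hn).trans subset_union_right
    exact ⟨fun h => mem_of_superset ((hP n hn y hyn).1 h) hs,
      (hP n hn y hyn).2.mono fun k hk => hs hk⟩

theorem isClosed_insert_of_tendsto {e : C ≃ₜ (ℕ → Bool)} {x : C} {u : ℕ → C}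
    (hu : Tendsto u atTop (𝓝 x)) {P : ℕ → Set C} {m : ℕ} (hP : ∀ n ≥ m, IsClosed (P n))
    (hPu : ∀ n ≥ m, P n ⊆ cylinder e (u n) n) : IsClosed ({x} ∪ ⋃ n ∈ {n | m ≤ n}, P n) := by
  rw [← isOpen_compl_iff, isOpen_iff_mem_nhds]
  intro y hy
  obtain ⟨k, hk⟩ := exists_notMem_cylinder (e := e) fun h : x = y => hy (.inl h.symm)
  obtain ⟨N, hN⟩ := eventually_atTop.1 (hu (cylinder_mem_nhds (e := e) x k))
  have hclosed : IsClosed (⋃ n ∈ {n | m ≤ n ∧ n < max N k}, P n) :=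
    Set.Finite.isClosed_biUnion ((finite_lt_nat (max N k)).subset fun n hn => hn.2)
      fun n hn => hP n hn.1
  have hyP : y ∈ (⋃ n ∈ {n | m ≤ n ∧ n < max N k}, P n)ᶜ := fun h => by
    obtain ⟨n, hn, hyn⟩ := mem_iUnion₂.1 h
    exact hy (.inr (mem_biUnion hn.1 hyn))
  filter_upwards [hclosed.isOpen_compl.mem_nhds hyP,
    (isClopen_cylinder x k).compl.isOpen.mem_nhds hk] with z hz hzk
  rintro (rfl | hzP)
  · exact hzk (mem_cylinder_self _ _)
  · obtain ⟨n, hn, hzn⟩ := mem_iUnion₂.1 hzP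
    rcases lt_or_ge n (max N k) with h | h
    · exact hz (mem_biUnion (show n ∈ {n | m ≤ n ∧ n < max N k} from ⟨hn, h⟩) hzn)
    · refine hzk ?_
      rw [← cylinder_eq_of_mem (hN n ((le_max_left _ _).trans h))]
      exact cylinder_anti _ ((le_max_right _ _).trans h) (hPu n hn hzn)

theorem exists_isOpen_seqTopology_isClosed_subset (e : C ≃ₜ (ℕ → Bool)) {rk : C → Ordinal}
    (ha : ∀ x, Tendsto (a x) atTop (𝓝 x))
    (hrk : ∀ x, (∀ n, a x n = x) ∨ ∀ n, rk (a x n) < rk x) (x : C) {U : Set C}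
    (hU : IsOpen[seqTopology S a] U) (hx : x ∈ U) :
    ∃ W, IsOpen[seqTopology S a] W ∧ IsClosed W ∧ x ∈ W ∧ W ⊆ U := by
  induction h : rk x using WellFoundedLT.induction generalizing x U with
  | ind r ih =>
    by_cases hxS : x ∈ S
    · obtain ⟨n, hn⟩ := exists_cylinder_subset (e := e) ((hU x hx).1 hxS)
      exact ⟨_, seqTopology_le ha _ (isClopen_cylinder x n).isOpen,
        (isClopen_cylinder x n).isClosed, mem_cylinder_self x n, hn⟩
    rcases hrk x with hconst | hlt
    · have : T1Space C := e.symm.t1Space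
      exact ⟨{x}, isOpen_seqTopology_singleton hxS hconst, isClosed_singleton, rfl, by simpa⟩
    · obtain ⟨m, hm⟩ := eventually_atTop.1 (hU x hx).2
      have hstep (n : ℕ) (hn : n ≥ m) : ∃ P, IsOpen[seqTopology S a] P ∧ IsClosed P ∧
          a x n ∈ P ∧ P ⊆ U ∩ cylinder e (a x n) n :=
        ih _ (h ▸ hlt n) (a x n) (@IsOpen.inter _ (seqTopology S a) _ _ hU
          (seqTopology_le ha _ (isClopen_cylinder (e := e) (a x n) n).isOpen))
          ⟨hm n hn, mem_cylinder_self _ _⟩ rfl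
      choose! P hPo hPc haP hPU using hstep
      refine ⟨{x} ∪ ⋃ n ∈ {n | m ≤ n}, P n, isOpen_seqTopology_insert hxS hPo haP,
        isClosed_insert_of_tendsto (e := e) (ha x) hPc
          fun n hn => (hPU n hn).trans inter_subset_right, .inl rfl, ?_⟩
      exact union_subset (by simpa using hx)
        (iUnion₂_subset fun n hn => (hPU n hn).trans inter_subset_left)

theorem lindelofSpace_seqTopology [SecondCountableTopology C]
    (hS : ∀ A : Set C, IsClosed A → Disjoint A S → A.Countable) :
    LindelofSpace (Retop (seqTopology S a)) := by
  refine isLindelof_univ_iff.1 (isLindelof_of_countable_subcover fun {ι} U hU hc => ?_)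
  have hU' : ∀ i, IsOpen[seqTopology S a] (U i : Set C) := hU
  let V : ι → Set C := fun i => @interior C ‹TopologicalSpace C› (U i)
  obtain ⟨t, ht, htV⟩ := eq_open_union_countable V (fun i => isOpen_interior)
  have hdisj : Disjoint (⋃ i, V i)ᶜ S := by
    refine disjoint_left.2 fun x hx hxS => hx ?_
    obtain ⟨i, hi⟩ := mem_iUnion.1 (hc (mem_univ x))
    exact mem_iUnion.2 ⟨i, mem_interior_iff_mem_nhds.2 ((hU' i x hi).1 hxS)⟩
  have hcount := hS _ (isOpen_iUnion fun i => isOpen_interior).isClosed_compl hdisj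
  choose i hi using fun x : C => mem_iUnion.1 (hc (mem_univ x))
  refine ⟨t ∪ i '' (⋃ i, V i)ᶜ, ht.union (hcount.image _), fun x _ => ?_⟩
  by_cases hx : x ∈ ⋃ i, V i
  · rw [← htV] at hx
    obtain ⟨j, hj, hxj⟩ := mem_iUnion₂.1 hx
    exact mem_biUnion (.inl hj) (@interior_subset C ‹TopologicalSpace C› (U j) x hxj)
  · exact mem_biUnion (.inr ⟨x, hx, rfl⟩) (hi x)

/-- The identity map from a set with a topology to the set. -/
def Retop.toBase {α : Type*} {τ : TopologicalSpace α} : Retop τ → α := fun x => x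

theorem Retop.continuous_toBase {α : Type*} {τ σ : TopologicalSpace α} (h : σ ≤ τ) :
    @Continuous (Retop σ) α _ τ Retop.toBase :=
  @Continuous.mk (Retop σ) α _ τ _ fun U hU => h U hU

theorem Retop.t2Space {α : Type*} {τ σ : TopologicalSpace α} (hτ : @T2Space α τ) (h : σ ≤ τ) :
    T2Space (Retop σ) :=
  @T2Space.of_injective_continuous (Retop σ) α _ τ hτ Retop.toBase (fun _ _ h => h)
    (Retop.continuous_toBase h)

theorem tendsto_seqTopology (x : C) : Tendsto (a x) atTop (@nhds C (seqTopology S a) x) := by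
  intro U hU
  obtain ⟨V, hVU, hV, hxV⟩ := (@mem_nhds_iff C (seqTopology S a) x U).1 hU
  exact (hV x hxV).2.mono fun n hn => hVU hn

theorem isTopologicalBasis_isClopen_seqTopology (e : C ≃ₜ (ℕ → Bool)) {rk : C → Ordinal}
    (ha : ∀ x, Tendsto (a x) atTop (𝓝 x))
    (hrk : ∀ x, (∀ n, a x n = x) ∨ ∀ n, rk (a x n) < rk x) :
    IsTopologicalBasis {s : Set (Retop (seqTopology S a)) | IsClopen s} :=
  isTopologicalBasis_of_isOpen_of_nhds (fun _ h => h.isOpen) fun x _ hx hU =>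
    let ⟨W, hWo, hWc, hxW, hWU⟩ := exists_isOpen_seqTopology_isClosed_subset e ha hrk x hU hx
    ⟨W, ⟨hWc.mono (seqTopology_le ha), hWo⟩, hxW, hWU⟩

end SequenceTopology

section Height

variable {C : Type*} [TopologicalSpace C] {e : C ≃ₜ (ℕ → Bool)}

theorem tendsto_of_mem_cylinder {x : C} {u : ℕ → C} {k : ℕ → ℕ} (hk : Tendsto k atTop atTop)
    (hu : ∀ n, u n ∈ cylinder e x (k n)) : Tendsto u atTop (𝓝 x) := by
  refine (hasBasis_nhds_cylinder (e := e) x).tendsto_right_iff.2 fun m _ => ?_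
  filter_upwards [hk.eventually_ge_atTop m] with n hn
  exact cylinder_anti x hn (hu n)

theorem tendsto_height_of_le_partialHeight_add {x : C} {u : ℕ → C} {k : ℕ → ℕ}
    (hk : Tendsto k atTop atTop) (hu : ∀ n, u n ∈ cylinder e x (k n)) {ε : ℕ → ℝ}
    (hε : Tendsto ε atTop (𝓝 0)) (h : ∀ n, height e (u n) ≤ partialHeight e (k n) x + ε n) :
    Tendsto (fun n => height e (u n)) atTop (𝓝 (height e x)) := by
  have hx := (tendsto_partialHeight (e := e) x).comp hk
  refine tendsto_of_tendsto_of_tendsto_of_le_of_le hx (by simpa using hx.add hε) (fun n => ?_) h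
  exact (partialHeight_congr (hu n)).symm.trans_le (partialHeight_le_height _ _)

theorem evenDigitSum_le_add {x y : C} {k : ℕ} (h : ∀ j, j ≠ k → e y j = e x j) (n : ℕ) :
    evenDigitSum e n y ≤ evenDigitSum e n x + 1 / (k + 1) := by
  have hk : (0 : ℝ) ≤ 1 / (k + 1) := by positivity
  have hsingle : (∑ j ∈ Finset.range n, if j = k then (1 / (k + 1) : ℝ) else 0) ≤ 1 / (k + 1) := by
    rw [Finset.sum_ite_eq']
    split_ifs
    exacts [le_rfl, hk]
  refine le_trans ?_ (add_le_add_right hsingle _)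
  rw [evenDigitSum, evenDigitSum, ← Finset.sum_add_distrib]
  refine Finset.sum_le_sum fun j _ => ?_
  obtain rfl | hj := eq_or_ne j k
  · rw [if_pos (c := j = j) rfl]
    split_ifs <;> linarith
  · rw [h j hj, if_neg hj, add_zero]

theorem height_le_height_add {x y : C} {k : ℕ} (h : ∀ j, j ≠ k → e y j = e x j) :
    height e y ≤ height e x + 1 / (k + 1) := by
  refine ciSup_le fun n => le_trans ?_ (add_le_add_left (partialHeight_le_height n x) _)
  rw [partialHeight, partialHeight, ← min_add_add_right]
  exact min_le_min (le_add_of_nonneg_right (by positivity)) (evenDigitSum_le_add h n)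

theorem height_le_partialHeight {x y : C} {n : ℕ} (hy : y ∈ cylinder e x n)
    (h0 : ∀ j ≥ n, Even j → e y j = false) : height e y ≤ partialHeight e n x := by
  refine ciSup_le fun m => ?_
  rw [← partialHeight_congr hy]
  rcases le_total m n with h | h
  · exact partialHeight_mono y h
  · refine min_le_min le_rfl (le_of_eq ?_)
    rw [evenDigitSum, ← Finset.sum_range_add_sum_Ico _ h, ← evenDigitSum, add_eq_left]
    refine Finset.sum_eq_zero fun j hj => if_neg fun hj1 => ?_
    simpa [h0 j (Finset.mem_Ico.1 hj).1 hj1.1] using hj1.2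

theorem evenDigitSum_two_mul (n : ℕ) (x : C) : evenDigitSum e (2 * n) x =
    ∑ k ∈ Finset.range n, if e x (2 * k) = true then (1 / (2 * k + 1) : ℝ) else 0 := by
  induction n with
  | zero => rfl
  | succ n ih =>
    rw [evenDigitSum] at ih ⊢
    simpa [mul_add, Finset.sum_range_succ] using ih

theorem height_eq_one_of_eventually {x : C} (h : ∀ᶠ n in atTop, e x (2 * n) = true) :
    height e x = 1 := by
  let f : ℕ → ℝ := fun k => if e x (2 * k) = true then 1 / (2 * k + 1) else 0
  have hf : ∀ k, 0 ≤ f k := fun k => by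
    simp only [f]
    split_ifs <;> positivity
  have hnot : ¬ Summable f := fun hs => by
    have hharm : Summable fun k : ℕ => (1 / 2 : ℝ) * (1 / ((k + 1 : ℕ) : ℝ)) := by
      refine hs.of_norm_bounded_eventually_nat (h.mono fun k hk => ?_)
      rw [Real.norm_of_nonneg (by positivity), div_mul_div_comm, one_mul]
      simp only [f, if_pos hk]
      exact one_div_le_one_div_of_le (by positivity) (by push_cast; linarith)
    exact Real.not_summable_one_div_natCast
      ((summable_nat_add_iff 1).1 ((summable_mul_left_iff (by norm_num)).1 hharm))
  obtain ⟨n, hn⟩ := (((not_summable_iff_tendsto_nat_atTop_of_nonneg hf).1 hnot).eventually_ge_atTop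
    1).exists
  refine le_antisymm (ciSup_le fun n => partialHeight_le_one n x) ?_
  refine le_trans (le_of_eq ?_) (partialHeight_le_height (2 * n) x)
  rw [partialHeight, evenDigitSum_two_mul, min_eq_left hn]

end Height

section Greedy

open Classical in
/-- Greedy construction of a binary sequence with odd digits `w`: starting with even digits `0`, in
step `n` the digit `2 * n` is raised to `1` if the outcome still has the property `p`. -/
noncomputable def greedyDigits (p : (ℕ → Bool) → Prop) (w : ℕ → Bool) : ℕ → ℕ → Bool
  | 0 => fun j => if Even j then false else w (j / 2)
  | n + 1 =>
    if p (Function.update (greedyDigits p w n) (2 * n) true)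
      then Function.update (greedyDigits p w n) (2 * n) true else greedyDigits p w n

/-- The sequence on which the steps of `greedyDigits` settle. -/
noncomputable def greedyLimit (p : (ℕ → Bool) → Prop) (w : ℕ → Bool) (j : ℕ) : Bool :=
  greedyDigits p w (j + 1) j

variable {p : (ℕ → Bool) → Prop} {w : ℕ → Bool}

theorem greedyDigits_succ_of_ne {n j : ℕ} (h : j ≠ 2 * n) :
    greedyDigits p w (n + 1) j = greedyDigits p w n j := by
  rw [greedyDigits]
  split_ifs
  exacts [Function.update_of_ne h _ _, rfl]

theorem greedyDigits_odd (n k : ℕ) : greedyDigits p w n (2 * k + 1) = w k := by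
  induction n with
  | zero =>
    have hdiv : (2 * k + 1) / 2 = k := by lia
    simp [greedyDigits, hdiv]
  | succ n ih => rw [greedyDigits_succ_of_ne (by lia), ih]

theorem greedyDigits_even {n k : ℕ} (h : n ≤ k) : greedyDigits p w n (2 * k) = false := by
  induction n with
  | zero => simp [greedyDigits]
  | succ n ih => rw [greedyDigits_succ_of_ne (by lia), ih (by lia)]

theorem greedyDigits_of_le {m n j : ℕ} (h : n ≤ m) (hj : j < 2 * n) :
    greedyDigits p w m j = greedyDigits p w n j := by
  induction m, h using Nat.le_induction with
  | base => rfl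
  | succ m hm ih => rw [greedyDigits_succ_of_ne (by lia), ih]

theorem greedyDigits_eq_greedyLimit {n j : ℕ} (hj : j < 2 * n) :
    greedyDigits p w n j = greedyLimit p w j := by
  rcases le_total n (j + 1) with h | h
  · exact (greedyDigits_of_le h hj).symm
  · exact greedyDigits_of_le h (by lia)

theorem greedyDigits_prop (h : p (greedyDigits p w 0)) (n : ℕ) : p (greedyDigits p w n) := by
  induction n with
  | zero => exact h
  | succ n ih =>
    rw [greedyDigits]
    split_ifs with hn
    exacts [hn, ih]

theorem greedyLimit_of_prop_update {n : ℕ}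
    (h : p (Function.update (greedyDigits p w n) (2 * n) true)) :
    greedyLimit p w (2 * n) = true := by
  rw [← greedyDigits_eq_greedyLimit (n := n + 1) (by lia), greedyDigits, if_pos h,
    Function.update_self]

variable {C : Type*} [TopologicalSpace C] {e : C ≃ₜ (ℕ → Bool)}

/- The height of the greedy limit `x` is at most `2 / 3`, so infinitely many even digits could not
be raised without leaving `G`. Raising them anyway changes the height by a null sequence. -/
theorem exists_common_limit (G : Set C) (w : ℕ → Bool) (h0 : ∀ x, height e x = 0 → x ∈ G)
    (h1 : ∀ x ∈ G, height e x < 2 / 3) :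
    ∃ (x : C) (u v : ℕ → C), (∀ k, e x (2 * k + 1) = w k) ∧
      Tendsto u atTop (𝓝 x) ∧ Tendsto (fun n => height e (u n)) atTop (𝓝 (height e x)) ∧
      Tendsto v atTop (𝓝 x) ∧ Tendsto (fun n => height e (v n)) atTop (𝓝 (height e x)) ∧
      (∀ n, u n ∈ G) ∧ ∃ᶠ n in atTop, v n ∉ G := by
  let b := greedyDigits (fun d => e.symm d ∈ G) w
  let x : C := e.symm (greedyLimit (fun d => e.symm d ∈ G) w)
  let u : ℕ → C := fun n => e.symm (b n)
  let v : ℕ → C := fun n => e.symm (Function.update (b n) (2 * n) true)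
  have htwo : Tendsto (fun n : ℕ => 2 * n) atTop atTop := tendsto_id.const_mul_atTop' two_pos
  have hu (n : ℕ) : u n ∈ cylinder e x (2 * n) := fun j hj => by
    simpa [u, x] using greedyDigits_eq_greedyLimit hj
  have hv (n : ℕ) : v n ∈ cylinder e x (2 * n) := fun j hj => by
    simpa [v, x, Function.update_of_ne hj.ne] using greedyDigits_eq_greedyLimit hj
  have huG : ∀ n, u n ∈ G := greedyDigits_prop (p := fun d => e.symm d ∈ G) (w := w) <|
    h0 _ <| le_antisymm
    ((height_le_partialHeight (n := 0) (mem_cylinder_self _ _) fun j _ hj => by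
      simp [greedyDigits, hj]).trans_eq (partialHeight_zero _))
    ((partialHeight_nonneg 0 _).trans (partialHeight_le_height 0 _))
  have hheight (n : ℕ) : height e (u n) ≤ partialHeight e (2 * n) x :=
    height_le_partialHeight (hu n) fun j hj hje => by
      obtain ⟨k, rfl⟩ := hje.two_dvd
      simpa [u] using greedyDigits_even (by lia)
  have hulim : Tendsto (fun n => height e (u n)) atTop (𝓝 (height e x)) :=
    tendsto_height_of_le_partialHeight_add htwo hu tendsto_const_nhds (ε := 0)
      fun n => by simpa using hheight n
  refine ⟨x, u, v, fun k => ?_, tendsto_of_mem_cylinder htwo hu, hulim,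
    tendsto_of_mem_cylinder htwo hv, tendsto_height_of_le_partialHeight_add htwo hv
      ((tendsto_one_div_add_atTop_nhds_zero_nat (𝕜 := ℝ)).comp htwo) fun n => ?_, huG, ?_⟩
  · rw [e.apply_symm_apply, ← greedyDigits_eq_greedyLimit (n := k + 1) (by lia), greedyDigits_odd]
  · refine (height_le_height_add (x := u n) (k := 2 * n) fun j hj => ?_).trans
      (add_le_add_left (hheight n) _)
    simp [u, v, Function.update_of_ne hj]
  · intro hcon
    have hone : height e x = 1 := height_eq_one_of_eventually <| hcon.mono fun n hn => by
      simpa [x] using greedyLimit_of_prop_update (not_not.1 hn)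
    have := le_of_tendsto' hulim fun n => (h1 _ (huG n)).le
    norm_num [hone] at this

end Greedy

section ProductSpace

variable {C : Type*} [TopologicalSpace C]

/-- The parametrization of the graph of `squareHeight` by the square. -/
noncomputable def graphMap (e : C ≃ₜ (ℕ → Bool)) (p : C × C) : (C × C) × ℝ := (p, squareHeight e p)

/-- The points of the diagonal, regarded as points of `C`, at which the lifts of both `D` and `E` to
the graph of `squareHeight` accumulate. -/
def diagOverlap (e : C ≃ₜ (ℕ → Bool)) (D E : Set (C × C)) : Set C :=
  {x | graphMap e (x, x) ∈ closure (graphMap e '' D) ∩ closure (graphMap e '' E)}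

/-- Disjoint sets `S₁`, `S₂` and a family of sequences `z x` in the square, from which two
refinements of the topology of `C` are defined; the ordinals `rk` make the family well-founded. The
condition on `splitLevel` keeps the members of each sequence apart from one another, and `diag`
makes points of the diagonal limits of any two sets whose lifts to the graph of `squareHeight`
accumulate at too many common points. -/
structure BernsteinData (e : C ≃ₜ (ℕ → Bool)) (S₁ S₂ : Set C) (z : C → ℕ → C × C)
    (rk : C → Ordinal) : Prop where
  disjoint : Disjoint S₁ S₂
  eq_or_rk_lt : ∀ x, (∀ n, z x n = (x, x)) ∨ (x ∉ S₁ ∧ x ∉ S₂ ∧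
    (∀ n, rk (z x n).1 < rk x ∧ rk (z x n).2 < rk x) ∧
    ∀ n m, n ≠ m → splitLevel e (z x n).1 x ≠ splitLevel e (z x m).2 x)
  tendsto : ∀ x, Tendsto (z x) atTop (𝓝 (x, x))
  tendsto_squareHeight : ∀ x, Tendsto (fun n => squareHeight e (z x n)) atTop (𝓝 (height e x))
  countable_fst : ∀ A : Set C, IsClosed A → Disjoint A S₁ → A.Countable
  countable_snd : ∀ A : Set C, IsClosed A → Disjoint A S₂ → A.Countable
  countable_lines : ∀ A : Set (C × C), IsClosed A → (∀ p ∈ A, p.1 ≠ p.2) → Disjoint A (S₁ ×ˢ S₂) →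
    ∃ Y : Set C, Y.Countable ∧ ∀ p ∈ A, p.1 ∈ Y ∨ p.2 ∈ Y
  diag : ∀ D E : Set (C × C), ¬ (diagOverlap e D E).Countable →
    ∃ x, (∃ᶠ n in atTop, z x n ∈ D) ∧ ∃ᶠ n in atTop, z x n ∈ E

variable {e : C ≃ₜ (ℕ → Bool)} {S₁ S₂ : Set C} {z : C → ℕ → C × C} {rk : C → Ordinal}

/-- The refinement `τ₁` of the theorem. -/
abbrev topFst (S₁ : Set C) (z : C → ℕ → C × C) : TopologicalSpace C :=
  seqTopology S₁ fun x n => (z x n).1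

/-- The refinement `τ₂` of the theorem. -/
abbrev topSnd (S₂ : Set C) (z : C → ℕ → C × C) : TopologicalSpace C :=
  seqTopology S₂ fun x n => (z x n).2

/-- The product `C₁ × C₂` of the two refinements. -/
abbrev ProdSpace (S₁ S₂ : Set C) (z : C → ℕ → C × C) : Type _ :=
  Retop (topFst S₁ z) × Retop (topSnd S₂ z)

/-- The identity map from `C₁ × C₂` to the square with its original topology. -/
def baseMap (p : ProdSpace S₁ S₂ z) : C × C := (p.1.toBase, p.2.toBase)

/-- The map `graphMap` on `C₁ × C₂`. -/
noncomputable def prodGraphMap (e : C ≃ₜ (ℕ → Bool)) (S₁ S₂ : Set C) (z : C → ℕ → C × C) :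
    ProdSpace S₁ S₂ z → (C × C) × ℝ := fun p => graphMap e (baseMap p)

/-- Open rectangles of `C₁ × C₂` on which `squareHeight` is less than `t` and that meet the diagonal
in a countable set. -/
structure IsSmallRect (e : C ≃ₜ (ℕ → Bool)) (S₁ S₂ : Set C) (z : C → ℕ → C × C) (t : ℝ)
    (U V : Set C) : Prop where
  isOpen_fst : IsOpen[topFst S₁ z] U
  isOpen_snd : IsOpen[topSnd S₂ z] V
  lt : ∀ u ∈ U, ∀ v ∈ V, squareHeight e (u, v) < t
  countable : (U ∩ V).Countable

theorem isOpen_rect {U V : Set C} (hU : IsOpen[topFst S₁ z] U) (hV : IsOpen[topSnd S₂ z] V) :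
    IsOpen (X := ProdSpace S₁ S₂ z) (U ×ˢ V : Set (C × C)) :=
  IsOpen.prod (X := Retop (topFst S₁ z)) (Y := Retop (topSnd S₂ z)) hU hV

theorem mem_nhds_of_mem_nhds_prodSpace {x y : C} (hx : x ∈ S₁) (hy : y ∈ S₂) {N : Set (C × C)}
    (hN : N ∈ @nhds (ProdSpace S₁ S₂ z) _ (x, y)) : N ∈ 𝓝 (x, y) := by
  obtain ⟨U, hU, V, hV, hUV⟩ := mem_nhds_prod_iff.1 hN
  exact mem_of_superset (prod_mem_nhds (mem_nhds_of_mem_nhds_seqTopology hx hU)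
    (mem_nhds_of_mem_nhds_seqTopology hy hV)) hUV

theorem isSmallRect_iUnion {x : C} (hx₁ : x ∉ S₁) (hx₂ : x ∉ S₂) {t : ℝ} (ht : height e x < t)
    {P Q : ℕ → Set C} {m : ℕ} (hPQ : ∀ n ≥ m, IsSmallRect e S₁ S₂ z t (P n) (Q n))
    (hP : ∀ n ≥ m, (z x n).1 ∈ P n) (hQ : ∀ n ≥ m, (z x n).2 ∈ Q n)
    (hsplit : ∀ n ≥ m, ∀ k ≥ m, n ≠ k → ∀ u ∈ P n, ∀ v ∈ Q k,
      u ≠ x ∧ v ≠ x ∧ splitLevel e u x ≠ splitLevel e v x) :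
    IsSmallRect e S₁ S₂ z t ({x} ∪ ⋃ n ∈ {n | m ≤ n}, P n) ({x} ∪ ⋃ n ∈ {n | m ≤ n}, Q n) where
  isOpen_fst := isOpen_seqTopology_insert hx₁ (fun n hn => (hPQ n hn).isOpen_fst) hP
  isOpen_snd := isOpen_seqTopology_insert hx₂ (fun n hn => (hPQ n hn).isOpen_snd) hQ
  lt := by
    rintro u (rfl | hu) v hv
    · exact (squareHeight_le_left _ _).trans_lt ht
    rcases hv with rfl | hv
    · exact (squareHeight_le_right _ _).trans_lt ht
    obtain ⟨n, hn, hun⟩ := mem_iUnion₂.1 hu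
    obtain ⟨k, hk, hvk⟩ := mem_iUnion₂.1 hv
    obtain rfl | hnk := eq_or_ne n k
    · exact (hPQ n hn).lt u hun v hvk
    · obtain ⟨hux, hvx, hne⟩ := hsplit n hn k hk hnk u hun v hvk
      exact (squareHeight_le_of_splitLevel_ne hne hux hvx).trans_lt ht
  countable := by
    refine ((countable_singleton x).union (.biUnion (to_countable {n | m ≤ n}) fun n hn =>
      (hPQ n hn).countable)).mono ?_
    rintro u ⟨rfl | hu, hu'⟩
    · exact .inl rfl
    obtain rfl | hu' := hu'
    · exact .inl rfl
    obtain ⟨n, hn, hun⟩ := mem_iUnion₂.1 hu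
    obtain ⟨k, hk, huk⟩ := mem_iUnion₂.1 hu'
    obtain rfl | hnk := eq_or_ne n k
    · exact .inr (mem_biUnion hn ⟨hun, huk⟩)
    · exact absurd rfl (hsplit n hn k hk hnk u hun u huk).2.2

theorem isClopen_setOf_notMem_cylinder (e : C ≃ₜ (ℕ → Bool)) (n : ℕ) :
    IsClopen {p : C × C | p.2 ∉ cylinder e p.1 n} := by
  have hunion : {p : C × C | p.2 ∉ cylinder e p.1 n} = ⋃ k ∈ {k | k < n},
      (fun p : C × C => (e p.2 k, e p.1 k)) ⁻¹' {q | q.1 ≠ q.2} := by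
    ext p
    simp [cylinder]
  rw [hunion]
  refine (finite_lt_nat n).isClopen_biUnion fun k _ => (isClopen_discrete _).preimage ?_
  have := continuous_apply (A := fun _ : ℕ => Bool) k
  have := e.continuous
  fun_prop

theorem mem_of_frequently_mem {H : Set (ProdSpace S₁ S₂ z)} (hH : IsClosed H) {x : C}
    (hx : ∃ᶠ n in atTop, z x n ∈ H) : ((x, x) : ProdSpace S₁ S₂ z) ∈ H := by
  let u : ℕ → ProdSpace S₁ S₂ z := z x
  have hu : Tendsto u atTop (𝓝 (x, x)) :=
    Tendsto.prodMk_nhds (X := Retop (topFst S₁ z)) (Y := Retop (topSnd S₂ z))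
      (tendsto_seqTopology x) (tendsto_seqTopology x)
  exact hH.closure_subset (mem_closure_of_frequently_of_tendsto (f := u) hx hu)

theorem mem_of_graphMap_mem_closure_image {H : Set (ProdSpace S₁ S₂ z)} (hH : IsClosed H) {x y : C}
    (hx : x ∈ S₁) (hy : y ∈ S₂)
    (hxy : graphMap e (x, y) ∈ closure (prodGraphMap e S₁ S₂ z '' H)) :
    ((x, y) : ProdSpace S₁ S₂ z) ∈ H := by
  rw [← hH.closure_eq, mem_closure_iff_nhds]
  intro N hN
  obtain ⟨_, ⟨hqN, -⟩, q, hq, rfl⟩ := mem_closure_iff_nhds.1 hxy _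
    (prod_mem_nhds (mem_nhds_of_mem_nhds_prodSpace hx hy hN) univ_mem)
  exact ⟨q, hqN, hq⟩

theorem exists_odd_digits_notMem {X : Set C} (hX : X.Countable) :
    ∃ w : ℕ → Bool, ∀ x ∈ X, ∃ k, e x (2 * k + 1) ≠ w k := by
  have : Uncountable (ℕ → Bool) := by
    rw [← not_countable_iff, ← Cardinal.mk_le_aleph0_iff]
    simp [Cardinal.aleph0_lt_continuum]
  obtain ⟨w, hw⟩ := (ne_univ_iff_exists_notMem _).1 fun huniv : (fun x k => e x (2 * k + 1)) '' X =
    univ => not_countable_univ (huniv ▸ hX.image _)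
  exact ⟨w, fun x hx => Function.ne_iff.1 fun heq => hw ⟨x, hx, heq⟩⟩

namespace BernsteinData

theorem tendsto_fst (h : BernsteinData e S₁ S₂ z rk) (x : C) :
    Tendsto (fun n => (z x n).1) atTop (𝓝 x) := (continuous_fst.tendsto _).comp (h.tendsto x)

theorem tendsto_snd (h : BernsteinData e S₁ S₂ z rk) (x : C) :
    Tendsto (fun n => (z x n).2) atTop (𝓝 x) := (continuous_snd.tendsto _).comp (h.tendsto x)

theorem eq_or_rk_lt_fst (h : BernsteinData e S₁ S₂ z rk) (x : C) :
    (∀ n, (z x n).1 = x) ∨ ∀ n, rk (z x n).1 < rk x :=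
  (h.eq_or_rk_lt x).imp (fun h n => by rw [h]) fun h n => (h.2.2.1 n).1

theorem eq_or_rk_lt_snd (h : BernsteinData e S₁ S₂ z rk) (x : C) :
    (∀ n, (z x n).2 = x) ∨ ∀ n, rk (z x n).2 < rk x :=
  (h.eq_or_rk_lt x).imp (fun h n => by rw [h]) fun h n => (h.2.2.1 n).2

theorem topFst_le (h : BernsteinData e S₁ S₂ z rk) : topFst S₁ z ≤ ‹TopologicalSpace C› :=
  seqTopology_le h.tendsto_fst

theorem topSnd_le (h : BernsteinData e S₁ S₂ z rk) : topSnd S₂ z ≤ ‹TopologicalSpace C› :=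
  seqTopology_le h.tendsto_snd

theorem isOpen_topFst_cylinder (h : BernsteinData e S₁ S₂ z rk) (x : C) (n : ℕ) :
    IsOpen[topFst S₁ z] (cylinder e x n) := h.topFst_le _ (isClopen_cylinder x n).isOpen

theorem isOpen_topSnd_cylinder (h : BernsteinData e S₁ S₂ z rk) (x : C) (n : ℕ) :
    IsOpen[topSnd S₂ z] (cylinder e x n) := h.topSnd_le _ (isClopen_cylinder x n).isOpen

theorem exists_isSmallRect_of_ne (h : BernsteinData e S₁ S₂ z rk) {p : C × C} (hp : p.1 ≠ p.2)
    {t : ℝ} (ht : squareHeight e p < t) :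
    ∃ U V, IsSmallRect e S₁ S₂ z t U V ∧ p.1 ∈ U ∧ p.2 ∈ V := by
  have hlt : splitLevel e p.1 p.2 < splitLevel e p.1 p.2 + 1 := Nat.lt_succ_self _
  refine ⟨_, _, ⟨h.isOpen_topFst_cylinder p.1 _, h.isOpen_topSnd_cylinder p.2 _,
    fun u hu v hv => by rwa [squareHeight_congr hp hlt hu hv], ?_⟩,
    mem_cylinder_self _ _, mem_cylinder_self _ _⟩
  convert countable_empty
  exact eq_empty_of_forall_notMem fun u hu => (splitLevel_congr hp hlt hu.1 hu.2).1 rfl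

theorem exists_isSmallRect_of_eq (h : BernsteinData e S₁ S₂ z rk) {x : C}
    (hz : ∀ n, z x n = (x, x)) {t : ℝ} (ht : height e x < t) :
    ∃ U V, IsSmallRect e S₁ S₂ z t U V ∧ x ∈ U ∧ x ∈ V := by
  by_cases hx : x ∈ S₁
  · refine ⟨univ, {x}, ⟨@isOpen_univ C (topFst S₁ z), isOpen_seqTopology_singleton
      (disjoint_left.1 h.disjoint hx) (fun n => by rw [hz]), ?_,
      (countable_singleton x).mono inter_subset_right⟩, trivial, rfl⟩
    rintro u - v rfl
    exact (squareHeight_le_right _ _).trans_lt ht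
  · refine ⟨{x}, univ, ⟨isOpen_seqTopology_singleton hx (fun n => by rw [hz]),
      @isOpen_univ C (topSnd S₂ z), ?_, (countable_singleton x).mono inter_subset_left⟩, rfl,
      trivial⟩
    rintro u rfl v -
    exact (squareHeight_le_left _ _).trans_lt ht

theorem exists_isSmallRect_self (h : BernsteinData e S₁ S₂ z rk) (x : C) {t : ℝ}
    (ht : height e x < t) : ∃ U V, IsSmallRect e S₁ S₂ z t U V ∧ x ∈ U ∧ x ∈ V := by
  induction hr : rk x using WellFoundedLT.induction generalizing x with
  | ind r ih =>
    obtain hz | ⟨hx₁, hx₂, hrk, hsplit⟩ := h.eq_or_rk_lt x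
    · exact h.exists_isSmallRect_of_eq hz ht
    obtain ⟨m, hm⟩ := eventually_atTop.1 ((h.tendsto_squareHeight x).eventually_lt_const ht)
    have hne_fst (n : ℕ) : (z x n).1 ≠ x := fun hn => (hrk n).1.ne (congrArg rk hn)
    have hne_snd (n : ℕ) : (z x n).2 ≠ x := fun hn => (hrk n).2.ne (congrArg rk hn)
    have hrect (n : ℕ) (hn : n ≥ m) : ∃ U V, IsSmallRect e S₁ S₂ z t U V ∧
        (z x n).1 ∈ U ∧ (z x n).2 ∈ V := by
      by_cases heq : (z x n).1 = (z x n).2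
      · have hzn : z x n = ((z x n).1, (z x n).1) := Prod.ext rfl heq.symm
        rw [← heq]
        exact ih _ (hr ▸ (hrk n).1) (z x n).1 (by
          rw [← squareHeight_self, ← hzn]
          exact hm n hn) rfl
      · exact h.exists_isSmallRect_of_ne heq (hm n hn)
    choose! U V hUV hU hV using hrect
    let P (n : ℕ) : Set C := cylinder e (z x n).1 (splitLevel e (z x n).1 x + 1)
    let Q (n : ℕ) : Set C := cylinder e (z x n).2 (splitLevel e (z x n).2 x + 1)
    have hsplitP (n : ℕ) (u : C) (hu : u ∈ P n) := splitLevel_congr (hne_fst n)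
      (Nat.lt_succ_self _) hu (mem_cylinder_self _ _)
    have hsplitQ (n : ℕ) (u : C) (hu : u ∈ Q n) := splitLevel_congr (hne_snd n)
      (Nat.lt_succ_self _) hu (mem_cylinder_self _ _)
    refine ⟨_, _, isSmallRect_iUnion (P := fun n => U n ∩ P n) (Q := fun n => V n ∩ Q n) hx₁ hx₂ ht
      (fun n hn => ⟨@IsOpen.inter _ (topFst S₁ z) _ _ (hUV n hn).isOpen_fst
          (h.isOpen_topFst_cylinder _ _), @IsOpen.inter _ (topSnd S₂ z) _ _ (hUV n hn).isOpen_snd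
          (h.isOpen_topSnd_cylinder _ _), fun u hu v hv => (hUV n hn).lt u hu.1 v hv.1,
        (hUV n hn).countable.mono (inter_subset_inter inter_subset_left inter_subset_left)⟩)
      (fun n hn => ⟨hU n hn, mem_cylinder_self _ _⟩) (fun n hn => ⟨hV n hn, mem_cylinder_self _ _⟩)
      fun n _ k _ hnk u hu v hv => ⟨(hsplitP n u hu.2).1, (hsplitQ k v hv.2).1, ?_⟩,
      .inl rfl, .inl rfl⟩
    rw [(hsplitP n u hu.2).2, (hsplitQ k v hv.2).2]
    exact hsplit n k hnk

theorem exists_isSmallRect (h : BernsteinData e S₁ S₂ z rk) (p : C × C) {t : ℝ}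
    (ht : squareHeight e p < t) : ∃ U V, IsSmallRect e S₁ S₂ z t U V ∧ p.1 ∈ U ∧ p.2 ∈ V := by
  obtain ⟨x, y⟩ := p
  obtain rfl | hxy := eq_or_ne x y
  · exact h.exists_isSmallRect_self x (squareHeight_self (e := e) x ▸ ht)
  · exact h.exists_isSmallRect_of_ne hxy ht

theorem continuous_baseMap (h : BernsteinData e S₁ S₂ z rk) :
    Continuous (baseMap : ProdSpace S₁ S₂ z → C × C) :=
  ((Retop.continuous_toBase h.topFst_le).comp continuous_fst).prodMk
    ((Retop.continuous_toBase h.topSnd_le).comp continuous_snd)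

theorem continuous_squareHeight (h : BernsteinData e S₁ S₂ z rk) :
    Continuous fun p : ProdSpace S₁ S₂ z => squareHeight e (baseMap p) := by
  suffices hat : ∀ x y : C,
      ContinuousAt (fun p : ProdSpace S₁ S₂ z => squareHeight e (baseMap p)) (x, y) from
    continuous_iff_continuousAt.2 fun p => hat p.1 p.2
  intro x y
  obtain rfl | hxy := eq_or_ne x y
  · refine tendsto_order.2 ⟨fun s hs => ?_, fun t ht => ?_⟩
    · have hsx : s < height e x := squareHeight_self (e := e) x ▸ hs
      obtain ⟨n, hn⟩ := ((tendsto_partialHeight x).eventually_const_lt hsx).exists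
      have hx : (x, x) ∈ cylinder e x n ×ˢ cylinder e x n :=
        ⟨mem_cylinder_self _ _, mem_cylinder_self _ _⟩
      filter_upwards [(isOpen_rect (h.isOpen_topFst_cylinder x n)
        (h.isOpen_topSnd_cylinder x n)).mem_nhds hx] with p hp
      exact hn.trans_le (partialHeight_le_squareHeight hp.1 hp.2)
    · obtain ⟨U, V, hUV, hxU, hxV⟩ := h.exists_isSmallRect (x, x) ht
      have hx : (x, x) ∈ U ×ˢ V := ⟨hxU, hxV⟩
      filter_upwards [(isOpen_rect hUV.isOpen_fst hUV.isOpen_snd).mem_nhds hx] with p hp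
      exact hUV.lt _ hp.1 _ hp.2
  · exact ContinuousAt.comp (f := (baseMap : ProdSpace S₁ S₂ z → C × C)) (g := squareHeight e)
      (x := (x, y)) (continuousAt_squareHeight (p := (x, y)) hxy)
      h.continuous_baseMap.continuousAt

theorem continuous_prodGraphMap (h : BernsteinData e S₁ S₂ z rk) :
    Continuous (prodGraphMap e S₁ S₂ z) := h.continuous_baseMap.prodMk h.continuous_squareHeight

theorem exists_isOpen_topFst_isClosed_subset (h : BernsteinData e S₁ S₂ z rk) (x : C) {U : Set C}
    (hU : IsOpen[topFst S₁ z] U) (hx : x ∈ U) :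
    ∃ W, IsOpen[topFst S₁ z] W ∧ IsClosed W ∧ x ∈ W ∧ W ⊆ U :=
  exists_isOpen_seqTopology_isClosed_subset e h.tendsto_fst h.eq_or_rk_lt_fst x hU hx

theorem exists_isOpen_topSnd_isClosed_subset (h : BernsteinData e S₁ S₂ z rk) (x : C) {U : Set C}
    (hU : IsOpen[topSnd S₂ z] U) (hx : x ∈ U) :
    ∃ W, IsOpen[topSnd S₂ z] W ∧ IsClosed W ∧ x ∈ W ∧ W ⊆ U :=
  exists_isOpen_seqTopology_isClosed_subset e h.tendsto_snd h.eq_or_rk_lt_snd x hU hx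

theorem isTopologicalBasis_isClopen_fst (h : BernsteinData e S₁ S₂ z rk) :
    IsTopologicalBasis {s : Set (Retop (topFst S₁ z)) | IsClopen s} :=
  isTopologicalBasis_isClopen_seqTopology e h.tendsto_fst h.eq_or_rk_lt_fst

theorem isTopologicalBasis_isClopen_snd (h : BernsteinData e S₁ S₂ z rk) :
    IsTopologicalBasis {s : Set (Retop (topSnd S₂ z)) | IsClopen s} :=
  isTopologicalBasis_isClopen_seqTopology e h.tendsto_snd h.eq_or_rk_lt_snd

theorem isTopologicalBasis_isClopen_prod (h : BernsteinData e S₁ S₂ z rk) :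
    IsTopologicalBasis {s : Set (ProdSpace S₁ S₂ z) | IsClopen s} :=
  _root_.isTopologicalBasis_isClopen_prod h.isTopologicalBasis_isClopen_fst
    h.isTopologicalBasis_isClopen_snd

theorem lindelofSpace_fst (h : BernsteinData e S₁ S₂ z rk) : LindelofSpace (Retop (topFst S₁ z)) :=
  have := e.secondCountableTopology
  lindelofSpace_seqTopology h.countable_fst

theorem lindelofSpace_snd (h : BernsteinData e S₁ S₂ z rk) : LindelofSpace (Retop (topSnd S₂ z)) :=
  have := e.secondCountableTopology
  lindelofSpace_seqTopology h.countable_snd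

theorem isLindelof_lines (h : BernsteinData e S₁ S₂ z rk) {Y : Set C} (hY : Y.Countable) :
    IsLindelof (X := ProdSpace S₁ S₂ z) {p | p.1 ∈ Y ∨ p.2 ∈ Y} := by
  have := h.lindelofSpace_fst
  have := h.lindelofSpace_snd
  have hlines : ({p | p.1 ∈ Y ∨ p.2 ∈ Y} : Set (ProdSpace S₁ S₂ z)) =
      ⋃ y ∈ Y, (range (fun q : Retop (topSnd S₂ z) => ((y, q) : ProdSpace S₁ S₂ z)) ∪
        range (fun q : Retop (topFst S₁ z) => ((q, y) : ProdSpace S₁ S₂ z))) := by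
    ext p
    constructor
    · rintro (hp | hp)
      · exact mem_biUnion hp (.inl ⟨p.2, rfl⟩)
      · exact mem_biUnion hp (.inr ⟨p.1, rfl⟩)
    · intro hp
      obtain ⟨y, hy, ⟨q, rfl⟩ | ⟨q, rfl⟩⟩ := mem_iUnion₂.1 hp
      exacts [.inl hy, .inr hy]
  rw [hlines]
  exact hY.isLindelof_biUnion fun y _ =>
    (isLindelof_range (by fun_prop)).union (isLindelof_range (by fun_prop))

theorem exists_countable_lines (h : BernsteinData e S₁ S₂ z rk) {A : Set (C × C)}
    (hA : ∀ p, p.1 ≠ p.2 → p ∉ A → Aᶜ ∈ 𝓝 p) (hS : Disjoint A (S₁ ×ˢ S₂))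
    (hdiag : {x | (x, x) ∈ A}.Countable) :
    ∃ Y : Set C, Y.Countable ∧ ∀ p ∈ A, p.1 ∈ Y ∨ p.2 ∈ Y := by
  have hlevel (n : ℕ) : ∃ Y : Set C, Y.Countable ∧
      ∀ p ∈ A ∩ {p | p.2 ∉ cylinder e p.1 n}, p.1 ∈ Y ∨ p.2 ∈ Y := by
    have hR := isClopen_setOf_notMem_cylinder e n
    have hne : ∀ p ∈ {p : C × C | p.2 ∉ cylinder e p.1 n}, p.1 ≠ p.2 := fun p hp heq =>
      hp (heq ▸ mem_cylinder_self _ _)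
    refine h.countable_lines _ ?_ (fun p hp => hne p hp.2) (hS.mono_left inter_subset_left)
    rw [← isOpen_compl_iff, isOpen_iff_mem_nhds]
    intro p hp
    by_cases hpR : p ∈ {p : C × C | p.2 ∉ cylinder e p.1 n}
    · exact mem_of_superset (hA p (hne p hpR) fun hpA => hp ⟨hpA, hpR⟩)
        (compl_subset_compl.2 inter_subset_left)
    · exact mem_of_superset (hR.compl.isOpen.mem_nhds hpR) (compl_subset_compl.2 inter_subset_right)
  choose Y hY hYA using hlevel
  refine ⟨{x | (x, x) ∈ A} ∪ ⋃ n, Y n, hdiag.union (countable_iUnion hY), ?_⟩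
  rintro ⟨x, y⟩ hp
  obtain rfl | hxy := eq_or_ne x y
  · exact .inl (.inl hp)
  · obtain ⟨n, hn⟩ := exists_notMem_cylinder (e := e) hxy
    exact (hYA n _ ⟨hp, hn⟩).imp (fun hx => .inr (mem_iUnion.2 ⟨n, hx⟩))
      fun hy => .inr (mem_iUnion.2 ⟨n, hy⟩)

theorem countable_diag_overlap (h : BernsteinData e S₁ S₂ z rk) {H K : Set (ProdSpace S₁ S₂ z)}
    (hH : IsClosed H) (hK : IsClosed K) (hd : Disjoint H K) :
    {x : C | prodGraphMap e S₁ S₂ z (x, x) ∈ closure (prodGraphMap e S₁ S₂ z '' H) ∩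
      closure (prodGraphMap e S₁ S₂ z '' K)}.Countable := by
  by_contra hcon
  obtain ⟨x, hxH, hxK⟩ := h.diag H K hcon
  exact disjoint_left.1 hd (mem_of_frequently_mem hH hxH) (mem_of_frequently_mem hK hxK)

theorem lindelofOverlap (h : BernsteinData e S₁ S₂ z rk) :
    LindelofOverlap (prodGraphMap e S₁ S₂ z) := by
  intro H K hH hK hd
  let A : Set (C × C) := graphMap e ⁻¹' (closure (prodGraphMap e S₁ S₂ z '' H) ∩
      closure (prodGraphMap e S₁ S₂ z '' K))
  have hA (p : C × C) (hp : p.1 ≠ p.2) (hpA : p ∉ A) : Aᶜ ∈ 𝓝 p :=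
    (continuousAt_id.prodMk (continuousAt_squareHeight hp)).preimage_mem_nhds
      ((isClosed_closure.inter isClosed_closure).isOpen_compl.mem_nhds hpA)
  have hAS : Disjoint A (S₁ ×ˢ S₂) := by
    refine disjoint_left.2 ?_
    rintro ⟨x, y⟩ hp ⟨hx, hy⟩
    exact disjoint_left.1 hd (mem_of_graphMap_mem_closure_image hH hx hy hp.1)
      (mem_of_graphMap_mem_closure_image hK hx hy hp.2)
  obtain ⟨Y, hY, hYA⟩ := h.exists_countable_lines hA hAS (h.countable_diag_overlap hH hK hd)
  exact ⟨_, h.isLindelof_lines hY, fun p hp => hYA _ hp⟩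

theorem isLindelof_of_countable_diag (h : BernsteinData e S₁ S₂ z rk) {W : Set (C × C)}
    (hW : IsClosed W) (hdiag : {x | (x, x) ∈ W}.Countable) :
    IsLindelof (X := ProdSpace S₁ S₂ z) W := by
  have := e.secondCountableTopology
  refine isLindelof_of_countable_subcover fun {ι} O hO hcov => ?_
  let O' (i : ι) : Set (C × C) := @interior (C × C) _ (O i)
  have hrest : IsClosed (W \ ⋃ i, O' i) := hW.sdiff (isOpen_iUnion fun i => isOpen_interior)
  have hrestS : Disjoint (W \ ⋃ i, O' i) (S₁ ×ˢ S₂) := by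
    refine disjoint_left.2 ?_
    rintro ⟨u, v⟩ ⟨huv, hnot⟩ ⟨hu, hv⟩
    obtain ⟨i, hi⟩ := mem_iUnion.1 (hcov huv)
    exact hnot (mem_iUnion.2 ⟨i, mem_interior_iff_mem_nhds.2
      (mem_nhds_of_mem_nhds_prodSpace hu hv ((hO i).mem_nhds hi))⟩)
  obtain ⟨Y, hY, hYA⟩ := h.exists_countable_lines
    (fun p _ hp => hrest.isOpen_compl.mem_nhds hp) hrestS (hdiag.mono fun _ hu => hu.1)
  obtain ⟨t, ht, hteq⟩ := eq_open_union_countable O' fun i => isOpen_interior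
  obtain ⟨r, hr, hrc⟩ := ((h.isLindelof_lines hY).of_isClosed_subset
    (hrest.preimage h.continuous_baseMap) hYA).elim_countable_subcover O hO
      (sdiff_subset.trans hcov)
  refine ⟨t ∪ r, ht.union hr, fun p hp => ?_⟩
  by_cases hpO : p ∈ ⋃ i, O' i
  · rw [← hteq] at hpO
    obtain ⟨i, hi, hpi⟩ := mem_iUnion₂.1 hpO
    exact mem_biUnion (.inl hi) (@interior_subset (C × C) _ (O i) p hpi)
  · obtain ⟨i, hi, hpi⟩ := mem_iUnion₂.1 (hrc ⟨hp, hpO⟩)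
    exact mem_biUnion (.inr hi) hpi

theorem exists_isClopen_isLindelof_mem (h : BernsteinData e S₁ S₂ z rk) (p : ProdSpace S₁ S₂ z) :
    ∃ W, IsClopen W ∧ IsLindelof W ∧ p ∈ W := by
  obtain ⟨x, y⟩ := p
  obtain ⟨U₀, V₀, hrect, hx₀, hy₀⟩ := h.exists_isSmallRect (x, y) (lt_add_one _)
  obtain ⟨U, hU, hUc, hxU, hUU⟩ := h.exists_isOpen_topFst_isClosed_subset x hrect.isOpen_fst hx₀
  obtain ⟨V, hV, hVc, hyV, hVV⟩ := h.exists_isOpen_topSnd_isClosed_subset y hrect.isOpen_snd hy₀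
  let W : Set (C × C) := U ×ˢ V
  have hW : IsClosed W := hUc.prod hVc
  have hdiag : {u | (u, u) ∈ W} ⊆ U₀ ∩ V₀ := fun _ hu => ⟨hUU hu.1, hVV hu.2⟩
  exact ⟨W, ⟨hW.preimage h.continuous_baseMap, isOpen_rect hU hV⟩,
    h.isLindelof_of_countable_diag hW (hrect.countable.mono hdiag), hxU, hyV⟩

theorem normalSpace_prod (h : BernsteinData e S₁ S₂ z rk) : NormalSpace (ProdSpace S₁ S₂ z) := by
  have := e.secondCountableTopology
  have := e.symm.t2Space
  have := e.symm.compactSpace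
  exact h.lindelofOverlap.normalSpace h.isTopologicalBasis_isClopen_prod h.continuous_prodGraphMap

theorem t4Space_prod (h : BernsteinData e S₁ S₂ z rk) : T4Space (ProdSpace S₁ S₂ z) := by
  have := Retop.t2Space e.symm.t2Space h.topFst_le
  have := Retop.t2Space e.symm.t2Space h.topSnd_le
  have := h.normalSpace_prod
  exact {}

theorem coverDimLE_one (h : BernsteinData e S₁ S₂ z rk) :
    CoverDimLE (fun U : Set (ProdSpace S₁ S₂ z) => IsOpen U) 1 := by
  have := e.secondCountableTopology
  have := h.normalSpace_prod
  have hb := isTopologicalBasis_isClopen_of_homeomorph e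
  exact h.lindelofOverlap.coverDimLE_one (_root_.isTopologicalBasis_isClopen_prod hb hb)
    h.isTopologicalBasis_isClopen_prod h.continuous_prodGraphMap h.exists_isClopen_isLindelof_mem

theorem exists_two_thirds_le_height_of_isClopen (h : BernsteinData e S₁ S₂ z rk)
    {W : Set (ProdSpace S₁ S₂ z)} (hW : IsClopen W)
    (hzero : ∀ x, height e x = 0 → ((x, x) : ProdSpace S₁ S₂ z) ∈ W) :
    ∃ x, ((x, x) : ProdSpace S₁ S₂ z) ∈ W ∧ 2 / 3 ≤ height e x := by
  by_contra! hlt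
  obtain ⟨w, hw⟩ := exists_odd_digits_notMem (e := e)
    (h.countable_diag_overlap hW.isClosed hW.compl.isClosed disjoint_compl_right)
  obtain ⟨x, u, v, hxw, hu, hu_height, hv, hv_height, huW, hvW⟩ := exists_common_limit
    {x : C | ((x, x) : ProdSpace S₁ S₂ z) ∈ W} w hzero hlt
  have hlim (u : ℕ → C) (hu : Tendsto u atTop (𝓝 x))
      (hheight : Tendsto (fun n => height e (u n)) atTop (𝓝 (height e x))) :
      Tendsto (fun n => prodGraphMap e S₁ S₂ z (u n, u n)) atTop
        (𝓝 (prodGraphMap e S₁ S₂ z (x, x))) := by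
    refine (hu.prodMk_nhds hu).prodMk_nhds ?_
    change Tendsto (fun n => squareHeight e (u n, u n)) atTop (𝓝 (squareHeight e (x, x)))
    simpa only [squareHeight_self] using hheight
  obtain ⟨k, hk⟩ := hw x
    ⟨mem_closure_of_tendsto (hlim u hu hu_height) (.of_forall fun n => mem_image_of_mem _ (huW n)),
      mem_closure_of_frequently_of_tendsto (hvW.mono fun n hn => mem_image_of_mem _ hn)
        (hlim v hv hv_height)⟩
  exact hk (hxw k)

theorem not_coverDimLE_zero (h : BernsteinData e S₁ S₂ z rk) {P : Set (ProdSpace S₁ S₂ z) → Prop}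
    (hP : ∀ U, P U → IsOpen U) (hcozero : ∀ U, IsCozeroSet U → P U) : ¬ CoverDimLE P 0 := by
  intro hdim
  have hcont := h.continuous_squareHeight
  obtain ⟨W, hW, hWlt, hWgt⟩ := hdim.exists_isClopen hP
    (hcozero _ (isCozeroSet_setOf_lt hcont (continuous_const (y := 2 / 3))))
    (hcozero _ (isCozeroSet_setOf_lt (continuous_const (y := 1 / 3)) hcont))
    (eq_univ_of_forall fun p => (lt_or_ge (squareHeight e (baseMap p)) (2 / 3)).imp id
      fun hp => lt_of_lt_of_le (by norm_num) hp)
  obtain ⟨x, hxW, hx⟩ := h.exists_two_thirds_le_height_of_isClopen hW fun x hx => by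
    by_contra hxW
    have hlt : 1 / 3 < squareHeight e (x, x) := hWgt hxW
    rw [squareHeight_self, hx] at hlt
    norm_num at hlt
  have hlt : squareHeight e (x, x) < 2 / 3 := hWlt hxW
  exact hx.not_gt (squareHeight_self (e := e) x ▸ hlt)

theorem cechDim_prod (h : BernsteinData e S₁ S₂ z rk) : cechDim (ProdSpace S₁ S₂ z) = 1 :=
  coverDim_eq (n := 1) (by norm_num) h.coverDimLE_one
    (h.not_coverDimLE_zero (fun _ h => h) fun _ h => h.isOpen)

theorem katetovDim_prod (h : BernsteinData e S₁ S₂ z rk) : katetovDim (ProdSpace S₁ S₂ z) = 1 :=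
  have := h.normalSpace_prod
  coverDim_eq (n := 1) (by norm_num) (coverDimLE_isCozeroSet_of_isOpen h.coverDimLE_one)
    (h.not_coverDimLE_zero (fun _ h => h.isOpen) fun _ h => h)

end BernsteinData

end ProductSpace

section Parity

variable {X : Type*}

/-- The parity of the number of letters of a word that lie in `U`. -/
noncomputable def parity (U : Set X) : FreeAbelianGroup X →+ ZMod 2 :=
  FreeAbelianGroup.lift (U.indicator 1)

theorem parity_of_mem {U : Set X} {x : X} (h : x ∈ U) : parity U (.of x) = 1 := by
  rw [parity, FreeAbelianGroup.lift_apply_of, indicator_of_mem h, Pi.one_apply]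

theorem parity_of_notMem {U : Set X} {x : X} (h : x ∉ U) : parity U (.of x) = 0 := by
  rw [parity, FreeAbelianGroup.lift_apply_of, indicator_of_notMem h]

theorem parity_map {Q : Type*} (π : X → Q) (B : Set Q) (w : FreeAbelianGroup X) :
    parity B (FreeAbelianGroup.map π w) = parity (π ⁻¹' B) w := by
  have hcomp : (parity B).comp (FreeAbelianGroup.map π) = parity (π ⁻¹' B) := by
    ext x
    simp only [parity, AddMonoidHom.comp_apply, FreeAbelianGroup.map_of_apply,
      FreeAbelianGroup.lift_apply_of]
    rfl
  exact DFunLike.congr_fun hcomp w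

theorem parity_union {U V : Set X} (h : Disjoint U V) (w : FreeAbelianGroup X) :
    parity (U ∪ V) w = parity U w + parity V w := by
  have hadd : parity (U ∪ V) = parity U + parity V := by
    ext x
    simp only [parity, AddMonoidHom.add_apply, FreeAbelianGroup.lift_apply_of,
      indicator_union_of_disjoint h]
  rw [hadd, AddMonoidHom.add_apply]

theorem exists_finite_support (w : FreeAbelianGroup X) :
    ∃ F : Set X, F.Finite ∧ ∀ U : Set X, Disjoint F U → parity U w = 0 := by
  induction w using FreeAbelianGroup.induction_on with
  | zero => exact ⟨∅, finite_empty, fun U _ => map_zero _⟩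
  | of x => exact ⟨{x}, finite_singleton x, fun U hU =>
      parity_of_notMem (disjoint_singleton_left.1 hU)⟩
  | neg x ih =>
    obtain ⟨F, hF, h⟩ := ih
    exact ⟨F, hF, fun U hU => by rw [map_neg, h U hU, neg_zero]⟩
  | add x y ihx ihy =>
    obtain ⟨F, hF, h⟩ := ihx
    obtain ⟨F', hF', h'⟩ := ihy
    refine ⟨F ∪ F', hF.union hF', fun U hU => ?_⟩
    rw [disjoint_union_left] at hU
    rw [map_add, h U hU.1, h' U hU.2, add_zero]

section Branch

variable {b : X → ℕ → Bool}

theorem disjoint_cylinder_succ {x y : X} {n : ℕ} (hn : y ∉ cylinder b x (n + 1)) :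
    Disjoint (cylinder b x (n + 1)) (cylinder b y (n + 1)) := by
  refine disjoint_left.2 fun z hz hz' => hn ?_
  rw [← cylinder_eq_of_mem hz, cylinder_eq_of_mem hz']
  exact mem_cylinder_self y _

theorem cylinder_succ_union {x y : X} {n : ℕ} (h : y ∈ cylinder b x n)
    (hn : y ∉ cylinder b x (n + 1)) :
    cylinder b x (n + 1) ∪ cylinder b y (n + 1) = cylinder b x n := by
  have hb : b y n ≠ b x n := fun heq => hn fun k hk =>
    (Nat.lt_succ_iff_lt_or_eq.1 hk).elim (h k) fun hkn => hkn ▸ heq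
  refine subset_antisymm (union_subset (cylinder_anti _ n.le_succ) ?_) fun z hz => ?_
  · exact cylinder_eq_of_mem h ▸ cylinder_anti y n.le_succ
  obtain hzn | hzn := eq_or_ne (b z n) (b x n)
  · exact .inl fun k hk => (Nat.lt_succ_iff_lt_or_eq.1 hk).elim (hz k) fun hkn => hkn ▸ hzn
  · have hzy : b z n = b y n := (Bool.eq_not_of_ne hzn).trans (Bool.eq_not_of_ne hb).symm
    exact .inr fun k hk => (Nat.lt_succ_iff_lt_or_eq.1 hk).elim
      (fun hkn => (hz k hkn).trans (h k hkn).symm) fun hkn => hkn ▸ hzy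

theorem mem_cylinder_of_parity_eq_one {w : FreeAbelianGroup X} {x y : X} {n : ℕ}
    (hx : ∀ k ≤ n, parity (cylinder b x k) w = 1)
    (hy : ∀ k ≤ n, parity (cylinder b y k) w = 1) : y ∈ cylinder b x n := by
  induction n with
  | zero => exact fun k hk => absurd hk (Nat.not_lt_zero k)
  | succ n ih =>
    have hmem := ih (fun k hk => hx k (hk.trans n.le_succ)) fun k hk => hy k (hk.trans n.le_succ)
    by_contra hsucc
    have hsum := hx n n.le_succ
    rw [← cylinder_succ_union hmem hsucc, parity_union (disjoint_cylinder_succ hsucc),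
      hx _ le_rfl, hy _ le_rfl] at hsum
    exact absurd hsum (by decide)

variable {b : X ≃ (ℕ → Bool)}

theorem exists_odd_child {w : FreeAbelianGroup X} {x : X} {n : ℕ}
    (h : parity (cylinder b x n) w = 1) :
    ∃ y ∈ cylinder b x n, parity (cylinder b y (n + 1)) w = 1 := by
  by_cases hx : parity (cylinder b x (n + 1)) w = 1
  · exact ⟨x, mem_cylinder_self _ _, hx⟩
  let y : X := b.symm (Function.update (b x) n (!(b x n)))
  have hy : y ∈ cylinder b x n := fun k hk => by simp [y, Function.update_of_ne hk.ne]
  have hy' : y ∉ cylinder b x (n + 1) := fun hmem => by simpa [y] using hmem n n.lt_succ_self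
  refine ⟨y, hy, ?_⟩
  rw [← cylinder_succ_union hy hy', parity_union (disjoint_cylinder_succ hy')] at h
  generalize parity (cylinder b x (n + 1)) w = p at *
  generalize parity (cylinder b y (n + 1)) w = q at *
  decide +revert

theorem exists_odd_branch {w : FreeAbelianGroup X} (h : parity univ w = 1) (b : X ≃ (ℕ → Bool)) :
    ∃ x, ∀ n, parity (cylinder b x n) w = 1 := by
  choose! f hf hfodd using fun (n : ℕ) (x : X) (h : parity (cylinder b x n) w = 1) =>
    exists_odd_child h
  let y : ℕ → X := fun n => Nat.rec (b.symm fun _ => false) f n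
  have hyodd : ∀ n, parity (cylinder b (y n) n) w = 1 := by
    intro n
    induction n with
    | zero => rwa [show cylinder b (y 0) 0 = univ from preimage_eq_univ_iff.2 (by simp)]
    | succ n ih => exact hfodd n _ ih
  have hydigit (k m : ℕ) (hm : k + 1 ≤ m) : b (y m) k = b (y (k + 1)) k := by
    induction m, hm using Nat.le_induction with
    | base => rfl
    | succ m hm ih => exact (hf m _ (hyodd m) k hm).trans ih
  refine ⟨b.symm fun k => b (y (k + 1)) k, fun n => ?_⟩
  have hmem : b.symm (fun k => b (y (k + 1)) k) ∈ cylinder b (y n) n := fun k hk => by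
    simpa using (hydigit k n hk).symm
  rw [cylinder_eq_of_mem hmem]
  exact hyodd n

/-- The retraction of the free Abelian group onto its generators: the branch of the binary tree
along which all cylinders contain an odd number of letters. The value at words with an even number
of letters is arbitrary. -/
noncomputable def oddBranch (b : X ≃ (ℕ → Bool)) (w : FreeAbelianGroup X) : X :=
  Classical.epsilon (h := ⟨b.symm fun _ => false⟩) fun x => ∀ n, parity (cylinder b x n) w = 1

theorem parity_cylinder_oddBranch {w : FreeAbelianGroup X} (h : parity univ w = 1) (n : ℕ) :
    parity (cylinder b (oddBranch b w) n) w = 1 :=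
  Classical.epsilon_spec (exists_odd_branch h b) n

theorem cylinder_zero (b : X → ℕ → Bool) (x : X) : cylinder b x 0 = univ :=
  eq_univ_of_forall fun _ k hk => absurd hk (Nat.not_lt_zero k)

theorem oddBranch_of_parity_ne_one {w : FreeAbelianGroup X} (h : parity univ w ≠ 1) :
    oddBranch b w = Classical.epsilon (h := ⟨b.symm fun _ => false⟩) fun _ => False := by
  have hempty (x : X) : ¬ ∀ n, parity (cylinder b x n) w = 1 := fun hx =>
    h (cylinder_zero b x ▸ hx 0)
  simp only [oddBranch, hempty]

theorem oddBranch_of (x : X) : oddBranch b (.of x) = x := by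
  by_contra hne
  obtain ⟨n, hn⟩ := PiNat.exists_disjoint_cylinder isClosed_singleton
    (mt eq_of_mem_singleton (b.injective.ne hne))
  have hodd := parity_cylinder_oddBranch (b := b) (parity_of_mem (mem_univ x)) n
  have hx : x ∉ cylinder b (oddBranch b (.of x)) n := fun hx => disjoint_left.1 hn rfl hx
  rw [parity_of_notMem hx] at hodd
  exact absurd hodd (by decide)

end Branch

section ExitCylinder

variable {b : X → ℕ → Bool} {V : Set X}

/-- The largest cylinder around `y` that is disjoint from `V`. If there is none, then it is the
whole space. -/
noncomputable def exitCylinder (b : X → ℕ → Bool) (V : Set X) (y : X) : Set X :=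
  cylinder b y (sInf {n | Disjoint (cylinder b y n) V})

theorem mem_exitCylinder_self (y : X) : y ∈ exitCylinder b V y := mem_cylinder_self _ _

theorem exitCylinder_of_mem {y : X} (hy : y ∈ V) : exitCylinder b V y = univ := by
  have hempty : {n | Disjoint (cylinder b y n) V} = ∅ :=
    eq_empty_of_forall_notMem fun n hn => disjoint_left.1 hn (mem_cylinder_self y n) hy
  rw [exitCylinder, hempty, Nat.sInf_empty, cylinder_zero]

theorem disjoint_exitCylinder (hV : IsClosed[.induced b inferInstance] V) {y : X} (hy : y ∉ V) :
    Disjoint (exitCylinder b V y) V := by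
  obtain ⟨A, hA, rfl⟩ := isClosed_induced_iff.1 hV
  obtain ⟨n, hn⟩ := PiNat.exists_disjoint_cylinder hA hy
  exact Nat.sInf_mem (s := {n | Disjoint (cylinder b y n) (b ⁻¹' A)})
    ⟨n, (hn.preimage b).symm⟩

theorem exitCylinder_eq_of_mem {y z : X} (hy : Disjoint (exitCylinder b V y) V)
    (hz : z ∈ exitCylinder b V y) : exitCylinder b V z = exitCylinder b V y := by
  unfold exitCylinder at *
  set N := sInf {n | Disjoint (cylinder b y n) V}
  have hcyl {n : ℕ} (hn : n ≤ N) : cylinder b z n = cylinder b y n :=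
    cylinder_eq_of_mem (cylinder_anti y hn hz)
  have hmin : IsLeast {n | Disjoint (cylinder b z n) V} N := by
    refine ⟨show Disjoint _ _ by rwa [hcyl le_rfl], fun n hn => ?_⟩
    by_contra! hlt
    exact hlt.not_ge (Nat.sInf_le (show Disjoint _ _ by rwa [← hcyl hlt.le]))
  rw [hmin.csInf_eq, hcyl le_rfl]

theorem preimage_exitCylinder {y : X} (hy : Disjoint (exitCylinder b V y) V) :
    exitCylinder b V ⁻¹' {exitCylinder b V y} = exitCylinder b V y :=
  subset_antisymm (fun z hz => eq_of_mem_singleton hz ▸ mem_exitCylinder_self z)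
    fun _ => exitCylinder_eq_of_mem hy

theorem isLocallyConstant_exitCylinder [TopologicalSpace X] (hb : Continuous b) (hV : IsOpen V)
    (hVc : IsClosed[.induced b inferInstance] V) : IsLocallyConstant (exitCylinder b V) := by
  refine (IsLocallyConstant.iff_exists_open _).2 fun y => ?_
  by_cases hy : y ∈ V
  · exact ⟨V, hV, hy, fun z hz => by rw [exitCylinder_of_mem hz, exitCylinder_of_mem hy]⟩
  · exact ⟨_, (isClopen_cylinder_of_continuous hb y _).isOpen, mem_exitCylinder_self y,
      fun z => exitCylinder_eq_of_mem (disjoint_exitCylinder hVc hy)⟩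

theorem oddBranch_mem_of_parity_eq {b : X ≃ (ℕ → Bool)} {v w : FreeAbelianGroup X} {F : Set X}
    {k : ℕ} (hV : IsClosed[.induced b inferInstance] V) (hxV : oddBranch b w ∈ V)
    (hw : parity univ w = 1) (hF : ∀ U, Disjoint F U → parity U w = 0)
    (hk : Disjoint (F \ {oddBranch b w}) (cylinder b (oddBranch b w) k))
    (hcyl : ∀ i ≤ k, parity (cylinder b (oddBranch b w) i) v =
      parity (cylinder b (oddBranch b w) i) w)
    (hexit : ∀ B, parity (exitCylinder b V ⁻¹' B) v = parity (exitCylinder b V ⁻¹' B) w) :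
    oddBranch b v ∈ V := by
  set x := oddBranch b w
  set y := oddBranch b v
  by_contra hy
  have hdisj := disjoint_exitCylinder hV hy
  have hvw : parity univ v = parity univ w := hexit univ
  have hyodd (n : ℕ) : parity (cylinder b y n) v = 1 := parity_cylinder_oddBranch (hvw ▸ hw) n
  have hyx : y ∈ cylinder b x k := mem_cylinder_of_parity_eq_one
    (fun i hi => (hcyl i hi).trans (parity_cylinder_oddBranch hw i)) fun i _ => hyodd i
  have hsub : exitCylinder b V y ⊆ cylinder b x k := by
    rw [← cylinder_eq_of_mem hyx]
    refine cylinder_anti y (le_of_not_gt fun hlt => disjoint_left.1 hdisj ?_ hxV)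
    rw [exitCylinder, cylinder_eq_of_mem (cylinder_anti x hlt.le hyx)]
    exact mem_cylinder_self _ _
  have hFexit : Disjoint F (exitCylinder b V y) := disjoint_left.2 fun u hu huy => by
    obtain rfl | hux := eq_or_ne u x
    · exact disjoint_left.1 hdisj huy hxV
    · exact disjoint_left.1 hk ⟨hu, hux⟩ (hsub huy)
  have hodd : parity (exitCylinder b V y) v = 1 := hyodd _
  rw [← preimage_exitCylinder hdisj, hexit, preimage_exitCylinder hdisj, hF _ hFexit] at hodd
  exact absurd hodd (by decide)

end ExitCylinder

end Parity

section FreeTopologicalGroups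

namespace FreeAbelianTopGroup

variable {X : Type*} [TopologicalSpace X]

/-- The embedding of `X` in `A(X)` as the set of generators. -/
def of (x : X) : FreeAbelianTopGroup X := FreeAbelianGroup.of x

/-- The identity map from `A(X)` to the free Abelian group without topology. -/
def toFree (v : FreeAbelianTopGroup X) : FreeAbelianGroup X := v

theorem continuous_of : Continuous (of : X → FreeAbelianTopGroup X) :=
  AddGroupTopology.coinduced_continuous (FreeAbelianGroup.of : X → FreeAbelianGroup X)

theorem continuous_hom {G : Type*} [AddGroup G] [TopologicalSpace G] [IsTopologicalAddGroup G]
    (φ : FreeAbelianGroup X →+ G) (h : Continuous fun x => φ (.of x)) :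
    Continuous (fun v : FreeAbelianTopGroup X => φ v.toFree) := by
  let t : AddGroupTopology (FreeAbelianGroup X) :=
    { toTopologicalSpace := TopologicalSpace.induced φ inferInstance
      toIsTopologicalAddGroup := topologicalAddGroup_induced φ }
  have ht : AddGroupTopology.coinduced (FreeAbelianGroup.of : X → FreeAbelianGroup X) ≤ t :=
    sInf_le (continuous_iff_coinduced_le.1 (continuous_induced_rng.2 h))
  exact continuous_iff_le_induced.2 ht

theorem eventually_map_eq {Q : Type*} {π : X → Q} (hπ : IsLocallyConstant π)
    (w : FreeAbelianTopGroup X) :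
    ∀ᶠ v in 𝓝 w, FreeAbelianGroup.map π v.toFree = FreeAbelianGroup.map π w.toFree := by
  let _ : TopologicalSpace (FreeAbelianGroup Q) := ⊥
  have : DiscreteTopology (FreeAbelianGroup Q) := ⟨rfl⟩
  have hcont := continuous_hom (FreeAbelianGroup.map π) (by
    simp only [FreeAbelianGroup.map_of_apply]
    exact (hπ.comp FreeAbelianGroup.of).continuous)
  exact hcont.continuousAt.eventually_mem (mem_nhds_discrete.2 (mem_singleton _))

theorem eventually_parity_preimage_eq {Q : Type*} {π : X → Q} (hπ : IsLocallyConstant π)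
    (w : FreeAbelianTopGroup X) :
    ∀ᶠ v in 𝓝 w, ∀ B, parity (π ⁻¹' B) v.toFree = parity (π ⁻¹' B) w.toFree :=
  (eventually_map_eq hπ w).mono fun v hv B => by rw [← parity_map, hv, parity_map]

theorem eventually_parity_eq {U : Set X} (hU : IsClopen U) (w : FreeAbelianTopGroup X) :
    ∀ᶠ v in 𝓝 w, parity U v.toFree = parity U w.toFree := by
  have hπ : IsLocallyConstant U.boolIndicator :=
    (IsLocallyConstant.iff_continuous _).2 ((continuous_boolIndicator_iff_isClopen U).2 hU)
  filter_upwards [eventually_parity_preimage_eq hπ w] with v hv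
  rw [← preimage_boolIndicator_true U, hv]

theorem continuous_oddBranch {b : X ≃ (ℕ → Bool)} (hb : Continuous b) {𝓑 : Set (Set X)}
    (h𝓑 : IsTopologicalBasis 𝓑) (hclosed : ∀ B ∈ 𝓑, IsClosed[.induced b inferInstance] B) :
    Continuous fun w : FreeAbelianTopGroup X => oddBranch b w.toFree := by
  refine continuous_iff_continuousAt.2 fun w => ?_
  by_cases hw : parity univ w.toFree = 1
  · intro N hN
    obtain ⟨V, hV, hxV, hVN⟩ := h𝓑.mem_nhds_iff.1 hN
    obtain ⟨F, hF, hFw⟩ := exists_finite_support w.toFree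
    obtain ⟨k, hk⟩ := PiNat.exists_disjoint_cylinder
      ((hF.sdiff (t := {oddBranch b w.toFree})).image b).isClosed
      (fun hx => ((b.injective.mem_set_image).1 hx).2 rfl)
    have hcyl : ∀ᶠ v in 𝓝 w, ∀ i ≤ k, parity (cylinder b (oddBranch b w.toFree) i) v.toFree =
        parity (cylinder b (oddBranch b w.toFree) i) w.toFree :=
      (finite_le_nat k).eventually_all.2 fun i _ =>
        eventually_parity_eq (isClopen_cylinder_of_continuous hb _ i) w
    change ∀ᶠ v in 𝓝 w, oddBranch b v.toFree ∈ N
    filter_upwards [hcyl, eventually_parity_preimage_eq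
      (isLocallyConstant_exitCylinder hb (h𝓑.isOpen hV) (hclosed V hV)) w] with v hv hexit
    exact hVN (oddBranch_mem_of_parity_eq (hclosed V hV) hxV hw hFw
      (disjoint_left.2 fun u hu hux => disjoint_left.1 hk (mem_image_of_mem b hu) hux) hv hexit)
  · have heq : ∀ᶠ v in 𝓝 w, oddBranch b v.toFree = oddBranch b w.toFree :=
      (eventually_parity_eq isClopen_univ w).mono fun v hv => by
        rw [oddBranch_of_parity_ne_one hw, oddBranch_of_parity_ne_one (hv ▸ hw)]
    exact continuousAt_const.congr (heq.mono fun _ h => h.symm)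

end FreeAbelianTopGroup

namespace FreeTopGroup

variable {X : Type*} [TopologicalSpace X]

/-- The embedding of `X` in `F(X)` as the set of generators. -/
def of (x : X) : FreeTopGroup X := FreeGroup.of x

/-- The identity map from `F(X)` to the free group without topology. -/
def toFree (v : FreeTopGroup X) : FreeGroup X := v

theorem continuous_of : Continuous (of : X → FreeTopGroup X) :=
  GroupTopology.coinduced_continuous (FreeGroup.of : X → FreeGroup X)

theorem continuous_hom {G : Type*} [Group G] [TopologicalSpace G] [IsTopologicalGroup G]
    (φ : FreeGroup X →* G) (h : Continuous fun x => φ (.of x)) :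
    Continuous (fun v : FreeTopGroup X => φ v.toFree) := by
  let t : GroupTopology (FreeGroup X) :=
    { toTopologicalSpace := TopologicalSpace.induced φ inferInstance
      toIsTopologicalGroup := topologicalGroup_induced φ }
  have ht : GroupTopology.coinduced (FreeGroup.of : X → FreeGroup X) ≤ t :=
    sInf_le (continuous_iff_coinduced_le.1 (continuous_induced_rng.2 h))
  exact continuous_iff_le_induced.2 ht

end FreeTopGroup

/-- A space that is a retract of its free Abelian topological group. -/
def IsRetractOfFreeAbelian (X : Type*) [TopologicalSpace X] : Prop :=
  ∃ r : FreeAbelianTopGroup X → X, Continuous r ∧ Function.LeftInverse r .of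

theorem isRetractOfFreeAbelian_of_isTopologicalBasis {X : Type*} [TopologicalSpace X]
    {b : X ≃ (ℕ → Bool)} (hb : Continuous b) {𝓑 : Set (Set X)} (h𝓑 : IsTopologicalBasis 𝓑)
    (hclosed : ∀ B ∈ 𝓑, IsClosed[.induced b inferInstance] B) : IsRetractOfFreeAbelian X :=
  ⟨_, FreeAbelianTopGroup.continuous_oddBranch hb h𝓑 hclosed, oddBranch_of⟩

namespace IsRetractOfFreeAbelian

variable {X Y : Type*} [TopologicalSpace X] [TopologicalSpace Y]

theorem exists_retraction_sum (hX : IsRetractOfFreeAbelian X) (hY : IsRetractOfFreeAbelian Y) :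
    ∃ r : FreeAbelianTopGroup (X ⊕ Y) → X × Y, Continuous r ∧
      ∀ p : X × Y, r (.of (Sum.inl p.1) + .of (Sum.inr p.2)) = p := by
  obtain ⟨r₁, hr₁, hof₁⟩ := hX
  obtain ⟨r₂, hr₂, hof₂⟩ := hY
  let φ₁ : FreeAbelianGroup (X ⊕ Y) →+ FreeAbelianTopGroup X :=
    FreeAbelianGroup.lift (Sum.elim .of fun _ => 0)
  let φ₂ : FreeAbelianGroup (X ⊕ Y) →+ FreeAbelianTopGroup Y :=
    FreeAbelianGroup.lift (Sum.elim (fun _ => 0) .of)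
  have hφ₁ := FreeAbelianTopGroup.continuous_hom φ₁ (by
    simpa only [φ₁, FreeAbelianGroup.lift_apply_of] using
      FreeAbelianTopGroup.continuous_of.sumElim continuous_const)
  have hφ₂ := FreeAbelianTopGroup.continuous_hom φ₂ (by
    simpa only [φ₂, FreeAbelianGroup.lift_apply_of] using
      continuous_const.sumElim FreeAbelianTopGroup.continuous_of)
  refine ⟨fun v => (r₁ (φ₁ v.toFree), r₂ (φ₂ v.toFree)), (hr₁.comp hφ₁).prodMk (hr₂.comp hφ₂), ?_⟩
  rintro ⟨x, y⟩
  have hx : φ₁ (.of (Sum.inl x) + .of (Sum.inr y)) = .of x := by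
    simp only [φ₁, map_add, FreeAbelianGroup.lift_apply_of, Sum.elim_inl, Sum.elim_inr, add_zero]
  have hy : φ₂ (.of (Sum.inl x) + .of (Sum.inr y)) = .of y := by
    simp only [φ₂, map_add, FreeAbelianGroup.lift_apply_of, Sum.elim_inl, Sum.elim_inr, zero_add]
  exact Prod.ext ((congrArg r₁ hx).trans (hof₁ x)) ((congrArg r₂ hy).trans (hof₂ y))

theorem exists_leftInverse_freeAbelianTopGroup (hX : IsRetractOfFreeAbelian X)
    (hY : IsRetractOfFreeAbelian Y) :
    ∃ (s : X × Y → FreeAbelianTopGroup (X ⊕ Y)) (r : FreeAbelianTopGroup (X ⊕ Y) → X × Y),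
      Continuous s ∧ Continuous r ∧ Function.LeftInverse r s := by
  obtain ⟨r, hr, hrs⟩ := hX.exists_retraction_sum hY
  have hl := FreeAbelianTopGroup.continuous_of.comp (continuous_inl (X := X) (Y := Y))
  have hr' := FreeAbelianTopGroup.continuous_of.comp (continuous_inr (X := X) (Y := Y))
  exact ⟨_, r, (hl.comp continuous_fst).add (hr'.comp continuous_snd), hr, hrs⟩

theorem exists_leftInverse_freeTopGroup (hX : IsRetractOfFreeAbelian X)
    (hY : IsRetractOfFreeAbelian Y) :
    ∃ (s : X × Y → FreeTopGroup (X ⊕ Y)) (r : FreeTopGroup (X ⊕ Y) → X × Y),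
      Continuous s ∧ Continuous r ∧ Function.LeftInverse r s := by
  obtain ⟨r, hr, hrs⟩ := hX.exists_retraction_sum hY
  let φ : FreeGroup (X ⊕ Y) →* Multiplicative (FreeAbelianTopGroup (X ⊕ Y)) :=
    FreeGroup.lift fun x => Multiplicative.ofAdd (.of x)
  have hφ := FreeTopGroup.continuous_hom φ (by
    simp only [φ, FreeGroup.lift_apply_of]
    exact continuous_ofAdd.comp FreeAbelianTopGroup.continuous_of)
  have hl := FreeTopGroup.continuous_of.comp (continuous_inl (X := X) (Y := Y))
  have hr' := FreeTopGroup.continuous_of.comp (continuous_inr (X := X) (Y := Y))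
  refine ⟨_, fun v => r (φ v.toFree).toAdd, (hl.comp continuous_fst).mul (hr'.comp continuous_snd),
    hr.comp (continuous_toAdd.comp hφ), fun p => ?_⟩
  have himage : φ (.of (Sum.inl p.1) * .of (Sum.inr p.2)) =
      .ofAdd (.of (Sum.inl p.1) + .of (Sum.inr p.2)) := by
    simp only [φ, map_mul, FreeGroup.lift_apply_of, ofAdd_add]
  exact (congrArg (fun v => r v.toAdd) himage).trans (hrs p)

end IsRetractOfFreeAbelian

end FreeTopologicalGroups

section Selection

universe u

variable {C : Type u} {n : ℕ} {A : Set (Fin n → C)}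

theorem nCard_le_mk {Y : Set C} (hY : ∀ x ∈ A, ∃ i, x i ∈ Y) : nCard A ≤ #Y :=
  csInf_le' ⟨Y, rfl, hY⟩

theorem NUncountable.exists_notMem (h : NUncountable A) {Y : Set C} (hY : Y.Countable) :
    ∃ x ∈ A, ∀ i, x i ∉ Y := by
  by_contra! hcon
  exact (nCard_le_mk hcon).not_gt ((Cardinal.mk_le_aleph0_iff.2 hY).trans_lt h)

theorem NUncountable.pos (h : NUncountable A) : 0 < n := by
  obtain ⟨x, hx, -⟩ := h.exists_notMem countable_empty
  by_contra! hn
  obtain rfl : n = 0 := by lia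
  have hempty : {κ | ∃ Y : Set C, #Y = κ ∧ ∀ x ∈ A, ∃ i, x i ∈ Y} = ∅ :=
    eq_empty_of_forall_notMem fun _ ⟨_, _, hY⟩ => (hY x hx).choose.elim0
  rw [NUncountable, nCard, hempty, Cardinal.sInf_empty] at h
  exact not_lt_zero h

theorem nUncountable_of_forall_exists_notMem (hn : 0 < n)
    (h : ∀ Y : Set C, Y.Countable → ∃ x ∈ A, ∀ i, x i ∉ Y) : NUncountable A := by
  obtain ⟨Y, hY, hYA⟩ : nCard A ∈ {κ | ∃ Y : Set C, #Y = κ ∧ ∀ x ∈ A, ∃ i, x i ∈ Y} :=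
    csInf_mem ⟨_, univ, rfl, fun _ _ => ⟨⟨0, hn⟩, trivial⟩⟩
  rw [NUncountable, ← hY]
  by_contra! hle
  obtain ⟨x, hx, hxY⟩ := h Y (Cardinal.mk_le_aleph0_iff.1 hle)
  obtain ⟨i, hi⟩ := hYA x hx
  exact hxY i hi

/-- The condition that the `n`-cardinality of `A` is at least `2^ω`, in a form that is also
meaningful for `n = 0`. -/
def IsBig (A : Set (Fin n → C)) : Prop :=
  ∀ Y : Set C, #Y < 𝔠 → ∃ x ∈ A, ∀ i, x i ∉ Y

theorem IsBig.mono {A' : Set (Fin n → C)} (h : IsBig A) (hA : A ⊆ A') : IsBig A' := fun Y hY =>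
  (h Y hY).imp fun _ hx => ⟨hA hx.1, hx.2⟩

theorem IsBig.nonempty (h : IsBig A) : A.Nonempty :=
  (h ∅ (by simp [Cardinal.continuum_pos])).imp fun _ hx => hx.1

theorem IsBig.le_nCard (h : IsBig A) (hn : 0 < n) : 𝔠 ≤ nCard A := by
  refine le_csInf ⟨_, univ, rfl, fun x _ => ⟨⟨0, hn⟩, trivial⟩⟩ ?_
  rintro _ ⟨Y, rfl, hY⟩
  by_contra! hlt
  obtain ⟨x, hx, hxY⟩ := h Y hlt
  obtain ⟨i, hi⟩ := hY x hx
  exact hxY i hi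

theorem IsBig.nCard_eq (h : IsBig A) (hC : #C = 𝔠) (hn : 0 < n) : nCard A = 𝔠 :=
  le_antisymm ((nCard_le_mk fun _ _ => ⟨⟨0, hn⟩, mem_univ _⟩).trans_eq
    (Cardinal.mk_univ.trans hC)) (h.le_nCard hn)

theorem isBig_of_disjoint_family {ι : Type*} (hι : 𝔠 ≤ #ι) {f : ι → Fin n → C} (hf : ∀ a, f a ∈ A)
    (hd : ∀ a b, a ≠ b → ∀ i k, f a i ≠ f b k) : IsBig A := by
  intro Y hY
  by_contra! hcon
  choose i hi using fun a => hcon (f a) (hf a)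
  have hinj : Function.Injective fun a => (⟨f a (i a), hi a⟩ : Y) := fun a b hab =>
    by_contra fun hne => hd a b hne _ _ (congrArg Subtype.val hab)
  have hle := (Cardinal.lift_le.2 hι).trans (Cardinal.lift_mk_le_lift_mk_of_injective hinj)
  rw [Cardinal.lift_continuum, Cardinal.continuum_le_lift] at hle
  exact hle.not_gt hY

theorem mk_iUnion_lt_continuum {J : Type u} (hJ : #J < 𝔠) {F : J → Set C}
    (hF : ∀ a, (F a).Countable) : #(⋃ a, F a) < 𝔠 :=
  calc #(⋃ a, F a) ≤ Cardinal.sum fun a => #(F a) := Cardinal.mk_iUnion_le_sum_mk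
    _ ≤ Cardinal.sum fun _ : J => ℵ₀ :=
      Cardinal.sum_le_sum _ _ fun a => Cardinal.mk_le_aleph0_iff.2 (hF a)
    _ = #J * ℵ₀ := Cardinal.sum_const' _ _
    _ < 𝔠 := Cardinal.mul_lt_of_lt Cardinal.aleph0_le_continuum hJ Cardinal.aleph0_lt_continuum

theorem exists_injective_ordinal_mk_lt_continuum {ι : Type u} (hι : #ι ≤ 𝔠) :
    ∃ r : ι → Ordinal.{u}, Function.Injective r ∧ ∀ α, #{β | r β ≤ r α} < 𝔠 := by
  obtain ⟨_, _, hord⟩ := Cardinal.exists_ord_eq_type_lt ι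
  let r : ι → Ordinal.{u} := Ordinal.typein (· < ·)
  refine ⟨r, Ordinal.typein_injective _, fun α => ?_⟩
  have hIio : #(Iio α) < 𝔠 := by
    have hcard := Cardinal.card_typein_lt (r := (· < ·)) α hord
    rw [Ordinal.card_typein] at hcard
    exact hcard.trans_le hι
  have hIic : {β | r β ≤ r α} = insert α (Iio α) := by
    simp only [r, Ordinal.typein_le_typein, not_lt, Iio_insert]
    rfl
  rw [hIic]
  exact Cardinal.mk_insert_le.trans_lt (Cardinal.add_lt_of_lt Cardinal.aleph0_le_continuum hIio
    (by simpa using Cardinal.nat_lt_continuum 1))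

/-- A set of points of a power of `C` that cannot be met by fewer than `2^ω` points of `C`, together
with a label in `Fin 3` for each coordinate such that equal coordinates have equal labels. -/
structure LabelledSet (C : Type u) where
  /-- The exponent of the power of `C`. -/
  dim : ℕ
  /-- The set of points. -/
  carrier : Set (Fin dim → C)
  /-- The labels of the coordinates. -/
  label : Fin dim → Fin 3
  isBig : IsBig carrier
  label_eq : ∀ p ∈ carrier, ∀ i k, p i = p k → label i = label k

theorem exists_points_notMem {ι : Type u} (A : ι → LabelledSet C) {Q : ι → Set C}
    (hQ : ∀ α, (Q α).Countable) {r : ι → Ordinal.{u}} (hr : ∀ α, #{β | r β ≤ r α} < 𝔠) :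
    ∃ p : ∀ α, Fin (A α).dim → C, (∀ α, p α ∈ (A α).carrier) ∧
      (∀ α β, r β < r α → ∀ i k, p α i ≠ p β k) ∧ ∀ α β, r β ≤ r α → ∀ i, p α i ∉ Q β := by
  have hstep (α : ι) (p : ∀ β, r β < r α → Fin (A β).dim → C) :
      ∃ q ∈ (A α).carrier, ∀ i,
        q i ∉ (⋃ β : {β // r β < r α}, range (p β β.2)) ∪ ⋃ β : {β // r β ≤ r α}, Q β := by
    refine (A α).isBig _ ((Cardinal.mk_union_le _ _).trans_lt ?_)
    exact Cardinal.add_lt_of_lt Cardinal.aleph0_le_continuum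
      (mk_iUnion_lt_continuum ((Cardinal.mk_subtype_mono fun _ h => h.le).trans_lt (hr α))
        fun β => countable_range _)
      (mk_iUnion_lt_continuum (hr α) fun β => hQ _)
  choose q hq hqnot using hstep
  have hwf : WellFounded fun α β => r α < r β := InvImage.wf r wellFounded_lt
  let p : ∀ α, Fin (A α).dim → C := hwf.fix fun α p => q α p
  have hp (α : ι) : p α = q α fun β _ => p β := hwf.fix_eq _ α
  refine ⟨p, fun α => hp α ▸ hq α _, fun α β hβ i k heq => ?_, fun α β hβ i hi => ?_⟩
  · exact hqnot α (fun β _ => p β) i (.inl (mem_iUnion.2 ⟨⟨β, hβ⟩, k, by rw [← heq, hp α]⟩))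
  · exact hqnot α (fun β _ => p β) i (.inr (mem_iUnion.2 ⟨⟨β, hβ⟩, by rwa [← hp α]⟩))

theorem exists_disjoint_selection {ι : Type u} (hι : #ι ≤ 𝔠) (A : ι → LabelledSet C)
    {Q : ι → Set C} (hQ : ∀ α, (Q α).Countable) :
    ∃ (p : ∀ α, Fin (A α).dim → C) (ρ : C → Ordinal.{u}), (∀ α, p α ∈ (A α).carrier) ∧
      (∀ α β i k, p α i = p β k → α = β) ∧ ∀ α i, ∀ y ∈ Q α, ρ y < ρ (p α i) := by
  obtain ⟨r, hrinj, hr⟩ := exists_injective_ordinal_mk_lt_continuum hι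
  obtain ⟨p, hpA, hpp, hpQ⟩ := exists_points_notMem A hQ hr
  have heq (α β i k) (h : p α i = p β k) : α = β := by
    by_contra hne
    rcases lt_or_gt_of_ne (hrinj.ne hne) with hlt | hlt
    · exact hpp β α hlt k i h.symm
    · exact hpp α β hlt i k h
  let ρ (y : C) : Ordinal.{u} := sInf {o | ∀ α i, p α i = y → r α < o}
  refine ⟨p, ρ, hpA, heq, fun α i y hy => ?_⟩
  have hle : ρ y ≤ r α := csInf_le' fun β k hβ => lt_of_not_ge fun hαβ => hpQ β α hαβ k (hβ ▸ hy)
  have hmem : ρ (p α i) ∈ {o | ∀ β k, p β k = p α i → r β < o} :=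
    csInf_mem ⟨Order.succ (r α), fun β k hβ => heq _ _ _ _ hβ ▸ Order.lt_succ _⟩
  exact hle.trans_lt (hmem α i rfl)

theorem mk_labelledSet_le_continuum {𝓕 : ∀ n, Set (Set (Fin n → C))} (h𝓕 : ∀ n, #(𝓕 n) ≤ 𝔠) :
    #{A : LabelledSet C // A.carrier ∈ 𝓕 A.dim} ≤ 𝔠 := by
  let g (A : {A : LabelledSet C // A.carrier ∈ 𝓕 A.dim}) : Σ n, 𝓕 n × (Fin n → Fin 3) :=
    ⟨A.1.dim, ⟨A.1.carrier, A.2⟩, A.1.label⟩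
  have hg : Function.Injective g := by
    rintro ⟨⟨n, A, l, _, _⟩, hA⟩ ⟨⟨m, B, l', _, _⟩, hB⟩ h
    obtain rfl : n = m := congrArg Sigma.fst h
    simp only [g, Sigma.mk.injEq, heq_eq_eq, Prod.mk.injEq, Subtype.mk.injEq, true_and] at h
    obtain ⟨rfl, rfl⟩ := h
    rfl
  have hfibre (n : ℕ) : #(𝓕 n × (Fin n → Fin 3)) ≤ 𝔠 := by
    rw [Cardinal.mk_prod, Cardinal.lift_uzero]
    exact (mul_le_mul' (h𝓕 n) ((Cardinal.lift_le_aleph0.2 Cardinal.mk_le_aleph0).trans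
      Cardinal.aleph0_le_continuum)).trans_eq Cardinal.continuum_mul_self
  calc _ ≤ #(Σ n, 𝓕 n × (Fin n → Fin 3)) := Cardinal.mk_le_of_injective hg
    _ ≤ 𝔠 := by
      rw [Cardinal.mk_sigma]
      refine (Cardinal.sum_le_sum _ (fun _ => 𝔠) hfibre).trans_eq ?_
      simp

/-- The set of the coordinates `p α i` whose label is `s`. -/
def labelClass {ι : Type*} (A : ι → LabelledSet C) (p : ∀ α, Fin (A α).dim → C) (s : Fin 3) :
    Set C :=
  {y | ∃ α i, p α i = y ∧ (A α).label i = s}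

theorem pairwise_disjoint_labelClass {ι : Type*} {A : ι → LabelledSet C}
    {p : ∀ α, Fin (A α).dim → C} (hp : ∀ α, p α ∈ (A α).carrier)
    (heq : ∀ α β i k, p α i = p β k → α = β) :
    Pairwise (Function.onFun Disjoint (labelClass A p)) := by
  intro s s' hne
  refine disjoint_left.2 ?_
  rintro _ ⟨α, i, rfl, rfl⟩ ⟨β, k, hk, rfl⟩
  obtain rfl := heq _ _ _ _ hk
  exact hne ((A β).label_eq _ (hp β) _ _ hk.symm)

theorem exists_bernstein_sets (hC : #C = 𝔠) {𝓕 : ∀ n, Set (Set (Fin n → C))}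
    (h𝓕 : ∀ n, #(𝓕 n) ≤ 𝔠) {κ : Type u} (hκ : #κ ≤ 𝔠) {B : κ → Set C}
    (hB : ∀ α, ∀ Y : Set C, #Y < 𝔠 → ∃ x ∈ B α, x ∉ Y) {Q : κ → Set C}
    (hQ : ∀ α, (Q α).Countable) :
    ∃ (S : Fin 3 → Set C) (x : κ → C) (ρ : C → Ordinal.{u}),
      Pairwise (Function.onFun Disjoint S) ∧ Function.Injective x ∧
      (∀ n, ∀ A ∈ 𝓕 n, IsBig A → ∀ l : Fin n → Fin 3,
        (∀ p ∈ A, ∀ i k, p i = p k → l i = l k) → IsBig (A ∩ {p | ∀ i, p i ∈ S (l i)})) ∧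
      (∀ α, x α ∈ B α ∧ x α ∈ S 0) ∧ ∀ α, ∀ y ∈ Q α, ρ y < ρ (x α) := by
  let A : {A : LabelledSet C // A.carrier ∈ 𝓕 A.dim} × C ⊕ κ → LabelledSet C :=
    Sum.elim (fun t => t.1.1) fun α =>
      { dim := 1
        carrier := {p | p 0 ∈ B α}
        label := 0
        isBig := fun Y hY =>
          let ⟨x, hx, hxY⟩ := hB α Y hY
          ⟨fun _ => x, hx, fun _ => hxY⟩
        label_eq := fun _ _ _ _ _ => rfl }
  have hι : #({A : LabelledSet C // A.carrier ∈ 𝓕 A.dim} × C ⊕ κ) ≤ 𝔠 := by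
    rw [Cardinal.mk_sum, Cardinal.lift_id, Cardinal.lift_id, Cardinal.mk_prod, Cardinal.lift_id,
      Cardinal.lift_id, hC]
    exact (add_le_add (mul_le_mul' (mk_labelledSet_le_continuum h𝓕) le_rfl) hκ).trans
      (by rw [Cardinal.continuum_mul_self, Cardinal.continuum_add_self])
  obtain ⟨p, ρ, hpA, heq, hρ⟩ := exists_disjoint_selection hι A (Q := Sum.elim (fun _ => ∅) Q)
    (Sum.rec (fun _ => countable_empty) hQ)
  refine ⟨labelClass A p, fun α => p (.inr α) (0 : Fin 1), ρ, pairwise_disjoint_labelClass hpA heq,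
    fun α β h => Sum.inr.inj (heq _ _ _ _ h), fun n D hD hbig l hl => ?_,
    fun α => ⟨hpA (.inr α), .inr α, (0 : Fin 1), rfl, rfl⟩, fun α => hρ (.inr α) (0 : Fin 1)⟩
  let t : {A : LabelledSet C // A.carrier ∈ 𝓕 A.dim} := ⟨⟨n, D, l, hbig, hl⟩, hD⟩
  exact isBig_of_disjoint_family (ι := C) hC.ge (f := fun c => p (.inl (t, c)))
    (fun c => ⟨hpA (.inl (t, c)), fun i => ⟨.inl (t, c), i, rfl, rfl⟩⟩) fun c d hcd i k h =>
      hcd (congrArg Prod.snd (Sum.inl.inj (heq _ _ _ _ h)))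

end Selection

section NUncountableClosed

instance countableInterFilter_pi {ι : Type*} [Finite ι] {α : ι → Type*} (l : ∀ i, Filter (α i))
    [∀ i, CountableInterFilter (l i)] : CountableInterFilter (Filter.pi l) where
  countable_sInter_mem 𝓢 h𝓢 h := by
    choose! I _ t ht hts using fun s hs => mem_pi.1 (h s hs)
    refine mem_of_superset (pi_mem_pi finite_univ fun i _ =>
      (countable_bInter_mem h𝓢).2 fun s hs => ht s hs i) fun x hx s hs => hts s hs fun i _ => ?_
    exact mem_iInter₂.1 (hx i trivial) s hs

instance countableInterFilter_cocountable {α : Type*} :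
    CountableInterFilter (cocountable : Filter α) :=
  CardinalInterFilter.toCountableInterFilter _ Cardinal.aleph0_lt_aleph_one

theorem eventually_clusterPt {X : Type*} [TopologicalSpace X] [SecondCountableTopology X]
    (l : Filter X) [CountableInterFilter l] : ∀ᶠ x in l, ClusterPt x l := by
  have hcompl : ∀ᶠ x in l, ¬ ¬ ClusterPt x l :=
    (HereditarilyLindelofSpace.isLindelof
      {x | ¬ ClusterPt x l}).compl_mem_sets_of_nhdsWithin fun x hx => by
        simp only [clusterPt_iff_frequently, not_forall, not_frequently, mem_ofPred_eq] at hx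
        obtain ⟨s, hs, hsl⟩ := hx
        exact ⟨s, mem_nhdsWithin_of_mem_nhds hs, hsl⟩
  simpa only [not_not] using hcompl

variable {X : Type*} [TopologicalSpace X] {R : Set (X × X)}

theorem exists_isClosed_pair_of_frequently [RegularSpace X] [SecondCountableTopology X]
    {l : Filter X} [CountableInterFilter l] (hR : IsOpen R) (h : ∀ x, ∀ᶠ y in l, (x, y) ∈ R)
    {K : Set X} (hK : IsClosed K) (hKl : ∃ᶠ x in l, x ∈ K) :
    ∃ L : Bool → Set X, (∀ c, IsClosed (L c) ∧ (∃ᶠ x in l, x ∈ L c) ∧ L c ⊆ K) ∧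
      L true ×ˢ L false ⊆ R := by
  have : (l ⊓ 𝓟 K).NeBot := frequently_mem_iff_neBot.1 hKl
  obtain ⟨x, hx⟩ := (eventually_clusterPt (l ⊓ 𝓟 K)).exists
  obtain ⟨y, hy, hxy⟩ :=
    ((eventually_clusterPt (l ⊓ 𝓟 K)).and ((h x).filter_mono inf_le_left)).exists
  have hfreq {z : X} (hz : ClusterPt z (l ⊓ 𝓟 K)) {s : Set X} (hs : s ∈ 𝓝 z) :
      ∃ᶠ w in l, w ∈ K ∩ s :=
    frequently_inf_principal.1 (clusterPt_iff_frequently.1 hz s hs)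
  obtain ⟨⟨s, t⟩, ⟨⟨hs, hsc⟩, ht, htc⟩, hst⟩ :=
    ((closed_nhds_basis x).prod_nhds (closed_nhds_basis y)).mem_iff.1 (hR.mem_nhds hxy)
  refine ⟨fun c => K ∩ if c then s else t, Bool.forall_bool.2 ⟨?_, ?_⟩, ?_⟩
  · exact ⟨hK.inter htc, hfreq hy ht, inter_subset_left⟩
  · exact ⟨hK.inter hsc, hfreq hx hs, inter_subset_left⟩
  · exact (prod_mono inter_subset_right inter_subset_right).trans hst

theorem exists_pairwise_of_eventually [CompactSpace X] [T2Space X] [SecondCountableTopology X]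
    {l : Filter X} [CountableInterFilter l] (hR : IsOpen R) (h : ∀ x, ∀ᶠ y in l, (x, y) ∈ R)
    {A : Set X} (hA : IsClosed A) (hAl : ∃ᶠ x in l, x ∈ A) :
    ∃ f : (ℕ → Bool) → X, (∀ a, f a ∈ A) ∧
      ∀ a b, a ≠ b → (f a, f b) ∈ R ∨ (f b, f a) ∈ R := by
  choose L hL hLR using fun K : {K : Set X // IsClosed K ∧ ∃ᶠ x in l, x ∈ K} =>
    exists_isClosed_pair_of_frequently hR h K.2.1 K.2.2
  let D (s : List Bool) : {K : Set X // IsClosed K ∧ ∃ᶠ x in l, x ∈ K} :=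
    s.foldr (fun c K => ⟨L K c, (hL K c).1, (hL K c).2.1⟩) ⟨A, hA, hAl⟩
  have hf (a : ℕ → Bool) : (⋂ n, (D (PiNat.res a n)).1).Nonempty :=
    IsCompact.nonempty_iInter_of_sequence_nonempty_isCompact_isClosed _
      (fun n => (hL (D (PiNat.res a n)) (a n)).2.2) (fun n => (D _).2.2.exists)
      (D _).2.1.isCompact fun n => (D _).2.1
  choose f hf using hf
  have hfL (a : ℕ → Bool) (n : ℕ) : f a ∈ L (D (PiNat.res a n)) (a n) :=
    mem_iInter.1 (hf a) (n + 1)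
  have hpair {a b : ℕ → Bool} {n : ℕ} (hab : PiNat.res a n = PiNat.res b n) (ha : a n = true)
      (hb : b n = false) : (f a, f b) ∈ R := by
    refine hLR (D (PiNat.res a n)) ⟨?_, ?_⟩
    · simpa only [ha] using hfL a n
    · simpa only [hab, hb] using hfL b n
  refine ⟨f, fun a => mem_iInter.1 (hf a) 0, fun a b hne => ?_⟩
  have hres : PiNat.res a (PiNat.firstDiff a b) = PiNat.res b (PiNat.firstDiff a b) :=
    PiNat.res_eq_res.2 fun k hk => PiNat.apply_eq_of_lt_firstDiff hk
  have hdiff := PiNat.apply_firstDiff_ne hne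
  cases ha : a (PiNat.firstDiff a b) <;> rw [ha] at hdiff
  · exact .inr (hpair hres.symm (Bool.eq_true_of_not_eq_false hdiff.symm) ha)
  · exact .inl (hpair hres ha (Bool.eq_false_of_not_eq_true hdiff.symm))

variable {C : Type*} {n : ℕ} {A : Set (Fin n → C)}

theorem NUncountable.frequently_pi_cocountable (h : NUncountable A) :
    ∃ᶠ x in Filter.pi fun _ : Fin n => cocountable, x ∈ A := by
  intro hA
  obtain ⟨I, -, t, ht, htA⟩ := mem_pi.1 hA
  obtain ⟨x, hx, hxt⟩ :=
    h.exists_notMem (countable_iUnion fun i => mem_cocountable.1 (ht i))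
  exact htA (fun i _ => not_not.1 fun hi => hxt i (mem_iUnion.2 ⟨i, hi⟩)) hx

theorem isBig_of_isClosed [TopologicalSpace C] [CompactSpace C] [T2Space C]
    [SecondCountableTopology C] (hA : IsClosed A) (h : NUncountable A) : IsBig A := by
  let R : Set ((Fin n → C) × (Fin n → C)) := {q | ∀ i k, q.1 i ≠ q.2 k}
  have hR : IsOpen R := by
    simp only [R, ofPred_forall]
    exact isOpen_iInter_of_finite fun i => isOpen_iInter_of_finite fun k =>
      isOpen_ne_fun (by fun_prop) (by fun_prop)
  have hRl (x : Fin n → C) : ∀ᶠ y in Filter.pi fun _ => cocountable, (x, y) ∈ R := by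
    refine mem_of_superset (pi_mem_pi finite_univ fun _ _ =>
      mem_cocountable.2 ((compl_compl (range x)).symm ▸ countable_range x)) fun y hy i k hik => ?_
    exact hy k trivial ⟨i, hik⟩
  obtain ⟨f, hfA, hfR⟩ := exists_pairwise_of_eventually hR hRl hA h.frequently_pi_cocountable
  refine isBig_of_disjoint_family (ι := ℕ → Bool) (by simp) hfA fun a b hab i k => ?_
  rcases hfR a b hab with hfab | hfba
  · exact hfab i k
  · exact (hfba k i).symm

end NUncountableClosed

section GraphTopology

universe u

theorem mk_setOf_isClosed_le {X : Type u} [TopologicalSpace X] [SecondCountableTopology X] :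
    #{A : Set X | IsClosed A} ≤ 𝔠 := by
  let _ : MeasurableSpace X := .generateFrom (countableBasis X)
  have : BorelSpace X := ⟨(isBasis_countableBasis X).borel_eq_generateFrom.symm⟩
  calc #{A : Set X | IsClosed A} ≤ #{A : Set X | MeasurableSet A} :=
      Cardinal.mk_le_mk_of_subset fun _ hA => IsClosed.measurableSet hA
    _ ≤ 𝔠 := MeasurableSpace.cardinal_measurableSet_le_continuum
      ((Cardinal.mk_le_aleph0_iff.2 (countable_countableBasis X).to_subtype).trans
        Cardinal.aleph0_le_continuum)

theorem mk_eq_continuum_of_equiv {X : Type*} (f : X ≃ (ℕ → Bool)) : #X = 𝔠 := by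
  simpa using Cardinal.lift_mk_eq'.2 ⟨f⟩

variable {C : Type u} [TopologicalSpace C] (e : C ≃ₜ (ℕ → Bool))

/-- The topology `μ` of the theorem: the topology of the graph of `squareHeight`, transferred to the
square. -/
noncomputable abbrev squareTopology : TopologicalSpace (Fin 2 → C) :=
  .induced (fun p => graphMap e (p 0, p 1)) inferInstance

theorem squareTopology_le : squareTopology e ≤ powTopology ‹TopologicalSpace C› 2 := by
  have hind : powTopology ‹TopologicalSpace C› 2 =
      .induced (fun p => (p 0, p 1)) inferInstance :=
    Homeomorph.finTwoArrow.isInducing.eq_induced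
  rw [hind]
  exact (induced_mono continuous_fst.le_induced).trans_eq induced_compose

theorem continuous_partialHeight (n : ℕ) : Continuous (partialHeight e n) :=
  continuous_iff_continuousAt.2 fun x => by
    have hconst : partialHeight e n =ᶠ[𝓝 x] fun _ => partialHeight e n x := by
      filter_upwards [cylinder_mem_nhds (e := e) x n] with y hy
      exact partialHeight_congr hy
    exact continuousAt_const.congr hconst.symm

theorem measurable_height [MeasurableSpace C] [BorelSpace C] : Measurable (height e) :=
  measurable_of_tendsto_metrizable (fun n => (continuous_partialHeight e n).measurable)
    (tendsto_pi_nhds.2 tendsto_partialHeight)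

variable {e}

theorem isClosed_preimage_graphMap_inter {F : Set ((C × C) × ℝ)} (hF : IsClosed F) (n : ℕ) :
    IsClosed (graphMap e ⁻¹' F ∩ {p | p.2 ∉ cylinder e p.1 n}) := by
  have hclopen := isClopen_setOf_notMem_cylinder e n
  rw [← isOpen_compl_iff, isOpen_iff_mem_nhds]
  intro p hp
  by_cases hpn : p.2 ∈ cylinder e p.1 n
  · exact mem_of_superset (hclopen.compl.isOpen.mem_nhds fun h => h hpn)
      (compl_subset_compl.2 inter_subset_right)
  · have hne : p.1 ≠ p.2 := fun heq => hpn (heq ▸ mem_cylinder_self _ _)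
    have hcont : ContinuousAt (graphMap e) p :=
      continuousAt_id.prodMk (continuousAt_squareHeight hne)
    exact mem_of_superset
      (hcont.preimage_mem_nhds (hF.isOpen_compl.mem_nhds fun h => hp ⟨h, hpn⟩))
      (compl_subset_compl.2 inter_subset_left)

theorem exists_notMem_of_not_countable {F : Set ((C × C) × ℝ)} (hF : IsClosed F)
    (h : ¬ {x | graphMap e (x, x) ∈ F}.Countable) {Y : Set C} (hY : #Y < 𝔠) :
    ∃ x, graphMap e (x, x) ∈ F ∧ x ∉ Y := by
  let _ : MeasurableSpace C := borel C
  have : BorelSpace C := ⟨rfl⟩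
  have : PolishSpace Bool := inferInstance
  have : PolishSpace C := e.isClosedEmbedding.polishSpace
  have hdiag : Measurable fun x => graphMap e (x, x) := by
    simp only [graphMap, squareHeight_self]
    exact (measurable_id.prodMk measurable_id).prodMk (measurable_height e)
  have : StandardBorelSpace {x | graphMap e (x, x) ∈ F} :=
    (hdiag hF.measurableSet).standardBorel
  have hcard : #{x | graphMap e (x, x) ∈ F} = 𝔠 :=
    mk_eq_continuum_of_equiv (PolishSpace.measurableEquivNatBoolOfNotCountable h).toEquiv
  by_contra! hsub
  exact hcard.not_lt ((Cardinal.mk_le_mk_of_subset hsub).trans_lt hY)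

theorem isBig_of_isClosed_squareTopology {A : Set (Fin 2 → C)} (hA : IsClosed[squareTopology e] A)
    (h : NUncountable A) : IsBig A := by
  obtain ⟨F, hF, rfl⟩ := isClosed_induced_iff.1 hA
  by_cases hdiag : {x | graphMap e (x, x) ∈ F}.Countable
  swap
  · intro Y hY
    obtain ⟨x, hx, hxY⟩ := exists_notMem_of_not_countable hF hdiag hY
    exact ⟨fun _ => x, hx, fun _ => hxY⟩
  have := e.secondCountableTopology
  have := e.symm.t2Space
  have := e.symm.compactSpace
  let G (n : ℕ) : Set (Fin 2 → C) :=
    (fun p => (p 0, p 1)) ⁻¹' (graphMap e ⁻¹' F ∩ {p | p.2 ∉ cylinder e p.1 n})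
  have hG (n : ℕ) : IsClosed (G n) :=
    (isClosed_preimage_graphMap_inter hF n).preimage (by fun_prop)
  by_cases hn : ∃ n, NUncountable (G n)
  · obtain ⟨n, hn⟩ := hn
    exact (isBig_of_isClosed (hG n) hn).mono fun p hp => hp.1
  have hcover (n : ℕ) : ∃ Y : Set C, Y.Countable ∧ ∀ p ∈ G n, ∃ i, p i ∈ Y := by
    by_contra! hcon
    exact hn ⟨n, nUncountable_of_forall_exists_notMem two_pos hcon⟩
  choose Y hY hGY using hcover
  obtain ⟨p, hp, hpY⟩ := h.exists_notMem (hdiag.union (countable_iUnion hY))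
  by_cases hp01 : p 0 = p 1
  · exact absurd (.inl (by simpa [← hp01] using hp)) (hpY 0)
  · obtain ⟨n, hn⟩ := exists_notMem_cylinder (e := e) hp01
    obtain ⟨i, hi⟩ := hGY n p ⟨hp, hn⟩
    exact absurd (.inr (mem_iUnion.2 ⟨n, hi⟩)) (hpY i)

variable (e)

theorem isAdmissibleSquareTopology :
    IsAdmissibleSquareTopology ‹TopologicalSpace C› (squareTopology e) where
  le_product := squareTopology_le e
  card_closed_le := by
    have := e.secondCountableTopology
    have : @SecondCountableTopology _ (squareTopology e) := secondCountableTopology_induced _ _ _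
    let _ := squareTopology e
    exact (Cardinal.mk_le_mk_of_subset fun _ hA => hA.1).trans mk_setOf_isClosed_le
  le_nCard _ hA h := (isBig_of_isClosed_squareTopology hA h).le_nCard h.pos

/-- The topologies on the powers of `C` to which the Bernstein sets are fitted: the topology `μ` of
the theorem on the square and the product topology on all other powers. -/
noncomputable abbrev refinedPowTopology : ∀ n, TopologicalSpace (Fin n → C)
  | 2 => squareTopology e
  | n => powTopology ‹TopologicalSpace C› n

theorem refinedPowTopology_of_ne {n : ℕ} (hn : n ≠ 2) :
    refinedPowTopology e n = powTopology ‹TopologicalSpace C› n := by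
  unfold refinedPowTopology
  split
  exacts [absurd rfl hn, rfl]

theorem refinedPowTopology_le (n : ℕ) :
    refinedPowTopology e n ≤ powTopology ‹TopologicalSpace C› n := by
  obtain rfl | hn := eq_or_ne n 2
  exacts [squareTopology_le e, (refinedPowTopology_of_ne e hn).le]

theorem secondCountableTopology_refinedPowTopology (n : ℕ) :
    @SecondCountableTopology _ (refinedPowTopology e n) := by
  have := e.secondCountableTopology
  obtain rfl | hn := eq_or_ne n 2
  · exact secondCountableTopology_induced _ _ _
  · rw [refinedPowTopology_of_ne e hn]
    infer_instance

variable {e}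

theorem isBig_of_isClosed_refinedPowTopology {n : ℕ} {A : Set (Fin n → C)}
    (hA : IsClosed[refinedPowTopology e n] A) (h : NUncountable A) : IsBig A := by
  have := e.secondCountableTopology
  have := e.symm.t2Space
  have := e.symm.compactSpace
  obtain rfl | hn := eq_or_ne n 2
  · exact isBig_of_isClosed_squareTopology hA h
  · rw [refinedPowTopology_of_ne e hn] at hA
    exact isBig_of_isClosed hA h

end GraphTopology

section BernsteinFamily

universe u

variable {C : Type u} [TopologicalSpace C] {e : C ≃ₜ (ℕ → Bool)}

/-- Three sets such that every `n`-uncountable closed set contains many points each of whose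
coordinates lies in a prescribed one of them, as long as the prescription does not separate
coordinates that may coincide. -/
def IsBernsteinFamily (e : C ≃ₜ (ℕ → Bool)) (S : Fin 3 → Set C) : Prop :=
  ∀ (n : ℕ) (A : Set (Fin n → C)), IsClosed[refinedPowTopology e n] A → NUncountable A →
    ∀ l : Fin n → Fin 3, (∀ p ∈ A, ∀ i k, p i = p k → l i = l k) →
      IsBig (A ∩ {p | ∀ i, p i ∈ S (l i)})

variable {S : Fin 3 → Set C}

namespace IsBernsteinFamily

theorem isBig (h : IsBernsteinFamily e S) {n : ℕ} {A : Set (Fin n → C)}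
    (hA : IsClosed[refinedPowTopology e n] A) (hA' : NUncountable A) (s : Fin 3) :
    IsBig (A ∩ {p | ∀ i, p i ∈ S s}) :=
  h n A hA hA' (fun _ => s) fun _ _ _ _ _ => rfl

theorem countable_of_disjoint (h : IsBernsteinFamily e S) {s : Fin 3} {A : Set C}
    (hA : IsClosed A) (hAS : Disjoint A (S s)) : A.Countable := by
  by_contra hcon
  have hline : NUncountable ((fun p : Fin 1 → C => p 0) ⁻¹' A) :=
    nUncountable_of_forall_exists_notMem one_pos fun Y hY => by
      obtain ⟨x, hx, hxY⟩ := not_subset.1 fun hsub => hcon (hY.mono hsub)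
      exact ⟨fun _ => x, hx, fun _ => hxY⟩
  obtain ⟨p, hp, hpS⟩ := (h.isBig
    ((hA.preimage (by fun_prop)).mono (refinedPowTopology_le e 1)) hline s).nonempty
  exact disjoint_left.1 hAS hp (hpS 0)

theorem exists_countable_of_disjoint_prod (h : IsBernsteinFamily e S) {s t : Fin 3}
    {A : Set (C × C)} (hA : IsClosed A) (hne : ∀ p ∈ A, p.1 ≠ p.2)
    (hAS : Disjoint A (S s ×ˢ S t)) :
    ∃ Y : Set C, Y.Countable ∧ ∀ p ∈ A, p.1 ∈ Y ∨ p.2 ∈ Y := by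
  by_contra! hcon
  have hsquare : NUncountable ((fun p : Fin 2 → C => (p 0, p 1)) ⁻¹' A) :=
    nUncountable_of_forall_exists_notMem two_pos fun Y hY => by
      obtain ⟨p, hp, hpY⟩ := hcon Y hY
      exact ⟨![p.1, p.2], hp, Fin.forall_fin_two.2 hpY⟩
  obtain ⟨p, hp, hpS⟩ := (h 2 _ ((hA.preimage (by fun_prop)).mono (refinedPowTopology_le e 2))
    hsquare ![s, t] fun p hp => by
      have hp01 : p 0 ≠ p 1 := hne _ hp
      simp [Fin.forall_fin_two, hp01, hp01.symm]).nonempty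
  exact disjoint_left.1 hAS hp ⟨hpS 0, hpS 1⟩

end IsBernsteinFamily

end BernsteinFamily

section Existence

theorem exists_seq_lt {α : Type*} {P : ℕ → α → Prop} {lo hi : α → ℕ}
    (h : ∀ n K, ∃ p, P n p ∧ K ≤ lo p) :
    ∃ w : ℕ → α, (∀ n, P n (w n)) ∧ (∀ n, n ≤ lo (w n)) ∧ ∀ n m, n < m → hi (w n) < lo (w m) := by
  choose p hp hlo using h
  let K (n : ℕ) : ℕ := Nat.rec 0 (fun n k => max k (hi (p n k)) + 1) n
  have hK (n : ℕ) : K (n + 1) = max (K n) (hi (p n (K n))) + 1 := rfl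
  have hmono : StrictMono K := strictMono_nat_of_lt_succ fun n => by rw [hK]; lia
  refine ⟨fun n => p n (K n), fun n => hp n _, fun n => (hmono.id_le n).trans (hlo n _),
    fun n m hnm => ?_⟩
  calc hi (p n (K n)) < K (n + 1) := by rw [hK]; lia
    _ ≤ K m := hmono.monotone hnm
    _ ≤ lo (p m (K m)) := hlo m _

universe u

variable {C : Type u} [TopologicalSpace C] {e : C ≃ₜ (ℕ → Bool)}

theorem exists_alternating_sequence {x : C} {D E : Set (C × C)} (hx : x ∈ diagOverlap e D E)
    (hne : ∀ p ∈ D ∪ E, p.1 ≠ x ∧ p.2 ≠ x) :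
    ∃ w : ℕ → C × C, (∀ n, w n ∈ D ∪ E) ∧ (∃ᶠ n in atTop, w n ∈ D) ∧ (∃ᶠ n in atTop, w n ∈ E) ∧
      Tendsto w atTop (𝓝 (x, x)) ∧
      Tendsto (fun n => squareHeight e (w n)) atTop (𝓝 (height e x)) ∧
      ∀ n m, n ≠ m → splitLevel e (w n).1 x ≠ splitLevel e (w m).2 x := by
  let T (n : ℕ) : Set (C × C) := if Even n then D else E
  have hT (n : ℕ) : T n ⊆ D ∪ E := by
    simp only [T]
    split_ifs
    exacts [subset_union_left, subset_union_right]
  have hcyl {y : C} (hy : y ≠ x) {K : ℕ} : y ∈ cylinder e x K ↔ K ≤ splitLevel e y x := by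
    rw [mem_cylinder_iff hy.symm, splitLevel_comm]
  have hstep (n K : ℕ) : ∃ p, (p ∈ T n ∧ dist (squareHeight e p) (height e x) < 1 / (n + 1 : ℝ)) ∧
      K ≤ min (splitLevel e p.1 x) (splitLevel e p.2 x) := by
    have hclosure : graphMap e (x, x) ∈ closure (graphMap e '' T n) := by
      simp only [T]
      split_ifs
      exacts [hx.1, hx.2]
    obtain ⟨_, ⟨⟨hp₁, hp₂⟩, hp⟩, p, hpT, rfl⟩ := mem_closure_iff_nhds.1 hclosure _
      (prod_mem_nhds (prod_mem_nhds (cylinder_mem_nhds x K) (cylinder_mem_nhds x K))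
        (Metric.ball_mem_nhds _ n.one_div_pos_of_nat))
    obtain ⟨hpx₁, hpx₂⟩ := hne p (hT n hpT)
    rw [squareHeight_self] at hp
    exact ⟨p, ⟨hpT, hp⟩, le_min ((hcyl hpx₁).1 hp₁) ((hcyl hpx₂).1 hp₂)⟩
  obtain ⟨w, hw, hlo, hlt⟩ := exists_seq_lt
    (hi := fun p => max (splitLevel e p.1 x) (splitLevel e p.2 x)) hstep
  have hwx (n : ℕ) := hne _ (hT n (hw n).1)
  refine ⟨w, fun n => hT n (hw n).1, frequently_atTop.2 fun n => ⟨2 * n, by lia, ?_⟩,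
    frequently_atTop.2 fun n => ⟨2 * n + 1, by lia, ?_⟩, ?_, ?_, fun n m hnm => ?_⟩
  · simpa [T] using (hw (2 * n)).1
  · simpa [T] using (hw (2 * n + 1)).1
  · exact (tendsto_of_mem_cylinder tendsto_id fun n =>
        (hcyl (hwx n).1).2 ((hlo n).trans (min_le_left _ _))).prodMk_nhds
      (tendsto_of_mem_cylinder tendsto_id fun n =>
        (hcyl (hwx n).2).2 ((hlo n).trans (min_le_right _ _)))
  · exact tendsto_iff_dist_tendsto_zero.2 (squeeze_zero (fun _ => dist_nonneg)
      (fun n => (hw n).2.le) tendsto_one_div_add_atTop_nhds_zero_nat)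
  · rcases lt_or_gt_of_ne hnm with h | h
    · exact ((le_max_left _ _).trans_lt ((hlt n m h).trans_le (min_le_right _ _))).ne
    · exact ((le_max_right _ _).trans_lt ((hlt m n h).trans_le (min_le_left _ _))).ne'

theorem exists_dense_sequence (e : C ≃ₜ (ℕ → Bool)) {D : Set (C × C)} (hD : D.Nonempty) :
    ∃ d : ℕ → C × C, range d ⊆ D ∧
      closure (graphMap e '' D) ⊆ closure (graphMap e '' range d) := by
  have := e.secondCountableTopology
  have := hD.image (graphMap e) |>.to_subtype
  let u := denseSeq (graphMap e '' D)
  have hmem (n : ℕ) : ∃ p ∈ D, graphMap e p = u n := (u n).2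
  choose d hdD hd using hmem
  refine ⟨d, range_subset_iff.2 hdD, closure_minimal ?_ isClosed_closure⟩
  have hcomp : graphMap e ∘ d = (↑) ∘ u := funext hd
  rw [← range_comp, hcomp, range_comp]
  exact Subtype.dense_iff.1 (denseRange_denseSeq _)

/-- The pairs of sequences in the square that have to be treated in the construction: those whose
lifts to the graph of `squareHeight` accumulate at uncountably many common points of the
diagonal. -/
def OverlapPair (e : C ≃ₜ (ℕ → Bool)) : Type u :=
  {q : (ℕ → C × C) × (ℕ → C × C) // ¬ (diagOverlap e (range q.1) (range q.2)).Countable}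

theorem mk_overlapPair_le (e : C ≃ₜ (ℕ → Bool)) : #(OverlapPair e) ≤ 𝔠 :=
  (Cardinal.mk_subtype_le _).trans (by simp [mk_eq_continuum_of_equiv e.toEquiv])

theorem exists_overlapPair {D E : Set (C × C)} (h : ¬ (diagOverlap e D E).Countable) :
    ∃ q : OverlapPair e, range q.1.1 ⊆ D ∧ range q.1.2 ⊆ E := by
  obtain ⟨x, hxD, hxE⟩ : (diagOverlap e D E).Nonempty :=
    nonempty_iff_ne_empty.2 fun hempty => h (hempty ▸ countable_empty)
  obtain ⟨d, hdD, hd⟩ := exists_dense_sequence e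
    (image_nonempty.1 (closure_nonempty_iff.1 ⟨_, hxD⟩))
  obtain ⟨d', hdE, hd'⟩ := exists_dense_sequence e
    (image_nonempty.1 (closure_nonempty_iff.1 ⟨_, hxE⟩))
  have hsub : diagOverlap e D E ⊆ diagOverlap e (range d) (range d') :=
    fun _ hx => ⟨hd hx.1, hd' hx.2⟩
  exact ⟨⟨(d, d'), fun hc => h (hc.mono hsub)⟩, hdD, hdE⟩

theorem exists_bernsteinFamily (e : C ≃ₜ (ℕ → Bool)) :
    ∃ (S : Fin 3 → Set C) (x : OverlapPair e → C) (rk : C → Ordinal.{u}),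
      Pairwise (Function.onFun Disjoint S) ∧ IsBernsteinFamily e S ∧ Function.Injective x ∧
      ∀ q : OverlapPair e, x q ∈ diagOverlap e (range q.1.1) (range q.1.2) ∧ x q ∈ S 0 ∧
        ∀ p ∈ range q.1.1 ∪ range q.1.2, rk p.1 < rk (x q) ∧ rk p.2 < rk (x q) := by
  let R (q : OverlapPair e) : Set (C × C) := range q.1.1 ∪ range q.1.2
  have hR (q : OverlapPair e) : (R q).Countable := (countable_range _).union (countable_range _)
  obtain ⟨S, x, rk, hS, hx, hbig, hxS, hrk⟩ :=
    exists_bernstein_sets (mk_eq_continuum_of_equiv e.toEquiv)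
      (𝓕 := fun n => {A | IsClosed[refinedPowTopology e n] A})
      (fun n =>
        let _ := refinedPowTopology e n
        have := secondCountableTopology_refinedPowTopology e n
        mk_setOf_isClosed_le)
      (mk_overlapPair_le e) (B := fun q => diagOverlap e (range q.1.1) (range q.1.2))
      (fun q _ => exists_notMem_of_not_countable (isClosed_closure.inter isClosed_closure) q.2)
      (Q := fun q => Prod.fst '' R q ∪ Prod.snd '' R q)
      fun q => ((hR q).image _).union ((hR q).image _)
  exact ⟨S, x, rk, hS, fun n A hA h => hbig n A hA (isBig_of_isClosed_refinedPowTopology hA h), hx,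
    fun q => ⟨(hxS q).1, (hxS q).2, fun p hp =>
      ⟨hrk q _ (.inl (mem_image_of_mem _ hp)), hrk q _ (.inr (mem_image_of_mem _ hp))⟩⟩⟩

theorem exists_bernsteinData (e : C ≃ₜ (ℕ → Bool)) :
    ∃ (S : Fin 3 → Set C) (z : C → ℕ → C × C) (rk : C → Ordinal.{u}),
      Pairwise (Function.onFun Disjoint S) ∧ IsBernsteinFamily e S ∧
      BernsteinData e (S 1) (S 2) z rk := by
  obtain ⟨S, x, rk, hS, hSe, hx, hxq⟩ := exists_bernsteinFamily e
  choose hxD hx0 hrk using hxq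
  choose w hwR hwD hwE hw hwh hsplit using fun q => exists_alternating_sequence (hxD q)
    fun p hp => ⟨ne_of_apply_ne rk (hrk q p hp).1.ne, ne_of_apply_ne rk (hrk q p hp).2.ne⟩
  let z : C → ℕ → C × C := Function.extend x w fun y _ => (y, y)
  have hzx (q : OverlapPair e) : z (x q) = w q := hx.extend_apply _ _ _
  have hz (y : C) : (∃ q, x q = y) ∨ z y = fun _ => (y, y) :=
    or_iff_not_imp_left.2 fun hy => Function.extend_apply' _ _ _ hy
  refine ⟨S, z, rk, hS, hSe, hS (by decide), fun y => ?_, fun y => ?_, fun y => ?_,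
    fun _ => hSe.countable_of_disjoint, fun _ => hSe.countable_of_disjoint,
    fun _ => hSe.exists_countable_of_disjoint_prod, fun D E hDE => ?_⟩
  · obtain ⟨q, rfl⟩ | hy := hz y
    · rw [hzx]
      exact .inr ⟨disjoint_left.1 (hS (by decide)) (hx0 q),
        disjoint_left.1 (hS (by decide)) (hx0 q), fun n => hrk q _ (hwR q n), hsplit q⟩
    · exact .inl fun n => by rw [hy]
  · obtain ⟨q, rfl⟩ | hy := hz y
    · exact (hzx q).symm ▸ hw q
    · exact hy.symm ▸ tendsto_const_nhds
  · obtain ⟨q, rfl⟩ | hy := hz y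
    · exact (hzx q).symm ▸ hwh q
    · simp only [hy, squareHeight_self, tendsto_const_nhds]
  · obtain ⟨q, hqD, hqE⟩ := exists_overlapPair hDE
    refine ⟨x q, ?_, ?_⟩ <;> rw [hzx]
    · exact (hwD q).mono fun _ hn => hqD hn
    · exact (hwE q).mono fun _ hn => hqE hn

end Existence

section Assembly

universe u

variable {C : Type u} [τ : TopologicalSpace C] {e : C ≃ₜ (ℕ → Bool)}

namespace IsBernsteinFamily

variable {S : Fin 3 → Set C}

theorem weaklyBernstein_squareTopology (h : IsBernsteinFamily e S) (s : Fin 3) {B : Set C}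
    (hB : S s ⊆ B) : WeaklyBernstein (squareTopology e) B := fun _ hA hA' =>
  ((h.isBig (n := 2) hA hA' s).mono <| inter_subset_inter_right _ fun _ hp i =>
    hB (hp i)).nCard_eq (mk_eq_continuum_of_equiv e.toEquiv) two_pos

theorem weaklyBernstein_powTopology (h : IsBernsteinFamily e S) (s : Fin 3) {n : ℕ} (hn : 1 ≤ n) :
    WeaklyBernstein (powTopology τ n) (S s) := fun _ hA hA' =>
  (h.isBig (hA.mono (refinedPowTopology_le e n)) hA' s).nCard_eq
    (mk_eq_continuum_of_equiv e.toEquiv) hn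

end IsBernsteinFamily

theorem isBernsteinRefinement_seqTopology {S : Set C} {a : C → ℕ → C} (e : C ≃ₜ (ℕ → Bool))
    {rk : C → Ordinal} (ha : ∀ x, Tendsto (a x) atTop (𝓝 x))
    (hrk : ∀ x, (∀ n, a x n = x) ∨ ∀ n, rk (a x n) < rk x)
    (hcount : ∀ A : Set C, IsClosed A → Disjoint A S → A.Countable)
    (hS : ∀ n, 1 ≤ n → WeaklyBernstein (powTopology τ n) S) :
    IsBernsteinRefinement τ S (seqTopology S a) := by
  have := e.secondCountableTopology
  have := lindelofSpace_seqTopology (a := a) hcount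
  have : Nonempty (Retop (seqTopology S a)) := ⟨e.symm fun _ => false⟩
  have hclopen := isTopologicalBasis_isClopen_seqTopology (S := S) e ha hrk
  exact
    { weaklyBernstein := hS
      refines := seqTopology_le ha
      mem_nhds := fun _ hs _ => mem_nhds_of_mem_nhds_seqTopology hs
      exists_closed_base := ⟨{W | IsOpen[seqTopology S a] W ∧ IsClosed W},
        @isTopologicalBasis_of_isOpen_of_nhds C (seqTopology S a) _ (fun _ hW => hW.1)
          fun x _ hx hU =>
            let ⟨W, hW, hWc, hxW, hWU⟩ := exists_isOpen_seqTopology_isClosed_subset e ha hrk x hU hx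
            ⟨W, ⟨hW, hWc⟩, hxW, hWU⟩,
        fun _ hW => hW.2⟩
      cechDim_eq := cechDim_eq_zero hclopen
      katetovDim_eq := katetovDim_eq_zero hclopen }

theorem IsBernsteinRefinement.isRetractOfFreeAbelian (e : C ≃ₜ (ℕ → Bool)) {S : Set C}
    {σ : TopologicalSpace C} (h : IsBernsteinRefinement τ S σ) :
    IsRetractOfFreeAbelian (Retop σ) := by
  -- Instance search on `C` would otherwise find `σ`.
  let _ := τ
  obtain ⟨𝓑, h𝓑, hclosed⟩ := h.exists_closed_base
  exact isRetractOfFreeAbelian_of_isTopologicalBasis (b := e.toEquiv)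
    (e.continuous.comp (Retop.continuous_toBase h.refines)) h𝓑 fun B hB =>
      e.isInducing.eq_induced ▸ hclosed B hB

namespace BernsteinData

variable {S₁ S₂ : Set C} {z : C → ℕ → C × C} {rk : C → Ordinal.{u}}

theorem t35Space_sum (h : BernsteinData e S₁ S₂ z rk) :
    T35Space (Retop (topFst S₁ z) ⊕ Retop (topSnd S₂ z)) := by
  have := Retop.t2Space e.symm.t2Space h.topFst_le
  have := Retop.t2Space e.symm.t2Space h.topSnd_le
  have := CompletelyRegularSpace.of_isTopologicalBasis_clopens
    (isTopologicalBasis_isClopen_sum h.isTopologicalBasis_isClopen_fst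
      h.isTopologicalBasis_isClopen_snd)
  exact {}

end BernsteinData

namespace IsRetractOfFreeAbelian

variable {X Y : Type*} [TopologicalSpace X] [TopologicalSpace Y]

theorem cechDim_prod_le_freeAbelianTopGroup (hX : IsRetractOfFreeAbelian X)
    (hY : IsRetractOfFreeAbelian Y) :
    cechDim (X × Y) ≤ cechDim (FreeAbelianTopGroup (X ⊕ Y)) :=
  let ⟨_, _, hs, hr, hrs⟩ := hX.exists_leftInverse_freeAbelianTopGroup hY
  cechDim_le_of_leftInverse hs hr hrs

theorem katetovDim_prod_le_freeAbelianTopGroup (hX : IsRetractOfFreeAbelian X)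
    (hY : IsRetractOfFreeAbelian Y) :
    katetovDim (X × Y) ≤ katetovDim (FreeAbelianTopGroup (X ⊕ Y)) :=
  let ⟨_, _, hs, hr, hrs⟩ := hX.exists_leftInverse_freeAbelianTopGroup hY
  katetovDim_le_of_leftInverse hs hr hrs

theorem cechDim_prod_le_freeTopGroup (hX : IsRetractOfFreeAbelian X)
    (hY : IsRetractOfFreeAbelian Y) : cechDim (X × Y) ≤ cechDim (FreeTopGroup (X ⊕ Y)) :=
  let ⟨_, _, hs, hr, hrs⟩ := hX.exists_leftInverse_freeTopGroup hY
  cechDim_le_of_leftInverse hs hr hrs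

theorem katetovDim_prod_le_freeTopGroup (hX : IsRetractOfFreeAbelian X)
    (hY : IsRetractOfFreeAbelian Y) : katetovDim (X × Y) ≤ katetovDim (FreeTopGroup (X ⊕ Y)) :=
  let ⟨_, _, hs, hr, hrs⟩ := hX.exists_leftInverse_freeTopGroup hY
  katetovDim_le_of_leftInverse hs hr hrs

end IsRetractOfFreeAbelian

theorem theorem3_general (e : C ≃ₜ (ℕ → Bool)) :
    ∃ (μ : TopologicalSpace (Fin 2 → C)) (S₁ S₂ : Set C) (τ₁ τ₂ : TopologicalSpace C),
      IsAdmissibleSquareTopology τ μ ∧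
      Disjoint S₁ S₂ ∧
      WeaklyBernstein μ S₁ ∧ WeaklyBernstein μ S₂ ∧ WeaklyBernstein μ (S₁ ∪ S₂)ᶜ ∧
      IsBernsteinRefinement τ S₁ τ₁ ∧
      IsBernsteinRefinement τ S₂ τ₂ ∧
      T4Space (Retop τ₁ × Retop τ₂) ∧
      cechDim (Retop τ₁ × Retop τ₂) = 1 ∧ katetovDim (Retop τ₁ × Retop τ₂) = 1 ∧
      T35Space (Retop τ₁ ⊕ Retop τ₂) ∧ LindelofSpace (Retop τ₁ ⊕ Retop τ₂) ∧
      cechDim (Retop τ₁ ⊕ Retop τ₂) = 0 ∧ katetovDim (Retop τ₁ ⊕ Retop τ₂) = 0 ∧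
      0 < cechDim (FreeAbelianTopGroup (Retop τ₁ ⊕ Retop τ₂)) ∧
      0 < katetovDim (FreeAbelianTopGroup (Retop τ₁ ⊕ Retop τ₂)) ∧
      0 < cechDim (FreeTopGroup (Retop τ₁ ⊕ Retop τ₂)) ∧
      0 < katetovDim (FreeTopGroup (Retop τ₁ ⊕ Retop τ₂)) := by
  obtain ⟨S, z, rk, hS, hB, h⟩ := exists_bernsteinData e
  have h₁ := isBernsteinRefinement_seqTopology e h.tendsto_fst h.eq_or_rk_lt_fst h.countable_fst
    fun _ => hB.weaklyBernstein_powTopology 1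
  have h₂ := isBernsteinRefinement_seqTopology e h.tendsto_snd h.eq_or_rk_lt_snd h.countable_snd
    fun _ => hB.weaklyBernstein_powTopology 2
  have hr₁ := h₁.isRetractOfFreeAbelian e
  have hr₂ := h₂.isRetractOfFreeAbelian e
  have := h.lindelofSpace_fst
  have := h.lindelofSpace_snd
  have : Nonempty (Retop (topFst (S 1) z)) := ⟨e.symm fun _ => false⟩
  have hbasis := isTopologicalBasis_isClopen_sum h.isTopologicalBasis_isClopen_fst
    h.isTopologicalBasis_isClopen_snd
  have hcompl : S 0 ⊆ (S 1 ∪ S 2)ᶜ := subset_compl_iff_disjoint_right.2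
    (disjoint_union_right.2 ⟨hS (by decide), hS (by decide)⟩)
  have hcech := one_pos.trans_eq h.cechDim_prod.symm
  have hkatetov := one_pos.trans_eq h.katetovDim_prod.symm
  exact ⟨squareTopology e, S 1, S 2, topFst (S 1) z, topSnd (S 2) z,
    isAdmissibleSquareTopology e, h.disjoint, hB.weaklyBernstein_squareTopology 1 subset_rfl,
    hB.weaklyBernstein_squareTopology 2 subset_rfl, hB.weaklyBernstein_squareTopology 0 hcompl,
    h₁, h₂, h.t4Space_prod, h.cechDim_prod, h.katetovDim_prod, h.t35Space_sum, inferInstance,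
    cechDim_eq_zero hbasis, katetovDim_eq_zero hbasis,
    hcech.trans_le (hr₁.cechDim_prod_le_freeAbelianTopGroup hr₂),
    hkatetov.trans_le (hr₁.katetovDim_prod_le_freeAbelianTopGroup hr₂),
    hcech.trans_le (hr₁.cechDim_prod_le_freeTopGroup hr₂),
    hkatetov.trans_le (hr₁.katetovDim_prod_le_freeTopGroup hr₂)⟩

end Assembly

theorem theorem3 :
    ∃ (μ : TopologicalSpace (Fin 2 → cantorSet)) (S₁ S₂ : Set cantorSet)
      (τ₁ τ₂ : TopologicalSpace cantorSet),
      -- the construction of the two spaces `C₁ = Retop τ₁` and `C₂ = Retop τ₂`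
      IsAdmissibleSquareTopology cantorTopology μ ∧
      Disjoint S₁ S₂ ∧
      WeaklyBernstein μ S₁ ∧ WeaklyBernstein μ S₂ ∧ WeaklyBernstein μ (S₁ ∪ S₂)ᶜ ∧
      IsBernsteinRefinement cantorTopology S₁ τ₁ ∧
      IsBernsteinRefinement cantorTopology S₂ τ₂ ∧
      T4Space (Retop τ₁ × Retop τ₂) ∧
      cechDim (Retop τ₁ × Retop τ₂) = 1 ∧ katetovDim (Retop τ₁ × Retop τ₂) = 1 ∧
      -- the space `X = C₁ ⊕ C₂` is a Lindelöf Tychonoff space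
      T35Space (Retop τ₁ ⊕ Retop τ₂) ∧ LindelofSpace (Retop τ₁ ⊕ Retop τ₂) ∧
      -- (i)
      cechDim (Retop τ₁ ⊕ Retop τ₂) = 0 ∧ katetovDim (Retop τ₁ ⊕ Retop τ₂) = 0 ∧
      -- (ii)
      0 < cechDim (FreeAbelianTopGroup (Retop τ₁ ⊕ Retop τ₂)) ∧
      0 < katetovDim (FreeAbelianTopGroup (Retop τ₁ ⊕ Retop τ₂)) ∧
      -- (iii)
      0 < cechDim (FreeTopGroup (Retop τ₁ ⊕ Retop τ₂)) ∧
      0 < katetovDim (FreeTopGroup (Retop τ₁ ⊕ Retop τ₂)) :=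
  theorem3_general cantorSetHomeomorphNatToBool
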